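/- **Setting.** For $\xi\in\mathbb R^2$ put $\langle\xi\rangle=(1+|\xi|^2)^{1/2}$. Let $m\in\mathbb R$ and let $a\in S^m$ be a symbol over the periodized unit square: $a(x,\xi)$ is a $C^\infty$ function on $\mathbb R^2\times\mathbb R^2$, $\mathbb Z^2$-periodic in $x$, such that for all multi-indices $\alpha,\beta$ there is a $C_{\alpha\beta}$ with $|\partial_\xi^\alpha\partial_x^\beta a(x,\xi)|\le C_{\alpha\beta}\langle\xi\rangle^{m-|\alpha|}$ for all $x,\xi$. (Proper support is automatic, because the periodized square is compact.) Write $e_\lambda(x)=e^{2\pi i x\cdot\lambda}$, $\hat a_\lambda(\xi)=\int_{[0,1]^2}e^{-2\pi i x\cdot\lambda}a(x,\xi)\,dx$ and $h_\lambda(\xi)=\hat a_\lambda(\xi)\langle\xi\rangle^{-m}$ for $\lambda\in\mathbb Z^2$. A symbol $a$ defines the operator $A f(x)=\sum_{\xi\in\mathbb Z^2}e^{2\pi i x\cdot\xi}a(x,\xi)\hat f(\xi)$, where $\hat f(\xi)$ are the Fourier coefficients of $f$; $H^m([0,1]^2)$ is the periodic Sobolev space with norm $\|f\|_{H^m}^2=\sum_{\xi\in\mathbb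 Z^2}\langle\xi\rangle^{2m}|\hat f(\xi)|^2$; and $P_N$ is the projector onto frequencies with $\max(|\xi_1|,|\xi_2|)\le N$. **Spline interpolation.** Let $p\ge 1$ and $K\ge p+1$ be integers. The spline interpolant of order $p$ on the sites $0,1,\dots,K-1$ is the interpolating function of class $C^{p-1}$ which is piecewise polynomial of degree at most $p$ with the interior knots $\frac{p+1}2+k$, $0\le k\le K-p-2$ (for $p=3$, the usual "not-a-knot" cubic spline). On a $K\times K$ equispaced Cartesian grid of a square (edges included), the spline interpolant is the tensor product one. **Hierarchical spline interpolant.** Fix $B>0$, and for an integer $N\ge 2$ let $L=\max(0,\lceil\log_3(N/B)\rceil)$. Put $D_0=[-B,B]^2$ and, for $1\le j\le L$, $D_j=[-3^jB,3^jB]^2\setminus[-3^{j-1}B,3^{j-1}B]^2$, partitioned into eight squares $D_{j,i}$ of side $2\cdot3^{j-1}B$. For a function $h$ of $\xi$, the interpolant $\tilde h$ equals $h$ at the integer points of $D_0$, and on each $D_{j,i}$ it equals the spline interpolant of order $p$ of $h$ on a $K\times K$ grid of $D_{j,i}$, with $K$ the same for all $j$ and $i$. Equivalently, $\tilde h=\sum_\mu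 h(\xi_\mu)g_\mu$, where the $\xi_\mu$ are the control points (the integer points of $D_0$ and the grid points of all the blocks) and the $g_\mu$ are the cardinal basis functions. A truncated expansion of $a$ is $$\tilde a(x,\xi)=\sum_{\lambda\in(-b,b)^2\cap\mathbb Z^2}e_\lambda(x)\,\tilde h_\lambda(\xi)\,\langle\xi\rangle^{m},$$ where the band $b$ and, for each $\lambda$, the grid size $K=K_\lambda\ge p+1$ used for $\tilde h_\lambda$ are chosen freely; its number of terms is the total number of pairs $(\lambda,\mu)$ with $\lambda\in(-b,b)^2$ and $\mu$ a control point for $\tilde h_\lambda$. **Theorem.** Let $m$, $a$, $p$ and $B$ be as above. There is a constant $C>0$ such that for all integers $N\ge2$ and all $\varepsilon>0$ there are an integer $$M\le C\,\varepsilon^{-2/(p+1)}\log N$$ and a truncated expansion $\tilde a$ of $a$ with at most $M$ terms for which the operators $\tilde A$ and $A$ with symbols $\tilde a$ and $a$ satisfy $$\|(\tilde A-A)P_N\|_{H^m([0,1]^2)\to L^2([0,1]^2)}\le\varepsilon .$$ -/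

import Mathlib

open MeasureTheory

noncomputable section

namespace HierSpline

/-- The Japanese bracket `⟨ξ⟩ = (1 + |ξ|²)^{1/2}` on the plane. -/
def bracket (ξ : ℝ × ℝ) : ℝ := Real.sqrt (1 + ξ.1 ^ 2 + ξ.2 ^ 2)

/-- The partial derivative `∂_ξ^α ∂_x^β a (x, ξ)`, for multi-indices `α` and `β`. -/
def partialDeriv (α β : ℕ × ℕ) (a : ℝ × ℝ → ℝ × ℝ → ℂ) (x ξ : ℝ × ℝ) : ℂ :=
  iteratedDeriv α.1 (fun s₁ => iteratedDeriv α.2 (fun s₂ =>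
    iteratedDeriv β.1 (fun y₁ => iteratedDeriv β.2 (fun y₂ =>
      a (y₁, y₂) (s₁, s₂)) x.2) x.1) ξ.2) ξ.1

/-- The symbol class `S^m` (type `(1,0)`) over the periodized unit square: `a` is smooth,
`ℤ²`-periodic in `x`, and
`|∂_ξ^α ∂_x^β a (x, ξ)| ≤ C_{αβ} ⟨ξ⟩^{m - |α|}` for all multi-indices. -/
structure IsSymbol (m : ℝ) (a : ℝ × ℝ → ℝ × ℝ → ℂ) : Prop where
  smooth : ContDiff ℝ ((⊤ : ℕ∞) : WithTop ℕ∞)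
    (fun z : (ℝ × ℝ) × (ℝ × ℝ) => a z.1 z.2)
  periodic : ∀ (k : ℤ × ℤ) (x ξ : ℝ × ℝ), a (x.1 + k.1, x.2 + k.2) ξ = a x ξ
  estimate : ∀ α β : ℕ × ℕ, ∃ C : ℝ, ∀ x ξ : ℝ × ℝ,
    ‖partialDeriv α β a x ξ‖ ≤ C * bracket ξ ^ (m - ((α.1 : ℝ) + (α.2 : ℝ)))

/-- A point of `ℤ²` seen in the plane. -/
def toPlane (k : ℤ × ℤ) : ℝ × ℝ := ((k.1 : ℝ), (k.2 : ℝ))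

/-- The complex exponential `e_k(x) = e^{2πi x·k}`. -/
def expo (k : ℤ × ℤ) (x : ℝ × ℝ) : ℂ :=
  Complex.exp (2 * (Real.pi : ℂ) * Complex.I * ((x.1 * k.1 + x.2 * k.2 : ℝ) : ℂ))

/-- The unit square `[0,1]²`. -/
def unitSquare : Set (ℝ × ℝ) := Set.Icc (0 : ℝ) 1 ×ˢ Set.Icc (0 : ℝ) 1

/-- The Fourier coefficient in `x`: `â_l(ξ) = ∫_{[0,1]²} e^{-2πi x·l} a(x, ξ) dx`. -/
def xCoeff (a : ℝ × ℝ → ℝ × ℝ → ℂ) (l : ℤ × ℤ) (ξ : ℝ × ℝ) : ℂ :=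
  ∫ x in unitSquare, expo (-l) x * a x ξ

/-- The normalized coefficient `h_{a,l}(ξ) = â_l(ξ) ⟨ξ⟩^{-m}`. -/
def hCoeff (m : ℝ) (a : ℝ × ℝ → ℝ × ℝ → ℂ) (l : ℤ × ℤ) (ξ : ℝ × ℝ) : ℂ :=
  xCoeff a l ξ * ((bracket ξ ^ (-m) : ℝ) : ℂ)

/-! ### Splines in one variable -/

/-- `s` is a spline of degree `p` with simple knots in the set `T`: it is of class `C^{p-1}`, and
a polynomial of degree at most `p` on each open interval that contains no knot. -/
def IsSpline (p : ℕ) (T : Set ℝ) (s : ℝ → ℝ) : Prop :=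
  ContDiff ℝ ((p - 1 : ℕ) : WithTop ℕ∞) s ∧
    ∀ u v : ℝ, u < v → Disjoint (Set.Ioo u v) T →
      ∃ P : Polynomial ℝ, P.natDegree ≤ p ∧ ∀ x ∈ Set.Ioo u v, s x = P.eval x

/-- The `K - p - 1` interior knots used to interpolate at the sites `0, 1, …, K - 1` by splines of
degree `p`: the midpoints of the groups of `p + 2` consecutive sites. For odd `p` this is the
"not-a-knot" choice (for `p = 3`: every site, except for the two at each end, is a knot); for even
`p` the knots lie halfway between sites. -/
def knots (p K : ℕ) : Set ℝ :=
  {t | ∃ k : ℕ, k + p + 1 < K ∧ t = ((p : ℝ) + 1) / 2 + (k : ℝ)}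

/-- `c K q`, for `q < K` and `K ≥ p + 1`, is the cardinal spline of degree `p` on the sites
`0, …, K - 1`: it is `1` at the site `q` and `0` at the other sites. The spline interpolant of data
`y` is `∑ q < K, y q • c K q`. -/
def IsCardinalFamily (p : ℕ) (c : ℕ → ℕ → ℝ → ℝ) : Prop :=
  ∀ K : ℕ, p + 1 ≤ K → ∀ q < K,
    IsSpline p (knots p K) (c K q) ∧
      ∀ r < K, c K q (r : ℝ) = if r = q then 1 else 0

/-! ### The hierarchical construction in the frequency plane

The square `[-B, B]²` is sampled at its integer points. For `j ≥ 0` and `R = 3^j B`, the annulus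
`R < max(|ξ₁|, |ξ₂|) ≤ 3 R` (level `j + 1`) is cut in eight squares of side `2 R`, indexed by the
pairs `i` in `{0,1,2}²` other than `(1,1)`; each carries a `K × K` grid. -/

/-- The three intervals that partition `[-3R, 3R]`. -/
def part (R : ℝ) (i : Fin 3) : Set ℝ :=
  if i = 0 then Set.Ico (-3 * R) (-R) else if i = 1 then Set.Icc (-R) R else Set.Ioc R (3 * R)

/-- The left endpoint of `part R i`. -/
def left (R : ℝ) (i : Fin 3) : ℝ := (2 * ((i : ℕ) : ℝ) - 3) * R

/-- The spacing of `K` equispaced points on an interval of length `2 R`, endpoints included. -/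
def spacing (R : ℝ) (K : ℕ) : ℝ := 2 * R / ((K : ℝ) - 1)

/-- Indices `μ` of the basis functions: an integer point of the central square, or
`(K, j, i, q)`: the grid point `q` of the `K × K` grid on the block `i` of level `j + 1`. -/
abbrev Index : Type := (ℤ × ℤ) ⊕ (ℕ × ℕ × (Fin 3 × Fin 3) × (ℕ × ℕ))

/-- The control point that belongs to an index. -/
def controlPoint (B : ℝ) : Index → ℝ × ℝ
  | Sum.inl ζ => toPlane ζ
  | Sum.inr (K, j, i, q) =>
      (left (3 ^ j * B) i.1 + spacing (3 ^ j * B) K * (q.1 : ℝ),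
        left (3 ^ j * B) i.2 + spacing (3 ^ j * B) K * (q.2 : ℝ))

open Classical in
/-- The basis function `g_μ(ξ)`: point values in the central square, and, in a block, the tensor
product cardinal spline of the grid of that block (zero outside the block). -/
def basisFun (c : ℕ → ℕ → ℝ → ℝ) (B : ℝ) : Index → ℝ × ℝ → ℝ
  | Sum.inl ζ, ξ => if ξ = toPlane ζ then 1 else 0
  | Sum.inr (K, j, i, q), ξ =>
      if ξ.1 ∈ part (3 ^ j * B) i.1 ∧ ξ.2 ∈ part (3 ^ j * B) i.2 then
        c K q.1 ((ξ.1 - left (3 ^ j * B) i.1) / spacing (3 ^ j * B) K) *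
          c K q.2 ((ξ.2 - left (3 ^ j * B) i.2) / spacing (3 ^ j * B) K)
      else 0

/-- The number of levels, `⌈log₃(N / B)⌉` (zero if `N ≤ B`): the least `L` such that
`[-N, N]² ⊆ [-3^L B, 3^L B]²`. -/
def levels (B : ℝ) (N : ℕ) : ℕ := ⌈Real.logb 3 ((N : ℝ) / B)⌉₊

/-- The indices of all control points for `K × K` grids and frequencies up to `N`. -/
def indices (B : ℝ) (N K : ℕ) : Finset Index :=
  (Finset.Icc (-⌊B⌋) ⌊B⌋ ×ˢ Finset.Icc (-⌊B⌋) ⌊B⌋).disjSum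
    (({K} : Finset ℕ) ×ˢ Finset.range (levels B N) ×ˢ
      (Finset.univ.filter fun i : Fin 3 × Fin 3 => i ≠ (1, 1)) ×ˢ
        (Finset.range K ×ˢ Finset.range K))

/-- The retained entries `(l, μ)` of the interaction matrix: the Fourier modes `l` in
`(-b, b)²`, each with the hierarchical spline interpolant on `K l × K l` grids. -/
def retained (B : ℝ) (N b : ℕ) (K : ℤ × ℤ → ℕ) : Finset ((_ : ℤ × ℤ) × Index) :=
  (Finset.Ioo (-(b : ℤ)) b ×ˢ Finset.Ioo (-(b : ℤ)) b).sigma fun l => indices B N (K l)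

/-- The truncated expansion
`ã(x, ξ) = ∑ a_{l,μ} e_l(x) g_μ(ξ) ⟨ξ⟩^m`, over the pairs `(l, μ)` in `S`, where
`a_{l,μ}` is the value of `h_{a,l}` at the control point of `μ`. -/
def expansion (c : ℕ → ℕ → ℝ → ℝ) (B m : ℝ) (a : ℝ × ℝ → ℝ × ℝ → ℂ)
    (S : Finset ((_ : ℤ × ℤ) × Index)) (x ξ : ℝ × ℝ) : ℂ :=
  ∑ w ∈ S, hCoeff m a w.1 (controlPoint B w.2) * expo w.1 x *
    ((basisFun c B w.2 ξ : ℝ) : ℂ) * ((bracket ξ ^ m : ℝ) : ℂ)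

/-! ### Operators -/

/-- The pseudodifferential operator `∑_{ξ ∈ ℤ²} e^{2πi x·ξ} a(x, ξ) f̂(ξ)` with symbol `a`, as a map
from the Fourier coefficients `fhat` of `f` to functions of `x`. -/
def pdo (a : ℝ × ℝ → ℝ × ℝ → ℂ) (fhat : ℤ × ℤ → ℂ) (x : ℝ × ℝ) : ℂ :=
  ∑' k : ℤ × ℤ, expo k x * a x (toPlane k) * fhat k

/-- The projector `P_N` onto frequencies with `max(|ξ₁|, |ξ₂|) ≤ N`. -/
def proj (N : ℕ) (fhat : ℤ × ℤ → ℂ) (k : ℤ × ℤ) : ℂ :=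
  if max |k.1| |k.2| ≤ (N : ℤ) then fhat k else 0

/-- Membership in the periodic Sobolev space `H^m([0,1]²)`, `m` real, through the Fourier
coefficients. -/
def MemSobolev (m : ℝ) (fhat : ℤ × ℤ → ℂ) : Prop :=
  Summable fun k : ℤ × ℤ => bracket (toPlane k) ^ (2 * m) * ‖fhat k‖ ^ 2

/-- The norm of `H^m([0,1]²)`. -/
def sobolevNorm (m : ℝ) (fhat : ℤ × ℤ → ℂ) : ℝ :=
  Real.sqrt (∑' k : ℤ × ℤ, bracket (toPlane k) ^ (2 * m) * ‖fhat k‖ ^ 2)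

/-- `‖T‖_{H^m([0,1]²) → L²([0,1]²)} ≤ ε`. -/
def OpNormLE (m : ℝ) (T : (ℤ × ℤ → ℂ) → ℝ × ℝ → ℂ) (ε : ℝ) : Prop :=
  ∀ fhat : ℤ × ℤ → ℂ, MemSobolev m fhat →
    AEStronglyMeasurable (T fhat) (volume.restrict unitSquare) ∧
      eLpNorm (T fhat) 2 (volume.restrict unitSquare) ≤ ENNReal.ofReal (ε * sobolevNorm m fhat)

end HierSpline

end

noncomputable section

namespace HierSpline

/-! Let `ω_l = (1 + |l₁|)(1 + |l₂|)`. Since `a` is smooth and periodic in `x`, its normalized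
coefficients `h_l` decay faster than any power of `ω_l`. Interpolation in `ξ` commutes with
differentiation and integration in `x`, so the interpolation errors of the `h_l` decay in the same
way.

On a block of size `R` the derivatives of order `p + 1` of a symbol of order zero are
`O(R^{-(p+1)})`, and the spacing is `2R/(K-1)`. The powers of `R` cancel: the spline error is
`O(K^{-(p+1)})` at every level, and covering all frequencies up to `N` costs only a factor `log N`.

Take the band `τ` and `K_l = p + 1 + ⌈τ/ω_l⌉`. Decay of order `ω_l^{-(p+3)}` makes the error of the
coefficient `l` at most a constant times `τ^{-(p+1)} ω_l^{-2}`, inside the band by interpolation and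
outside it because `ω_l ≥ τ` (`IsSymbol.norm_coeffError_le`). Multiplication by `e_l` does not
change the `L²` norm and the remaining factor is a Fourier multiplier, so these bounds add up in
operator norm (`IsSymbol.opNormLE_of_coeffError`). As `∑ ω_l^{-2}` converges, the total error is
`O(τ^{-(p+1)})` and the number of terms `O(τ² log N)` (`card_retained_le`); `τ^{p+1}` proportional
to `1/ε` gives the theorem.

The analytic core is that spline interpolation is stable uniformly in `K` (`exists_cardinalFamily`).
A spline is a polynomial plus truncated powers; differences of order `p + 1` remove the polynomial
and leave a banded symmetric Toeplitz system whose entries are B-spline values. Its symbol is an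
Eulerian polynomial, a combination with positive coefficients of products of `|1+z|²` and `|1-z|²`
on the unit circle (`eulerCoeff_pos`), hence bounded below. A weighted energy estimate turns this
coercivity into a sup-norm bound for the inverses (`exists_toeplitz_inverse_bound`). -/

/-! ### Eulerian polynomials and their positive expansion. -/

open Polynomial in
/-- The numerators of `∑ (n + d)^p z^n = E_p(z) / (1 - z)^{p+1}` (Eulerian polynomials). -/
def eulerPoly (d : ℝ) : ℕ → ℝ[X]
  | 0 => 1
  | p + 1 => (1 - X) * (X * derivative (eulerPoly d p) + C d * eulerPoly d p)
      + C ((p : ℝ) + 1) * X * eulerPoly d p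

-- Raising the exponent by one is the action of `X d/dX + d` on the generating series; the Leibniz
-- rule turns it into the recursion for the numerators.
open PowerSeries in
theorem one_sub_X_pow_mul_mk_eq_eulerPoly (d : ℝ) (p : ℕ) :
    (1 - X : ℝ⟦X⟧) ^ (p + 1) * PowerSeries.mk (fun n : ℕ => ((n : ℝ) + d) ^ p)
      = (eulerPoly d p : ℝ⟦X⟧) := by
  induction p with
  | zero =>
    have := PowerSeries.mk_one_mul_one_sub_eq_one ℝ
    simp only [eulerPoly, pow_zero, zero_add, pow_one, Polynomial.coe_one]
    rw [mul_comm]; exact this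
  | succ p ih =>
    have hW : PowerSeries.mk (fun n : ℕ => ((n : ℝ) + d) ^ (p + 1))
        = X * PowerSeries.derivative ℝ (PowerSeries.mk (fun n : ℕ => ((n : ℝ) + d) ^ p))
          + C d * PowerSeries.mk (fun n : ℕ => ((n : ℝ) + d) ^ p) := by
      ext n
      rcases n with _ | n
      · simp [pow_succ, mul_comm]
      · simp [coeff_succ_X_mul, PowerSeries.coeff_derivative, pow_succ]
        ring
    have hd := congrArg (PowerSeries.derivative ℝ) ih
    rw [Derivation.leibniz, Derivation.leibniz_pow] at hd
    simp only [smul_eq_mul, map_sub, Derivation.map_one_eq_zero, PowerSeries.derivative_X,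
      PowerSeries.derivative_coe, Nat.add_sub_cancel, nsmul_eq_mul] at hd
    rw [hW]
    simp only [eulerPoly, Polynomial.coe_add, Polynomial.coe_mul, Polynomial.coe_sub,
      Polynomial.coe_one, Polynomial.coe_X, Polynomial.coe_C]
    rw [← hd, ← ih]
    simp only [map_add, map_natCast, map_one]
    push_cast
    ring

/-- Coefficients of the expansion of the Eulerian polynomials in powers of `1 + X` and
`-(1 - X)²`. -/
def eulerCoeff (e : ℕ) : ℕ → ℕ → ℝ
  | 0, 0 => 1
  | 0, _ + 1 => 0
  | q + 1, 0 => ((q : ℝ) + e + 1) / 2 * eulerCoeff e q 0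
  | q + 1, j + 1 => ((q : ℝ) - 2 * (j + 1) + e + 1) / 2 * eulerCoeff e q (j + 1)
      + ((q : ℝ) - 2 * j) / 2 * eulerCoeff e q j

theorem eulerCoeff_eq_zero (e q j : ℕ) (h : q < 2 * j) : eulerCoeff e q j = 0 := by
  induction q generalizing j with
  | zero => rcases j with _ | j <;> simp_all [eulerCoeff]
  | succ q ih =>
    rcases j with _ | j
    · simp at h
    · rw [eulerCoeff, ih (j + 1) (by omega)]
      rcases Nat.lt_or_ge q (2 * j) with h' | h'
      · rw [ih j h']; ring
      -- Boundary case: the power of `1 + X` is exhausted and the weight `q - 2j` vanishes.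
      · have : q = 2 * j := by omega
        subst this; push_cast; ring

/-- In this range the weights of the recursion multiply nonnegative coefficients and one of the two
terms is positive. The coercivity of the spline systems comes from here. -/
theorem eulerCoeff_pos (e q j : ℕ) (h : 2 * j ≤ q) : 0 < eulerCoeff e q j := by
  induction q generalizing j with
  | zero => obtain rfl : j = 0 := by omega
            simp [eulerCoeff]
  | succ q ih =>
    rcases j with _ | j
    · rw [eulerCoeff]; have := ih 0 (by omega); positivity
    · rw [eulerCoeff]
      have h1 := ih j (by omega)
      have h2 : (2 * (j : ℝ) + 1) ≤ q := by exact_mod_cast (by omega : 2 * j + 1 ≤ q)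
      have h3 : 0 < ((q : ℝ) - 2 * j) / 2 * eulerCoeff e q j :=
        mul_pos (by linarith) h1
      rcases Nat.lt_or_ge q (2 * (j + 1)) with h' | h'
      · rw [eulerCoeff_eq_zero e q (j + 1) h']; linarith
      · have h4 := ih (j + 1) h'
        have h5 : (2 * ((j : ℝ) + 1)) ≤ q := by exact_mod_cast h'
        have : 0 ≤ ((q : ℝ) - 2 * (j + 1) + e + 1) / 2 * eulerCoeff e q (j + 1) :=
          mul_nonneg (by have : (0:ℝ) ≤ e := by positivity
                         linarith) h4.le
        linarith

-- The shift `d = (1 - e)/2` is the one for which the numerators are palindromic. The recursion then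
-- sends a basis element to just two others, with nonnegative weights.
open Polynomial in
theorem eulerPoly_step_basis (e i j : ℕ) (d : ℝ) (hd : d = (1 - (e : ℝ)) / 2) :
    let f : ℝ[X] := X ^ e * (1 + X) ^ i * (-(1 - X) ^ 2) ^ j
    (1 - X) * (X * derivative f + C d * f) + C (((i + 2 * j + e : ℕ) : ℝ) + 1) * X * f
      = C (((i : ℝ) + e + 1) / 2) * (X ^ e * (1 + X) ^ (i + 1) * (-(1 - X) ^ 2) ^ j)
        + C ((i : ℝ) / 2) * (X ^ e * (1 + X) ^ (i - 1) * (-(1 - X) ^ 2) ^ (j + 1)) := by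
  intro f
  have he : (X : ℝ[X]) * derivative (X ^ e : ℝ[X]) = C (e : ℝ) * X ^ e := by
    rcases e with _ | e
    · simp
    · simp; ring
  have hi : (1 + X : ℝ[X]) * derivative ((1 + X) ^ i : ℝ[X]) = C (i : ℝ) * (1 + X) ^ i := by
    rcases i with _ | i
    · simp
    · simp [derivative_pow]; ring
  have hi' : derivative ((1 + X) ^ i : ℝ[X]) = C (i : ℝ) * (1 + X) ^ (i - 1) := by
    simp [derivative_pow]
  have hj : (1 - X : ℝ[X]) * derivative ((-(1 - X) ^ 2) ^ j : ℝ[X])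
      = - C (2 * j : ℝ) * (-(1 - X) ^ 2) ^ j := by
    rcases j with _ | j
    · simp
    · simp only [derivative_pow, derivative_neg, derivative_sub, derivative_one, derivative_X,
        Nat.add_sub_cancel, C_mul, show (C 2 : ℝ[X]) = 2 from rfl]
      simp only [Nat.cast_add, Nat.cast_one, Nat.cast_ofNat, map_add, map_natCast, map_one,
        show (C 2 : ℝ[X]) = 2 from rfl]
      ring
  have hii : C (i : ℝ) * (1 + X : ℝ[X]) ^ i = C (i : ℝ) * ((1 + X) * (1 + X) ^ (i - 1)) := by
    rcases i with _ | i
    · simp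
    · simp [pow_succ']
  have h2 : (C (1 / 2 : ℝ)) * 2 = (1 : ℝ[X]) := by
    rw [show (2 : ℝ[X]) = C 2 from rfl, ← C_mul]; norm_num
  have hdC : C d = C (1 / 2 : ℝ) * (1 - C (e : ℝ)) := by
    rw [hd, ← C_1, ← C_sub, ← C_mul]; congr 1; ring
  have hc1 : C (((i : ℝ) + e + 1) / 2) = C (1 / 2 : ℝ) * (C (i : ℝ) + C (e : ℝ) + 1) := by
    rw [← C_1, ← C_add, ← C_add, ← C_mul]; congr 1; ring
  have hc2 : C ((i : ℝ) / 2) = C (1 / 2 : ℝ) * C (i : ℝ) := by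
    rw [← C_mul]; congr 1; ring
  have hc3 : C (((i + 2 * j + e : ℕ) : ℝ) + 1) = C (i : ℝ) + 2 * C (j : ℝ) + C (e : ℝ) + 1 := by
    rw [show (((i + 2 * j + e : ℕ) : ℝ) + 1) = (i : ℝ) + 2 * (j : ℝ) + e + 1 by push_cast; ring,
      C_add, C_add, C_add, C_mul, C_1, show (C 2 : ℝ[X]) = 2 from rfl]
  have hj2 : C (2 * j : ℝ) = 2 * C (j : ℝ) := by rw [C_mul]; rfl
  simp only [f, derivative_mul, hi', hdC, hc1, hc2, hc3]
  rw [hj2] at hj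
  rw [pow_succ (1 + X : ℝ[X]) i, pow_succ (-(1 - X) ^ 2 : ℝ[X]) j]
  linear_combination (1 - X) * (1 + X) ^ i * (-(1 - X) ^ 2) ^ j * he
    + X * X ^ e * (1 + X) ^ i * hj
    - X ^ e * (-(1 - X) ^ 2) ^ j * C (1 / 2 : ℝ) * (1 - X) * hii
    - (X ^ e * (1 + X) ^ i * (-(1 - X) ^ 2) ^ j
        * ((1 - X) * C (e : ℝ) + (C (i : ℝ) + C (e : ℝ) + 1) * X)
      + (1 - X) * X * C (i : ℝ) * X ^ e * (1 + X) ^ (i - 1) * (-(1 - X) ^ 2) ^ j) * h2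

open Polynomial in
theorem eulerPoly_eq_sum (e q : ℕ) (he : e ≤ 1) (m : ℕ) (hm : q < m) :
    eulerPoly ((1 - (e : ℝ)) / 2) (q + e) = ∑ j ∈ Finset.range m,
      C (eulerCoeff e q j) * (X ^ e * (1 + X) ^ (q - 2 * j) * (-(1 - X) ^ 2) ^ j) := by
  induction q generalizing m with
  | zero =>
    obtain ⟨m, rfl⟩ : ∃ k, m = k + 1 := ⟨m - 1, by omega⟩
    rw [Finset.sum_range_succ']
    obtain rfl | rfl : e = 0 ∨ e = 1 := by omega
    · simp [eulerPoly, eulerCoeff]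
    · simp [eulerPoly, eulerCoeff]
  | succ q ih =>
    obtain ⟨m, rfl⟩ : ∃ k, m = k + 1 := ⟨m - 1, by omega⟩
    rw [show q + 1 + e = (q + e) + 1 by ring, eulerPoly, ih m (by omega)]
    have key : ∀ j, (1 - X) * (X * derivative (C (eulerCoeff e q j)
          * (X ^ e * (1 + X) ^ (q - 2 * j) * (-(1 - X) ^ 2) ^ j : ℝ[X]))
        + C ((1 - (e : ℝ)) / 2) * (C (eulerCoeff e q j)
          * (X ^ e * (1 + X) ^ (q - 2 * j) * (-(1 - X) ^ 2) ^ j : ℝ[X])))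
        + C (((q + e : ℕ) : ℝ) + 1) * X * (C (eulerCoeff e q j)
          * (X ^ e * (1 + X) ^ (q - 2 * j) * (-(1 - X) ^ 2) ^ j : ℝ[X]))
        = C (((q : ℝ) - 2 * j + e + 1) / 2 * eulerCoeff e q j)
            * (X ^ e * (1 + X) ^ (q + 1 - 2 * j) * (-(1 - X) ^ 2) ^ j)
          + C (((q : ℝ) - 2 * j) / 2 * eulerCoeff e q j)
            * (X ^ e * (1 + X) ^ (q + 1 - 2 * (j + 1)) * (-(1 - X) ^ 2) ^ (j + 1)) := by
      intro j
      rcases Nat.lt_or_ge q (2 * j) with h | h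
      · simp [eulerCoeff_eq_zero e q j h]
      · obtain ⟨i, rfl⟩ := Nat.exists_eq_add_of_le h
        have := eulerPoly_step_basis e i j _ rfl
        rw [show 2 * j + i - 2 * j = i by omega, show 2 * j + i + 1 - 2 * j = i + 1 by omega,
          show 2 * j + i + 1 - 2 * (j + 1) = i - 1 by omega,
          show 2 * j + i + e = i + 2 * j + e by ring, derivative_C_mul, C_mul, C_mul,
          show ((2 * j + i : ℕ) : ℝ) - 2 * j = i by push_cast; ring]
        linear_combination C (eulerCoeff e (2 * j + i) j) * this
    simp only [derivative_sum, Finset.mul_sum, ← Finset.sum_add_distrib]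
    rw [Finset.sum_congr rfl fun j _ => key j, Finset.sum_add_distrib]
    rw [Finset.sum_range_succ']
    have h0 : ∑ j ∈ Finset.range m, C (((q : ℝ) - 2 * j + e + 1) / 2 * eulerCoeff e q j)
            * (X ^ e * (1 + X) ^ (q + 1 - 2 * j) * (-(1 - X) ^ 2) ^ j : ℝ[X])
        = ∑ j ∈ Finset.range m, C (((q : ℝ) - 2 * (j + 1 : ℕ) + e + 1) / 2 * eulerCoeff e q (j + 1))
            * (X ^ e * (1 + X) ^ (q + 1 - 2 * (j + 1)) * (-(1 - X) ^ 2) ^ (j + 1) : ℝ[X])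
          + C (((q : ℝ) - 2 * (0 : ℕ) + e + 1) / 2 * eulerCoeff e q 0)
            * (X ^ e * (1 + X) ^ (q + 1 - 2 * 0) * (-(1 - X) ^ 2) ^ 0 : ℝ[X]) := by
      rw [← Finset.sum_range_succ' (fun j => C (((q : ℝ) - 2 * j + e + 1) / 2 * eulerCoeff e q j)
            * (X ^ e * (1 + X) ^ (q + 1 - 2 * j) * (-(1 - X) ^ 2) ^ j : ℝ[X])),
        Finset.sum_range_succ, eulerCoeff_eq_zero e q m (by omega)]
      simp
    rw [h0, add_right_comm, ← Finset.sum_add_distrib]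
    congr 1
    · refine Finset.sum_congr rfl fun j _ => ?_
      rw [← add_mul, ← C_add, eulerCoeff]
      push_cast
      rfl
    · rw [eulerCoeff]; simp

/-! ### Positivity of Laurent polynomials on the unit circle, in algebraic form -/

open LaurentPolynomial in
/-- A Laurent polynomial `f` is of positive type if the quadratic form
`V ↦ [f V(z) V(1/z)]_0` is nonnegative. -/
def IsPosType (f : ℝ[T;T⁻¹]) : Prop :=
  ∀ V : ℝ[T;T⁻¹], 0 ≤ (f * (V * invert V)).coeff 0

section PosType
open LaurentPolynomial

theorem coeff_zero_mul_invert (V : ℝ[T;T⁻¹]) :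
    (V * invert V).coeff 0 = V.coeff.sum fun _ a => a ^ 2 := by
  rw [AddMonoidAlgebra.coeff_mul]
  refine Finsupp.sum_congr fun k _ => ?_
  rw [Finsupp.sum, Finset.sum_congr rfl fun n _ => if_congr (show k + n = 0 ↔ n = -k by omega) rfl rfl,
    Finset.sum_ite_eq']
  by_cases h : V.coeff k = 0 <;> simp [h, sq]

theorem coeff_mul_T (f : ℝ[T;T⁻¹]) (k n : ℤ) : (f * T k).coeff n = f.coeff (n - k) := by
  have := AddMonoidAlgebra.coeff_mul_single_add f (1 : ℝ) k (n - k)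
  rwa [sub_add_cancel, mul_one] at this

theorem isPosType_one : IsPosType 1 := fun V => by
  rw [one_mul, coeff_zero_mul_invert]
  exact Finset.sum_nonneg fun _ _ => sq_nonneg _

theorem IsPosType.mul_norm {f : ℝ[T;T⁻¹]} (hf : IsPosType f) (W : ℝ[T;T⁻¹]) :
    IsPosType (f * (W * invert W)) := fun V => by
  have := hf (W * V)
  rw [map_mul] at this
  rwa [show W * V * (invert W * invert V) = W * invert W * (V * invert V) by ring,
    ← mul_assoc] at this

theorem IsPosType.mul_norm_pow {f : ℝ[T;T⁻¹]} (hf : IsPosType f) (W : ℝ[T;T⁻¹]) (n : ℕ) :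
    IsPosType (f * (W * invert W) ^ n) := by
  induction n with
  | zero => simpa
  | succ n ih => rw [pow_succ, ← mul_assoc]; exact ih.mul_norm W

theorem IsPosType.C_mul {f : ℝ[T;T⁻¹]} (hf : IsPosType f) {r : ℝ} (hr : 0 ≤ r) :
    IsPosType (C r * f) := fun V => by
  rw [mul_assoc, ← smul_eq_C_mul]
  exact mul_nonneg hr (hf V)

theorem isPosType_sum {ι : Type*} (s : Finset ι) (f : ι → ℝ[T;T⁻¹]) (hf : ∀ i ∈ s, IsPosType (f i)) :
    IsPosType (∑ i ∈ s, f i) := fun V => by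
  rw [Finset.sum_mul]
  have : (∑ i ∈ s, f i * (V * invert V)).coeff 0 = ∑ i ∈ s, (f i * (V * invert V)).coeff 0 := by
    simp
  rw [this]
  exact Finset.sum_nonneg fun i hi => hf i hi V

/-- `∑ a_j U^{n-j} D^j - r` is of positive type for some `r > 0`, if `U + D = 4` and `U`, `D` are
norms. -/
theorem exists_pos_isPosType_sub (u w : ℝ[T;T⁻¹]) (h4 : w * invert w + u * invert u = C 4)
    (n : ℕ) (a : ℕ → ℝ) (ha : ∀ j ≤ n, 0 < a j) :
    ∃ r : ℝ, 0 < r ∧ IsPosType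
      (∑ j ∈ Finset.range (n + 1), C (a j) *
        ((u * invert u) ^ (n - j) * (w * invert w) ^ j) - C r) := by
  obtain ⟨r, hr, hle⟩ : ∃ r : ℝ, 0 < r ∧ ∀ j ∈ Finset.range (n + 1),
      r * (n.choose j / 4 ^ n) ≤ a j := by
    have hne : (Finset.range (n + 1)).Nonempty := ⟨0, by simp⟩
    obtain ⟨j₀, hj₀, hmin⟩ :=
      Finset.exists_min_image _ (fun j => a j / ((n.choose j : ℝ) / 4 ^ n)) hne
    have hpos : ∀ j ∈ Finset.range (n + 1), (0 : ℝ) < n.choose j / 4 ^ n := fun j hj => by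
      have : 0 < n.choose j := Nat.choose_pos (by simpa [Nat.lt_succ_iff] using hj)
      positivity
    refine ⟨a j₀ / (n.choose j₀ / 4 ^ n), div_pos (ha _ (by simpa [Nat.lt_succ_iff] using hj₀))
      (hpos _ hj₀), fun j hj => ?_⟩
    rw [← le_div_iff₀ (hpos j hj)]
    exact hmin j hj
  refine ⟨r, hr, ?_⟩
  have hC : (C r : ℝ[T;T⁻¹]) = ∑ j ∈ Finset.range (n + 1), C (r * (n.choose j / 4 ^ n)) *
        ((u * invert u) ^ (n - j) * (w * invert w) ^ j) := by
    have h := add_pow (w * invert w) (u * invert u) n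
    rw [h4] at h
    have h' : (C r : ℝ[T;T⁻¹]) = C (r / 4 ^ n) * C 4 ^ n := by
      rw [← map_pow, ← map_mul]
      exact congrArg _ (div_mul_cancel₀ r (by positivity)).symm
    rw [h', h, Finset.mul_sum]
    refine Finset.sum_congr rfl fun j _ => ?_
    rw [show r * (n.choose j / 4 ^ n) = r / 4 ^ n * n.choose j by ring, map_mul C,
      map_natCast C]
    generalize w * invert w = D
    generalize u * invert u = U
    ring
  rw [hC, ← Finset.sum_sub_distrib]
  refine isPosType_sum _ _ fun j hj => ?_
  rw [← sub_mul, ← map_sub]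
  refine IsPosType.C_mul ?_ (sub_nonneg.2 (hle j hj))
  have := (isPosType_one.mul_norm_pow u (n - j)).mul_norm_pow w j
  rwa [one_mul] at this

theorem norm_one_sub_T_add_norm_one_add_T :
    (1 - T 1) * invert (1 - T 1) + (1 + T 1) * invert (1 + T 1) = (C 4 : ℝ[T;T⁻¹]) := by
  have hT : (T 1 : ℝ[T;T⁻¹]) * T (-1) = 1 := by rw [← T_add]; simp
  have hC : (C 4 : ℝ[T;T⁻¹]) = 4 := map_ofNat C 4
  rw [hC]
  simp only [map_sub, map_add, map_one, invert_T]
  linear_combination 2 * hT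
end PosType

/-! ### B-spline values at the integers and coercivity of their Toeplitz matrices. -/

/-- The `(p+1)`-st difference of the truncated power `x ↦ (x - (p + 1) / 2)₊^p` at `d`: up to the
factor `p!`, the value at the integer `d` of the centred cardinal B-spline of degree `p`. -/
def bsplineVal (p : ℕ) (d : ℤ) : ℝ :=
  ∑ i ∈ Finset.range (p + 2), (-1) ^ i * ((p + 1).choose i : ℝ) *
    max ((d : ℝ) + (p + 1) - i - ((p : ℝ) + 1) / 2) 0 ^ p

theorem coeff_eulerPoly (d : ℝ) (p m : ℕ) : (eulerPoly d p).coeff m =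
    ∑ i ∈ Finset.range (m + 1), (-1) ^ i * ((p + 1).choose i : ℝ) * (((m - i : ℕ) : ℝ) + d) ^ p := by
  have h := congrArg (PowerSeries.coeff m) (one_sub_X_pow_mul_mk_eq_eulerPoly d p)
  rw [Polynomial.coeff_coe] at h
  rw [← h, PowerSeries.coeff_mul, Finset.Nat.sum_antidiagonal_eq_sum_range_succ_mk]
  refine Finset.sum_congr rfl fun i _ => ?_
  rw [PowerSeries.coeff_mk]
  congr 1
  have : (1 - PowerSeries.X : PowerSeries ℝ) ^ (p + 1)
      = (((1 + Polynomial.X : Polynomial ℝ) ^ (p + 1)).comp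
          (Polynomial.C (-1) * Polynomial.X) : Polynomial ℝ) := by
    simp [sub_eq_add_neg]
  rw [this, Polynomial.coeff_coe, Polynomial.comp_C_mul_X_coeff, Polynomial.coeff_one_add_X_pow,
    mul_comm]

/-- For `p = 2n + e` the base of the truncated power is `m - i + (1 - e)/2`, so the truncation
removes exactly the indices `i > m`, as the convolution does. -/
theorem bsplineVal_eq_coeff (n e : ℕ) (he : e ≤ 1) (hp : 1 ≤ 2 * n + e) (m : ℕ) :
    bsplineVal (2 * n + e) ((m : ℤ) - (n + e)) =
      (eulerPoly ((1 - (e : ℝ)) / 2) (2 * n + e)).coeff m := by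
  rw [coeff_eulerPoly]
  have h1 : bsplineVal (2 * n + e) ((m : ℤ) - (n + e))
      = ∑ i ∈ Finset.range (m + (2 * n + e + 2)), (-1) ^ i * ((2 * n + e + 1).choose i : ℝ) *
          max ((m : ℝ) - i + (1 - (e : ℝ)) / 2) 0 ^ (2 * n + e) := by
    rw [bsplineVal]
    rw [Finset.sum_subset (Finset.range_mono (Nat.le_add_left (2 * n + e + 2) m))]
    · refine Finset.sum_congr rfl fun i _ => ?_
      congr 3
      push_cast; ring
    · intro i _ hi
      rw [Nat.choose_eq_zero_of_lt (by have := Finset.mem_range.not.1 hi; omega)]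
      simp
  rw [h1]
  symm
  rw [show ∑ i ∈ Finset.range (m + 1), (-1) ^ i * ((2 * n + e + 1).choose i : ℝ) *
        (((m - i : ℕ) : ℝ) + (1 - (e : ℝ)) / 2) ^ (2 * n + e)
      = ∑ i ∈ Finset.range (m + 1), (-1) ^ i * ((2 * n + e + 1).choose i : ℝ) *
          max ((m : ℝ) - i + (1 - (e : ℝ)) / 2) 0 ^ (2 * n + e) from ?_]
  · refine Finset.sum_subset (Finset.range_mono (by omega)) fun i _ hi => ?_
    have hi' : (m : ℝ) + 1 ≤ i := by
      have : m + 1 ≤ i := by simpa using hi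
      exact_mod_cast this
    have he' : (0 : ℝ) ≤ e := by positivity
    rw [max_eq_right (by linarith), zero_pow (by omega), mul_zero]
  · refine Finset.sum_congr rfl fun i hi => ?_
    have hi' : i ≤ m := by simpa [Nat.lt_succ_iff] using hi
    have he' : (e : ℝ) ≤ 1 := by exact_mod_cast he
    have hi2 : (i : ℝ) ≤ m := by exact_mod_cast hi'
    rw [max_eq_left (by linarith), Nat.cast_sub hi']

theorem bsplineVal_eq_zero_of_lt (n e : ℕ) (hp : 1 ≤ 2 * n + e) (d : ℤ) (hd : d < -(n + e)) :
    bsplineVal (2 * n + e) d = 0 := by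
  refine Finset.sum_eq_zero fun i _ => ?_
  have : (d : ℝ) ≤ -(n + e) - 1 := by exact_mod_cast (by omega : d ≤ -(n + e) - 1)
  have he' : (0 : ℝ) ≤ e := by positivity
  have hi : (0 : ℝ) ≤ i := by positivity
  rw [max_eq_right (by push_cast; linarith), zero_pow (by omega), mul_zero]

-- On the unit circle `(1+z)²/z = |1+z|²` and `-(1-z)²/z = |1-z|²`. Dividing the Eulerian polynomial
-- by `z^{n+e}` therefore leaves a positive combination of products of squared moduli, which is
-- invariant under `z ↦ 1/z`.
open LaurentPolynomial in
theorem exists_laurent_bsplineVal (p : ℕ) (hp : 1 ≤ p) :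
    ∃ f : ℝ[T;T⁻¹], (∀ d, f.coeff d = bsplineVal p d) ∧ invert f = f ∧
      ∃ r : ℝ, 0 < r ∧ IsPosType (f - C r) := by
  obtain ⟨n, e, he, rfl⟩ : ∃ n e, e ≤ 1 ∧ p = 2 * n + e :=
    ⟨p / 2, p % 2, by omega, by omega⟩
  obtain ⟨r, hr, hpos⟩ := exists_pos_isPosType_sub (1 + T 1) (1 - T 1)
    norm_one_sub_T_add_norm_one_add_T n (eulerCoeff e (2 * n))
    fun j hj => eulerCoeff_pos _ _ _ (by omega)
  refine ⟨_, fun d => ?_, ?_, r, hr, hpos⟩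
  · set f := ∑ j ∈ Finset.range (n + 1), C (eulerCoeff e (2 * n) j) *
        (((1 + T 1) * invert (1 + T 1)) ^ (n - j) * ((1 - T 1) * invert (1 - T 1) : ℝ[T;T⁻¹]) ^ j)
    have hT : (T 1 : ℝ[T;T⁻¹]) * T (-1) = 1 := by rw [← T_add]; simp
    have hU : ((1 + T 1) * invert (1 + T 1)) * T 1 = ((1 + T 1) ^ 2 : ℝ[T;T⁻¹]) := by
      simp only [map_add, map_one, invert_T]
      linear_combination (1 + T 1) * hT
    have hD : ((1 - T 1) * invert (1 - T 1)) * T 1 = (-(1 - T 1) ^ 2 : ℝ[T;T⁻¹]) := by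
      simp only [map_sub, map_one, invert_T]
      linear_combination -(1 - T 1) * hT
    have hE : Polynomial.toLaurent (eulerPoly ((1 - (e : ℝ)) / 2) (2 * n + e)) = f * T (n + e) := by
      rw [eulerPoly_eq_sum e (2 * n) he (2 * n + 1) (by omega),
        ← Finset.sum_subset (Finset.range_mono (by omega : n + 1 ≤ 2 * n + 1)), map_sum,
        Finset.sum_mul]
      · refine Finset.sum_congr rfl fun j hj => ?_
        have hj' : j ≤ n := by simpa [Nat.lt_succ_iff] using hj
        simp only [map_mul, map_pow, map_add Polynomial.toLaurent, map_neg,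
          map_sub Polynomial.toLaurent, map_one, Polynomial.toLaurent_C, Polynomial.toLaurent_X]
        rw [← hD, show 2 * n - 2 * j = 2 * (n - j) by omega, pow_mul, ← hU]
        have h1 : (T ((n : ℤ) + e) : ℝ[T;T⁻¹]) = T 1 ^ e * (T 1 ^ (n - j) * T 1 ^ j) := by
          rw [← pow_add, ← pow_add, T_pow]
          congr 1
          omega
        rw [h1]
        generalize (1 + T 1 : ℝ[T;T⁻¹]) * invert (1 + T 1) = U
        generalize (1 - T 1 : ℝ[T;T⁻¹]) * invert (1 - T 1) = D
        ring
      · intro j _ hj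
        rw [eulerCoeff_eq_zero e (2 * n) j (by simp at hj; omega)]
        simp
    have hf : f = Polynomial.toLaurent (eulerPoly ((1 - (e : ℝ)) / 2) (2 * n + e)) * T (-(n + e)) := by
      rw [hE, mul_assoc, ← T_add]; simp
    rw [hf, coeff_mul_T]
    rcases lt_or_ge d (-(n + e)) with h | h
    · rw [bsplineVal_eq_zero_of_lt n e hp d h]
      rw [coeff_toLaurent]
      refine Finsupp.mapDomain_of_notMem_range _ _ ?_
      rintro ⟨k, hk⟩
      simp only [Nat.castEmbedding_apply] at hk
      omega
    · obtain ⟨m, rfl⟩ : ∃ m : ℕ, d = m - (n + e) := ⟨(d + (n + e)).toNat, by omega⟩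
      rw [bsplineVal_eq_coeff n e he hp, show (m : ℤ) - (n + e) - -(n + e) = m by ring,
        coeff_toLaurent]
      exact Finsupp.mapDomain_apply Nat.castEmbedding.injective _ m
  · rw [map_sum]
    refine Finset.sum_congr rfl fun j _ => ?_
    simp only [map_mul, map_pow, invert_C]
    rw [show invert (invert (1 + T 1 : ℝ[T;T⁻¹])) = 1 + T 1 from involutive_invert _,
      show invert (invert (1 - T 1 : ℝ[T;T⁻¹])) = 1 - T 1 from involutive_invert _]
    ring

theorem bsplineVal_neg (p : ℕ) (hp : 1 ≤ p) (d : ℤ) : bsplineVal p (-d) = bsplineVal p d := by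
  obtain ⟨f, hf, hinv, -⟩ := exists_laurent_bsplineVal p hp
  rw [← hf, ← hf, ← LaurentPolynomial.invert_apply, hinv]

open LaurentPolynomial in
/-- The Toeplitz matrices of the values of B-splines are uniformly positive definite. -/
theorem exists_bsplineVal_coercive (p : ℕ) (hp : 1 ≤ p) : ∃ r : ℝ, 0 < r ∧
    ∀ (M : ℕ) (v : Fin M → ℝ), r * ∑ k, v k ^ 2 ≤
      ∑ k : Fin M, ∑ l : Fin M, bsplineVal p ((k : ℤ) - (l : ℤ)) * v k * v l := by
  obtain ⟨f, hf, -, r, hr, hpos⟩ := exists_laurent_bsplineVal p hp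
  refine ⟨r, hr, fun M v => ?_⟩
  -- Tested on `V = ∑ v_k T^k`, positive type becomes a statement on the Toeplitz quadratic form.
  have h := hpos (∑ k, C (v k) * T (k : ℤ))
  have hexp : ∀ g : ℝ[T;T⁻¹], (g * ((∑ k, C (v k) * T (k : ℤ)) *
      invert (∑ k, C (v k) * T (k : ℤ)))).coeff 0
      = ∑ k : Fin M, ∑ l : Fin M, g.coeff ((k : ℤ) - (l : ℤ)) * v k * v l := by
    intro g
    rw [map_sum, Finset.sum_mul_sum, Finset.mul_sum, AddMonoidAlgebra.coeff_sum,
      Finsupp.finsetSum_apply, Finset.sum_comm]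
    have h1 : ∀ k : Fin M, (g * ∑ l : Fin M, C (v k) * T (k : ℤ) * invert (C (v l) * T (l : ℤ))).coeff 0
        = ∑ l : Fin M, g.coeff ((l : ℤ) - (k : ℤ)) * v l * v k := by
      intro k
      rw [Finset.mul_sum, AddMonoidAlgebra.coeff_sum, Finsupp.finsetSum_apply]
      refine Finset.sum_congr rfl fun l _ => ?_
      rw [map_mul, invert_C, invert_T, show g * (C (v k) * T (k : ℤ) * (C (v l) * T (-(l : ℤ))))
        = C (v k * v l) * (g * T ((k : ℤ) - l)) by rw [T_sub, map_mul]; ring,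
        ← smul_eq_C_mul, AddMonoidAlgebra.coeff_smul, Finsupp.smul_apply, coeff_mul_T, smul_eq_mul,
        show (0 : ℤ) - (k - l) = l - k by ring]
      ring
    exact Finset.sum_congr rfl fun k _ => h1 k
  rw [hexp] at h
  have h0 : ∀ k l : Fin M, (f - C r).coeff ((k : ℤ) - (l : ℤ)) * v k * v l
      = bsplineVal p ((k : ℤ) - (l : ℤ)) * v k * v l - if k = l then r * v k * v l else 0 := by
    intro k l
    rw [AddMonoidAlgebra.coeff_sub, Finsupp.sub_apply, hf, C_apply]
    have : ((k : ℤ) - (l : ℤ) = 0) ↔ k = l := by rw [sub_eq_zero, Fin.ext_iff]; omega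
    by_cases hkl : k = l <;> simp [this, hkl]
    ring
  simp only [h0, Finset.sum_sub_distrib, Finset.sum_ite_eq, Finset.mem_univ, if_true] at h
  rw [Finset.mul_sum]
  have : ∑ k, r * v k ^ 2 = ∑ k, r * v k * v k := Finset.sum_congr rfl fun k _ => by ring
  linarith

/-! ### Uniform boundedness of inverses of banded, positive definite Toeplitz matrices -/

theorem sum_fin_sub_le_tsum (g : ℤ → ℝ) (hg : ∀ d, 0 ≤ g d) (hs : Summable g) (M : ℕ) (k : ℤ) :
    ∑ l : Fin M, g (k - l) ≤ ∑' d, g d := by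
  have hinj : Function.Injective (fun l : Fin M => k - (l : ℤ)) := fun a b h => by
    simp only [sub_right_inj, Nat.cast_inj] at h
    exact Fin.ext h
  have := tsum_comp_le_tsum_of_inj hs hg hinj
  rwa [tsum_fintype] at this

theorem summable_pow_natAbs {ρ : ℝ} (h0 : 0 ≤ ρ) (h1 : ρ < 1) :
    Summable fun d : ℤ => ρ ^ d.natAbs := by
  apply Summable.of_nat_of_neg
  · simpa using summable_geometric_of_lt_one h0 h1
  · simpa using summable_geometric_of_lt_one h0 h1

/-- Geometric weights vary slowly: within the bandwidth `n` the squared difference is small relative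
to the product. This is the form in which the commutator below is absorbed. -/
theorem sub_sq_pow_le {ρ η : ℝ} {n : ℕ} (h0 : 0 < ρ) (h1 : ρ < 1) (hη : 0 ≤ η)
    (h : (1 - ρ ^ n) ^ 2 ≤ η * ρ ^ n)
    {a b : ℕ} (hab : a ≤ b) (hb : b ≤ a + n) : (ρ ^ a - ρ ^ b) ^ 2 ≤ η * (ρ ^ a * ρ ^ b) := by
  obtain ⟨t, rfl⟩ := Nat.exists_eq_add_of_le hab
  have ht : ρ ^ n ≤ ρ ^ t := pow_le_pow_of_le_one h0.le h1.le (by omega)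
  have ht1 : ρ ^ t ≤ 1 := pow_le_one₀ h0.le h1.le
  have h2 : (1 - ρ ^ t) ^ 2 ≤ (1 - ρ ^ n) ^ 2 := by
    apply pow_le_pow_left₀ <;> linarith
  have h3 : (1 - ρ ^ t) ^ 2 ≤ η * ρ ^ t := h2.trans (h.trans (mul_le_mul_of_nonneg_left ht hη))
  have := mul_le_mul_of_nonneg_left h3 (sq_nonneg (ρ ^ a))
  rw [pow_add]
  nlinarith

/-- At `ρ = 1` the inequality is strict, so by continuity it persists for some `ρ < 1`. -/
theorem exists_rate {η : ℝ} (hη : 0 < η) (n : ℕ) :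
    ∃ ρ : ℝ, 0 < ρ ∧ ρ < 1 ∧ (1 - ρ ^ n) ^ 2 ≤ η * ρ ^ n := by
  have hc : Continuous fun ρ : ℝ => η * ρ ^ n - (1 - ρ ^ n) ^ 2 := by fun_prop
  have h1 : ∀ᶠ ρ in nhds (1 : ℝ), 0 < η * ρ ^ n - (1 - ρ ^ n) ^ 2 :=
    hc.continuousAt.eventually (lt_mem_nhds (by simpa using hη))
  have h2 : ∀ᶠ ρ in nhds (1 : ℝ), 0 < ρ := lt_mem_nhds one_pos
  obtain ⟨ρ, ⟨h, h'⟩, h''⟩ := (((h1.and h2).filter_mono nhdsWithin_le_nhds).and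
    (self_mem_nhdsWithin : Set.Iio (1 : ℝ) ∈ nhdsWithin 1 (Set.Iio 1))).exists
  exact ⟨ρ, h', h'', by linarith⟩

/-- A commutator identity: by symmetry of `b`, both copies of the weight can be moved to one side at
the cost of the squared differences of the weight. -/
theorem weighted_energy_identity {ι : Type*} [Fintype ι] (b : ι → ι → ℝ) (hb : ∀ k l, b k l = b l k)
    (w c : ι → ℝ) :
    ∑ k, ∑ l, b k l * (w k * c k) * (w l * c l) = ∑ k, w k ^ 2 * c k * ∑ l, b k l * c l
      - 1 / 2 * ∑ k, ∑ l, b k l * c k * c l * (w k - w l) ^ 2 := by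
  have h : ∑ k, w k ^ 2 * c k * ∑ l, b k l * c l
      = ∑ k, ∑ l, b k l * c k * c l * w k ^ 2 := by
    refine Finset.sum_congr rfl fun k _ => ?_
    rw [Finset.mul_sum]
    exact Finset.sum_congr rfl fun l _ => by ring
  have h' : ∑ k, w k ^ 2 * c k * ∑ l, b k l * c l
      = ∑ k, ∑ l, b k l * c k * c l * w l ^ 2 := by
    rw [h, Finset.sum_comm]
    exact Finset.sum_congr rfl fun k _ => Finset.sum_congr rfl fun l _ => by rw [hb l k]; ring
  have h2 : ∑ k, w k ^ 2 * c k * ∑ l, b k l * c l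
      = 1 / 2 * ∑ k, ∑ l, b k l * c k * c l * w k ^ 2
        + 1 / 2 * ∑ k, ∑ l, b k l * c k * c l * w l ^ 2 := by
    rw [← h, ← h']; ring
  rw [h2, ← mul_add, ← mul_sub]
  simp only [← Finset.sum_add_distrib, ← Finset.sum_sub_distrib, Finset.mul_sum]
  exact Finset.sum_congr rfl fun k _ => Finset.sum_congr rfl fun l _ => by ring

/-- Coercivity gives only `ℓ²` bounds, which grow with `M`. Applied to `w c` with `w = ρ^{|k₀ - k|}`
it localizes at `k₀`: the data contribute at most `D² ∑ w²`, bounded independently of `M`, and the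
commutator is absorbed when `ρ` is near `1`. -/
theorem exists_toeplitz_inverse_bound (b : ℤ → ℝ) (hsymm : ∀ d, b (-d) = b d) (n : ℕ)
    (hband : ∀ d : ℤ, n < d.natAbs → b d = 0) (r : ℝ) (hr : 0 < r)
    (hcoer : ∀ (M : ℕ) (v : Fin M → ℝ), r * ∑ k, v k ^ 2 ≤
      ∑ k : Fin M, ∑ l : Fin M, b ((k : ℤ) - (l : ℤ)) * v k * v l) :
    ∃ C : ℝ, 0 < C ∧ ∀ (M : ℕ) (c : Fin M → ℝ) (D : ℝ),
      (∀ k : Fin M, |∑ l : Fin M, b ((k : ℤ) - (l : ℤ)) * c l| ≤ D) → ∀ k, |c k| ≤ C * D := by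
  have hbs : Summable fun d => |b d| := by
    refine summable_of_ne_finset_zero (s := Finset.Icc (-(n : ℤ)) n) fun d hd => ?_
    rw [hband d (by simp only [Finset.mem_Icc] at hd; omega), abs_zero]
  set b₁ := ∑' d, |b d| with hb₁
  have hb₁0 : 0 ≤ b₁ := tsum_nonneg fun d => abs_nonneg _
  -- With `η b₁ ≤ r` the commutator, which enters with the factor `1/2`, uses at most half of the
  -- coercivity.
  set η := r / (b₁ + 1) with hη
  have hη0 : 0 < η := by positivity
  have hηb : η * b₁ ≤ r := by
    rw [hη, div_mul_eq_mul_div, div_le_iff₀ (by positivity)]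
    nlinarith
  obtain ⟨ρ, hρ0, hρ1, hρ⟩ := exists_rate hη0 n
  have hws : Summable fun d : ℤ => (ρ ^ 2) ^ d.natAbs :=
    summable_pow_natAbs (by positivity) (by nlinarith)
  set S := ∑' d : ℤ, (ρ ^ 2) ^ d.natAbs with hS
  have hS0 : 0 ≤ S := tsum_nonneg fun d => by positivity
  refine ⟨2 / r * Real.sqrt (S + 1), by positivity, fun M c D hD k₀ => ?_⟩
  have hD0 : 0 ≤ D := (abs_nonneg _).trans (hD k₀)
  set w : Fin M → ℝ := fun k => ρ ^ ((k₀ : ℤ) - (k : ℤ)).natAbs with hw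
  have hw0 : ∀ k, 0 < w k := fun k => by positivity
  have hid := weighted_energy_identity (fun k l : Fin M => b ((k : ℤ) - (l : ℤ)))
    (fun k l => by rw [← hsymm]; ring_nf) w c
  have hco := hcoer M (fun k => w k * c k)
  rw [hid] at hco
  set Q := ∑ k, (w k * c k) ^ 2 with hQ
  have hcomm : |∑ k : Fin M, ∑ l : Fin M, b ((k : ℤ) - (l : ℤ)) * c k * c l * (w k - w l) ^ 2|
      ≤ r * Q := by
    have h1 : ∀ k l : Fin M, |b ((k : ℤ) - (l : ℤ)) * c k * c l * (w k - w l) ^ 2|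
        ≤ η / 2 * (|b ((k : ℤ) - (l : ℤ))| * (w k * c k) ^ 2)
          + η / 2 * (|b ((l : ℤ) - (k : ℤ))| * (w l * c l) ^ 2) := by
      intro k l
      rw [show |b ((l : ℤ) - (k : ℤ))| = |b ((k : ℤ) - (l : ℤ))| by
        rw [← hsymm ((k : ℤ) - l)]; ring_nf]
      rcases lt_or_ge n ((k : ℤ) - (l : ℤ)).natAbs with h | h
      · rw [hband _ h]; simp
      · have hsq : (w k - w l) ^ 2 ≤ η * (w k * w l) := by
          rcases le_total ((k₀ : ℤ) - (k : ℤ)).natAbs ((k₀ : ℤ) - (l : ℤ)).natAbs with h' | h'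
          · exact sub_sq_pow_le hρ0 hρ1 hη0.le hρ h' (by omega)
          · have := sub_sq_pow_le hρ0 hρ1 hη0.le hρ h' (by omega)
            simp only [hw]
            linarith [sub_sq_comm (ρ ^ ((k₀ : ℤ) - (k : ℤ)).natAbs) (ρ ^ ((k₀ : ℤ) - (l : ℤ)).natAbs),
              mul_comm (ρ ^ ((k₀ : ℤ) - (k : ℤ)).natAbs) (ρ ^ ((k₀ : ℤ) - (l : ℤ)).natAbs)]
        rw [abs_mul, abs_mul, abs_mul, abs_of_nonneg (sq_nonneg (w k - w l))]
        calc |b ((k : ℤ) - (l : ℤ))| * |c k| * |c l| * (w k - w l) ^ 2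
            ≤ |b ((k : ℤ) - (l : ℤ))| * |c k| * |c l| * (η * (w k * w l)) := by gcongr
          _ = η * |b ((k : ℤ) - (l : ℤ))| * ((w k * |c k|) * (w l * |c l|)) := by ring
          _ ≤ η * |b ((k : ℤ) - (l : ℤ))| * (((w k * |c k|) ^ 2 + (w l * |c l|) ^ 2) / 2) := by
              gcongr
              nlinarith [sq_nonneg (w k * |c k| - w l * |c l|)]
          _ = _ := by rw [mul_pow, mul_pow, sq_abs, sq_abs]; ring
    have h2 : ∑ k : Fin M, ∑ l : Fin M, |b ((k : ℤ) - (l : ℤ))| * (w k * c k) ^ 2 ≤ b₁ * Q := by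
      rw [hQ, Finset.mul_sum]
      refine Finset.sum_le_sum fun k _ => ?_
      rw [← Finset.sum_mul]
      gcongr
      exact sum_fin_sub_le_tsum (fun d => |b d|) (fun d => abs_nonneg _) hbs M k
    calc _ ≤ ∑ k : Fin M, ∑ l : Fin M, |b ((k : ℤ) - (l : ℤ)) * c k * c l * (w k - w l) ^ 2| :=
          (Finset.abs_sum_le_sum_abs _ _).trans
            (Finset.sum_le_sum fun k _ => Finset.abs_sum_le_sum_abs _ _)
      _ ≤ ∑ k : Fin M, ∑ l : Fin M, (η / 2 * (|b ((k : ℤ) - (l : ℤ))| * (w k * c k) ^ 2)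
          + η / 2 * (|b ((l : ℤ) - (k : ℤ))| * (w l * c l) ^ 2)) :=
          Finset.sum_le_sum fun k _ => Finset.sum_le_sum fun l _ => h1 k l
      _ = η * ∑ k : Fin M, ∑ l : Fin M, |b ((k : ℤ) - (l : ℤ))| * (w k * c k) ^ 2 := by
          simp only [Finset.sum_add_distrib]
          rw [Finset.sum_comm (f := fun k l : Fin M =>
            η / 2 * (|b ((l : ℤ) - (k : ℤ))| * (w l * c l) ^ 2))]
          simp only [← Finset.mul_sum]
          ring
      _ ≤ η * (b₁ * Q) := by gcongr
      _ ≤ r * Q := by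
          rw [← mul_assoc]
          exact mul_le_mul_of_nonneg_right hηb (Finset.sum_nonneg fun k _ => sq_nonneg _)
  have hdata : ∑ k : Fin M, w k ^ 2 * c k * ∑ l : Fin M, b ((k : ℤ) - (l : ℤ)) * c l
      ≤ r / 4 * Q + D ^ 2 / r * S := by
    have h1 : ∀ k : Fin M, w k ^ 2 * c k * ∑ l : Fin M, b ((k : ℤ) - (l : ℤ)) * c l
        ≤ r / 4 * (w k * c k) ^ 2 + D ^ 2 / r * (ρ ^ 2) ^ ((k₀ : ℤ) - (k : ℤ)).natAbs := by
      intro k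
      have e : (ρ ^ 2) ^ ((k₀ : ℤ) - (k : ℤ)).natAbs = w k ^ 2 := by rw [hw, ← pow_mul, ← pow_mul, mul_comm]
      rw [e]
      set d := ∑ l : Fin M, b ((k : ℤ) - (l : ℤ)) * c l
      have hd : d ^ 2 ≤ D ^ 2 := sq_le_sq' (abs_le.1 (hD k)).1 (abs_le.1 (hD k)).2
      have : w k ^ 2 * c k * d ≤ r / 4 * (w k * c k) ^ 2 + d ^ 2 / r * w k ^ 2 := by
        have h := sq_nonneg (r / 2 * (w k * c k) - d * w k)
        have h3 : r / 4 * (w k * c k) ^ 2 + d ^ 2 / r * w k ^ 2 - w k ^ 2 * c k * d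
            = (r / 2 * (w k * c k) - d * w k) ^ 2 / r := by
          field_simp; ring
        have h4 : 0 ≤ (r / 2 * (w k * c k) - d * w k) ^ 2 / r := by positivity
        linarith
      refine this.trans ?_
      gcongr
    refine (Finset.sum_le_sum fun k _ => h1 k).trans ?_
    rw [Finset.sum_add_distrib, ← Finset.mul_sum, ← Finset.mul_sum]
    gcongr
    exact sum_fin_sub_le_tsum (fun d => (ρ ^ 2) ^ d.natAbs) (fun d => by positivity) hws M k₀
  have hQle : Q ≤ 4 / r ^ 2 * D ^ 2 * S := by
    have h1 := neg_abs_le (∑ k : Fin M, ∑ l : Fin M, b ((k : ℤ) - (l : ℤ)) * c k * c l * (w k - w l) ^ 2)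
    -- From `r Q ≤ (r/4) Q + D² S / r + (r/2) Q`.
    have h2 : r / 4 * Q ≤ D ^ 2 / r * S := by linarith
    have h3 : Q = 4 / r * (r / 4 * Q) := by field_simp
    calc Q = 4 / r * (r / 4 * Q) := h3
      _ ≤ 4 / r * (D ^ 2 / r * S) := by gcongr
      _ = _ := by field_simp
  have hk₀ : c k₀ ^ 2 ≤ Q := by
    have := Finset.single_le_sum (f := fun k => (w k * c k) ^ 2) (fun k _ => sq_nonneg _)
      (Finset.mem_univ k₀)
    simpa [hw] using this
  apply abs_le_of_sq_le_sq _ (by positivity)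
  rw [mul_pow, mul_pow, Real.sq_sqrt (by positivity)]
  have h5 : 0 ≤ 4 / r ^ 2 * D ^ 2 := by positivity
  calc c k₀ ^ 2 ≤ 4 / r ^ 2 * D ^ 2 * S := hk₀.trans hQle
    _ ≤ 4 / r ^ 2 * D ^ 2 * (S + 1) := by nlinarith
    _ = _ := by ring

theorem exists_toeplitz_solution (b : ℤ → ℝ) (r : ℝ) (hr : 0 < r) (M : ℕ)
    (hcoer : ∀ (v : Fin M → ℝ), r * ∑ k, v k ^ 2 ≤
      ∑ k : Fin M, ∑ l : Fin M, b ((k : ℤ) - (l : ℤ)) * v k * v l) (d : Fin M → ℝ) :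
    ∃ c : Fin M → ℝ, ∀ k : Fin M, ∑ l : Fin M, b ((k : ℤ) - (l : ℤ)) * c l = d k := by
  let A : Matrix (Fin M) (Fin M) ℝ := Matrix.of fun k l => b ((k : ℤ) - (l : ℤ))
  have hinj : Function.Injective A.mulVecLin := by
    rw [injective_iff_map_eq_zero]
    intro v hv
    have h := hcoer v
    have h0 : ∑ k : Fin M, ∑ l : Fin M, b ((k : ℤ) - (l : ℤ)) * v k * v l = 0 := by
      refine Finset.sum_eq_zero fun k _ => ?_
      have hk : ∑ l : Fin M, b ((k : ℤ) - (l : ℤ)) * v l = 0 := congrFun hv k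
      calc _ = v k * ∑ l : Fin M, b ((k : ℤ) - (l : ℤ)) * v l := by
            rw [Finset.mul_sum]; exact Finset.sum_congr rfl fun l _ => by ring
        _ = 0 := by rw [hk, mul_zero]
    rw [h0] at h
    have h1 : ∑ k, v k ^ 2 = 0 :=
      le_antisymm (nonpos_of_mul_nonpos_right h hr) (Finset.sum_nonneg fun k _ => sq_nonneg _)
    funext k
    have := (Finset.sum_eq_zero_iff_of_nonneg fun k _ => sq_nonneg (v k)).1 h1 k (Finset.mem_univ k)
    simpa using this
  obtain ⟨c, hc⟩ := (LinearMap.injective_iff_surjective.1 hinj) d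
  exact ⟨c, fun k => congrFun hc k⟩

theorem exists_bandwidth_bsplineVal (p : ℕ) (hp : 1 ≤ p) :
    ∃ n : ℕ, ∀ d : ℤ, n < d.natAbs → bsplineVal p d = 0 := by
  obtain ⟨f, hf, -⟩ := exists_laurent_bsplineVal p hp
  refine ⟨f.coeff.support.sup Int.natAbs, fun d hd => ?_⟩
  rw [← hf]
  by_contra h
  exact absurd (Finset.le_sup (f := Int.natAbs) (Finsupp.mem_support_iff.2 h)) (not_le.2 hd)

theorem exists_bsplineVal_inverse_bound (p : ℕ) (hp : 1 ≤ p) :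
    ∃ C : ℝ, 0 < C ∧ ∀ (M : ℕ) (c : Fin M → ℝ) (D : ℝ),
      (∀ k : Fin M, |∑ l : Fin M, bsplineVal p ((k : ℤ) - (l : ℤ)) * c l| ≤ D) →
        ∀ k, |c k| ≤ C * D := by
  obtain ⟨n, hn⟩ := exists_bandwidth_bsplineVal p hp
  obtain ⟨r, hr, h⟩ := exists_bsplineVal_coercive p hp
  exact exists_toeplitz_inverse_bound _ (bsplineVal_neg p hp) n hn r hr h

theorem exists_bsplineVal_solution (p : ℕ) (hp : 1 ≤ p) (M : ℕ) (d : Fin M → ℝ) :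
    ∃ c : Fin M → ℝ, ∀ k : Fin M, ∑ l : Fin M, bsplineVal p ((k : ℤ) - (l : ℤ)) * c l = d k := by
  obtain ⟨r, hr, h⟩ := exists_bsplineVal_coercive p hp
  exact exists_toeplitz_solution _ r hr M (h M) d

/-! ### Truncated power splines -/

/-- Differentiation lowers the degree of a truncated power by one, at the origin too as long as the
degree is at least two; the base case is continuity. -/
theorem contDiff_max_pow (n : ℕ) : ContDiff ℝ n (fun x : ℝ => max x 0 ^ (n + 1)) := by
  have hderiv : ∀ (n : ℕ) (x : ℝ),
      HasDerivAt (fun x : ℝ => max x 0 ^ (n + 2)) ((n + 2 : ℝ) * max x 0 ^ (n + 1)) x := by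
    intro n x
    rcases lt_trichotomy x 0 with h | h | h
    · have h1 : (fun x : ℝ => max x 0 ^ (n + 2)) =ᶠ[nhds x] fun _ => 0 := by
        filter_upwards [gt_mem_nhds h] with y hy
        rw [max_eq_right hy.le]; simp
      rw [max_eq_right h.le]
      simpa using (hasDerivAt_const x (0 : ℝ)).congr_of_eventuallyEq h1
    · subst h
      have : HasDerivAt (fun x : ℝ => max x 0 ^ (n + 2)) 0 0 := by
        rw [hasDerivAt_iff_isLittleO]
        simp only [max_self, ne_eq, Nat.add_eq_zero_iff, OfNat.ofNat_ne_zero, and_false,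
          not_false_eq_true, zero_pow, sub_zero, smul_eq_mul, mul_zero]
        have h1 : (fun x : ℝ => max x 0 ^ (n + 2)) =O[nhds 0] fun x : ℝ => x ^ (n + 2) := by
          refine Asymptotics.IsBigO.of_bound 1 (Filter.Eventually.of_forall fun y => ?_)
          rw [norm_pow, norm_pow, one_mul]
          refine pow_le_pow_left₀ (norm_nonneg _) ?_ _
          rw [Real.norm_eq_abs, Real.norm_eq_abs, abs_of_nonneg (le_max_right _ _)]
          exact max_le (le_abs_self _) (abs_nonneg _)
        refine h1.trans_isLittleO ?_
        simpa using Asymptotics.isLittleO_pow_id (𝕜 := ℝ) (n := n + 2) (by omega)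
      simpa using this
    · have h1 : (fun x : ℝ => max x 0 ^ (n + 2)) =ᶠ[nhds x] fun x => x ^ (n + 2) := by
        filter_upwards [lt_mem_nhds h] with y hy
        rw [max_eq_left hy.le]
      rw [max_eq_left h.le]
      simpa using (hasDerivAt_pow (n + 2) x).congr_of_eventuallyEq h1
  induction n with
  | zero => exact contDiff_zero.2 (by fun_prop)
  | succ n ih =>
    rw [show ((n + 1 : ℕ) : WithTop ℕ∞) = (n : WithTop ℕ∞) + 1 by push_cast; rfl,
      contDiff_succ_iff_deriv]
    refine ⟨fun x => (hderiv n x).differentiableAt, fun h => absurd h (by simp), ?_⟩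
    rw [funext fun x => (hderiv n x).deriv]
    exact contDiff_const.mul ih

/-- The knot number `k`. -/
def knot (p k : ℕ) : ℝ := ((p : ℝ) + 1) / 2 + k

/-- The spline with polynomial part `P` and coefficients `c` of the truncated powers. -/
def truncSpline (p : ℕ) {M : ℕ} (P : Polynomial ℝ) (c : Fin M → ℝ) (x : ℝ) : ℝ :=
  P.eval x + ∑ k, c k * max (x - knot p k) 0 ^ p

theorem isSpline_truncSpline {p K : ℕ} (hp : 1 ≤ p) {P : Polynomial ℝ} (hP : P.natDegree ≤ p)
    (c : Fin (K - p - 1) → ℝ) : IsSpline p (knots p K) (truncSpline p P c) := by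
  constructor
  · have h : ContDiff ℝ ((p - 1 : ℕ) : WithTop ℕ∞) fun x : ℝ => max x 0 ^ p := by
      obtain ⟨n, rfl⟩ : ∃ n, p = n + 1 := ⟨p - 1, by omega⟩
      exact contDiff_max_pow n
    have hPc : ContDiff ℝ ((p - 1 : ℕ) : WithTop ℕ∞) fun x : ℝ => P.eval x := by
      simpa using P.contDiff_aeval (𝕜 := ℝ) ((p - 1 : ℕ) : WithTop ℕ∞)
    refine hPc.add ?_
    exact ContDiff.sum fun k _ => contDiff_const.mul (h.comp (contDiff_id.sub contDiff_const))
  · intro u v _ hdisj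
    refine ⟨P + ∑ k : Fin (K - p - 1), if knot p k ≤ u then Polynomial.C (c k) *
      (Polynomial.X - Polynomial.C (knot p k)) ^ p else 0, ?_, fun x hx => ?_⟩
    · refine (Polynomial.natDegree_add_le _ _).trans (max_le hP ?_)
      refine Polynomial.natDegree_sum_le_of_forall_le _ _ fun k _ => ?_
      split_ifs
      · refine (Polynomial.natDegree_C_mul_le _ _).trans ?_
        refine (Polynomial.natDegree_pow_le).trans ?_
        rw [Polynomial.natDegree_X_sub_C, mul_one]
      · simp
    · rw [truncSpline, Polynomial.eval_add, Polynomial.eval_finsetSum]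
      congr 1
      refine Finset.sum_congr rfl fun k _ => ?_
      have hk : knot p k ∉ Set.Ioo u v := fun h =>
        Set.disjoint_left.1 hdisj h ⟨k, by have := k.2; omega, rfl⟩
      split_ifs with hku
      · rw [max_eq_left (by linarith [hx.1])]; simp
      · have : v ≤ knot p k := by
          by_contra hv
          exact hk ⟨not_le.1 hku, not_le.1 hv⟩
        rw [max_eq_right (by linarith [hx.2]), zero_pow (by omega)]; simp

/-! ### Existence of interpolating splines through differences of order `p + 1`. -/

/-- The forward difference of order `p + 1`. -/
def fdiff (p : ℕ) (y : ℕ → ℝ) (r : ℕ) : ℝ :=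
  ∑ i ∈ Finset.range (p + 2), (-1) ^ (p + 1 - i) * ((p + 1).choose i : ℝ) * y (r + i)

theorem fdiff_add (p : ℕ) (y z : ℕ → ℝ) (r : ℕ) :
    fdiff p (fun n => y n + z n) r = fdiff p y r + fdiff p z r := by
  simp only [fdiff, ← Finset.sum_add_distrib, mul_add]

theorem fdiff_sub (p : ℕ) (y z : ℕ → ℝ) (r : ℕ) :
    fdiff p (fun n => y n - z n) r = fdiff p y r - fdiff p z r := by
  simp only [fdiff, ← Finset.sum_sub_distrib, mul_sub]

theorem fdiff_polynomial {p : ℕ} {P : Polynomial ℝ} (hP : P.natDegree ≤ p) (r : ℕ) :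
    fdiff p (fun n => P.eval (n : ℝ)) r = 0 := by
  have h := congrFun (Polynomial.fwdDiff_iter_eq_zero_of_degree_lt (Nat.lt_succ_of_le hP)) (r : ℝ)
  rw [fwdDiff_iter_eq_sum_shift] at h
  simpa [fdiff] using h

/-- The two sums differ by the reflection `i ↦ p + 1 - i`. Interpolation thereby becomes a Toeplitz
system for the coefficients of the truncated powers. -/
theorem fdiff_max_pow (p : ℕ) (k r : ℕ) :
    fdiff p (fun n => max ((n : ℝ) - knot p k) 0 ^ p) r = bsplineVal p ((r : ℤ) - k) := by
  rw [fdiff, ← Finset.sum_range_reflect, bsplineVal]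
  refine Finset.sum_congr rfl fun i hi => ?_
  have hi' : i ≤ p + 1 := by have := Finset.mem_range.1 hi; omega
  rw [show p + 2 - 1 - i = p + 1 - i by omega, Nat.sub_sub_self hi', Nat.choose_symm hi', knot,
    Nat.cast_add, Nat.cast_sub hi']
  congr 3
  push_cast; ring

theorem fdiff_truncSpline {p M : ℕ} {P : Polynomial ℝ} (hP : P.natDegree ≤ p) (c : Fin M → ℝ)
    (r : ℕ) : fdiff p (fun n => truncSpline p P c n) r
      = ∑ k : Fin M, bsplineVal p ((r : ℤ) - (k : ℤ)) * c k := by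
  simp only [truncSpline]
  rw [fdiff_add, fdiff_polynomial hP, zero_add]
  simp only [← fdiff_max_pow, fdiff, Finset.mul_sum, Finset.sum_mul]
  rw [Finset.sum_comm]
  exact Finset.sum_congr rfl fun k _ => Finset.sum_congr rfl fun l _ => by ring

/-- The leading coefficient of the difference is `1`, so vanishing differences form a recursion
started by `p + 1` zeros. -/
theorem fdiff_eq_zero_imp {p K : ℕ} {z : ℕ → ℝ} (h0 : ∀ i ≤ p, z i = 0)
    (hz : ∀ r, r + p + 1 < K → fdiff p z r = 0) : ∀ i < K, z i = 0 := by
  intro i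
  induction i using Nat.strong_induction_on with
  | _ i ih =>
    intro hi
    rcases Nat.lt_or_ge p i with h | h
    · obtain ⟨r, rfl⟩ : ∃ r, i = r + (p + 1) := ⟨i - (p + 1), by omega⟩
      have := hz r (by omega)
      rw [fdiff, Finset.sum_range_succ, Finset.sum_eq_zero] at this
      · simpa using this
      · intro j hj
        have := Finset.mem_range.1 hj
        rw [ih (r + j) (by omega) (by omega), mul_zero]
    · exact h0 i h

theorem injOn_natCast_add (r n : ℕ) :
    Set.InjOn (fun i : ℕ => ((r + i : ℕ) : ℝ)) (Finset.range n : Set ℕ) := fun a _ b _ h => by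
  have : r + a = r + b := Nat.cast_injective (R := ℝ) h
  omega

/-- The coefficients `c` match the differences of the data; `P` then corrects the values at the
first `p + 1` sites, and the recursion gives all the others. -/
theorem exists_truncSpline_interpolating {p K : ℕ} (hp : 1 ≤ p) (y : ℕ → ℝ) :
    ∃ (P : Polynomial ℝ) (c : Fin (K - p - 1) → ℝ), P.natDegree ≤ p ∧
      ∀ i < K, truncSpline p P c i = y i := by
  obtain ⟨c, hc⟩ := exists_bsplineVal_solution p hp (K - p - 1) fun r => fdiff p y r
  set g : ℕ → ℝ := fun n => ∑ k, c k * max ((n : ℝ) - knot p k) 0 ^ p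
  set P := Lagrange.interpolate (Finset.range (p + 1)) (fun i : ℕ => ((0 + i : ℕ) : ℝ))
    (fun i => y i - g i) with hPdef
  have hP : P.natDegree ≤ p := by
    have := Lagrange.degree_interpolate_lt (fun i => y i - g i) (injOn_natCast_add 0 (p + 1))
    rw [Finset.card_range, ← hPdef] at this
    rw [Polynomial.natDegree_le_iff_degree_le]
    exact Order.le_of_lt_succ (by exact_mod_cast this)
  refine ⟨P, c, hP, fun i hi => ?_⟩
  have hz := fdiff_eq_zero_imp (p := p) (K := K) (z := fun n => truncSpline p P c n - y n)
    (fun i hi => ?_) (fun r hr => ?_) i hi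
  · linarith
  · have := Lagrange.eval_interpolate_at_node (fun i => y i - g i) (injOn_natCast_add 0 (p + 1))
      (Finset.mem_range.2 (Nat.lt_succ_of_le hi))
    rw [← hPdef, zero_add] at this
    rw [truncSpline, this]
    ring
  · rw [fdiff_sub, fdiff_truncSpline hP, hc ⟨r, by omega⟩, sub_self]

/-! ### Local stability of spline interpolation and its order of approximation. -/

/-- Distinct nodes are at least `1` apart and all are within `p` of `x`, so each Lagrange basis
polynomial is at most `p^p`. -/
theorem abs_eval_le_of_abs_eval_nodes_le {p r : ℕ} {R : Polynomial ℝ} (hR : R.natDegree ≤ p) {A : ℝ}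
    (hA : ∀ i ≤ p, |R.eval ((r + i : ℕ) : ℝ)| ≤ A) {x : ℝ} (hx : x ∈ Set.Icc (r : ℝ) (r + p)) :
    |R.eval x| ≤ (p + 1) * p ^ p * A := by
  have hdeg : R.degree < (Finset.range (p + 1)).card := by
    rw [Finset.card_range]
    exact lt_of_le_of_lt (Polynomial.natDegree_le_iff_degree_le.1 hR) (by exact_mod_cast Nat.lt_succ_self p)
  rw [Lagrange.eq_interpolate (injOn_natCast_add r (p + 1)) hdeg, Lagrange.interpolate_apply,
    Polynomial.eval_finsetSum]
  have hb : ∀ i ∈ Finset.range (p + 1), |(Polynomial.C (R.eval ((r + i : ℕ) : ℝ)) *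
      Lagrange.basis (Finset.range (p + 1)) (fun i : ℕ => ((r + i : ℕ) : ℝ)) i).eval x| ≤ p ^ p * A := by
    intro i hi
    rw [Polynomial.eval_mul, Polynomial.eval_C, abs_mul, mul_comm]
    have hi' : i ≤ p := Nat.lt_succ_iff.1 (Finset.mem_range.1 hi)
    refine mul_le_mul ?_ (hA i hi') (abs_nonneg _) (by positivity)
    rw [Lagrange.basis, Polynomial.eval_prod, Finset.abs_prod]
    have hcard : ((Finset.range (p + 1)).erase i).card = p := by
      rw [Finset.card_erase_of_mem hi, Finset.card_range]; rfl
    rw [show (p : ℝ) ^ p = ∏ _j ∈ (Finset.range (p + 1)).erase i, (p : ℝ) by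
      rw [Finset.prod_const, hcard]]
    refine Finset.prod_le_prod (fun _ _ => abs_nonneg _) fun j hj => ?_
    obtain ⟨hji, hj⟩ := Finset.mem_erase.1 hj
    have hj' : j ≤ p := Nat.lt_succ_iff.1 (Finset.mem_range.1 hj)
    rw [Lagrange.basisDivisor, Polynomial.eval_mul, Polynomial.eval_C, Polynomial.eval_sub,
      Polynomial.eval_X, Polynomial.eval_C, abs_mul, abs_inv]
    have h1 : (1 : ℝ) ≤ |((r + i : ℕ) : ℝ) - ((r + j : ℕ) : ℝ)| := by
      have : (1 : ℤ) ≤ |((r + i : ℕ) : ℤ) - ((r + j : ℕ) : ℤ)| := Int.one_le_abs (by omega)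
      exact_mod_cast this
    have h2 : |x - ((r + j : ℕ) : ℝ)| ≤ p := by
      have hjp : (j : ℝ) ≤ p := by exact_mod_cast hj'
      have hj0 : (0 : ℝ) ≤ j := by positivity
      push_cast
      rw [abs_le]; constructor <;> linarith [hx.1, hx.2]
    calc _ ≤ 1 * (p : ℝ) := mul_le_mul (inv_le_one_of_one_le₀ h1) h2 (abs_nonneg _) zero_le_one
      _ = p := one_mul _
  refine (Finset.abs_sum_le_sum_abs _ _).trans ((Finset.sum_le_sum hb).trans_eq ?_)
  rw [Finset.sum_const, Finset.card_range, nsmul_eq_mul]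
  push_cast; ring

/-- On a window of length `p` only boundedly many truncated powers have their knot inside; they form
`ψ`, of size `O(D)`. The rest of the spline is a polynomial there and is controlled by its values at
the `p + 1` nodes, so no constant depends on the number of knots. -/
theorem abs_truncSpline_sub_le {p M r : ℕ} (hp : 1 ≤ p) {P Q : Polynomial ℝ} (hP : P.natDegree ≤ p)
    (hQ : Q.natDegree ≤ p) {c : Fin M → ℝ} {A D : ℝ} (hc : ∀ k, |c k| ≤ D) (hD : 0 ≤ D)
    (hA : ∀ i ≤ p, |truncSpline p P c ((r + i : ℕ) : ℝ) - Q.eval ((r + i : ℕ) : ℝ)| ≤ A)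
    {x : ℝ} (hx : x ∈ Set.Icc (r : ℝ) (r + p)) :
    |truncSpline p P c x - Q.eval x|
      ≤ (p + 1) * p ^ p * A + ((p + 1) * p ^ p + 1) * ((p + 1) * p ^ p) * D := by
  set ψ : ℝ → ℝ := fun x => ∑ k ∈ Finset.univ.filter fun k : Fin M => ¬ knot p k ≤ r,
    c k * max (x - knot p k) 0 ^ p with hψ
  have hψle : ∀ x ∈ Set.Icc (r : ℝ) (r + p), |ψ x| ≤ (p + 1) * p ^ p * D := by
    intro x hx
    set S := Finset.univ.filter fun k : Fin M => (r : ℝ) < knot p k ∧ knot p k < r + p with hS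
    have hcard : S.card ≤ p + 1 := by
      have hinj : Function.Injective (fun k : Fin M => ((k : ℕ) : ℤ)) := fun a b h => by
        exact Fin.ext (Nat.cast_injective (R := ℤ) h)
      rw [← Finset.card_image_of_injective S hinj]
      -- Integer division rounds down, so a single interval of `p + 1` integers serves both parities
      -- of `p`.
      have hsub : S.image (fun k : Fin M => ((k : ℕ) : ℤ))
          ⊆ Finset.Icc ((2 * (r : ℤ) - p) / 2) ((2 * (r : ℤ) - p) / 2 + p) := by
        intro z hz
        obtain ⟨k, hk, rfl⟩ := Finset.mem_image.1 hz
        obtain ⟨-, h1, h2⟩ := Finset.mem_filter.1 hk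
        simp only [knot] at h1 h2
        have h1' : (2 * (r : ℤ)) < p + 1 + 2 * (k : ℕ) := by
          have : (2 * (r : ℝ)) < p + 1 + 2 * (k : ℕ) := by linarith
          exact_mod_cast this
        have h2' : p + 1 + 2 * ((k : ℕ) : ℤ) < 2 * (r : ℤ) + 2 * p := by
          have : p + 1 + 2 * ((k : ℕ) : ℝ) < 2 * (r : ℝ) + 2 * p := by linarith
          exact_mod_cast this
        rw [Finset.mem_Icc]
        omega
      refine (Finset.card_le_card hsub).trans ?_
      rw [Int.card_Icc]
      omega
    have hsum : ψ x = ∑ k ∈ S, c k * max (x - knot p k) 0 ^ p := by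
      symm
      refine Finset.sum_subset (fun k hk => ?_) fun k hk hk' => ?_
      · simp only [hS, Finset.mem_filter, Finset.mem_univ, true_and, not_le] at hk ⊢
        exact hk.1
      · simp only [hS, Finset.mem_filter, Finset.mem_univ, true_and, not_le, not_and, not_lt] at hk hk'
        have := hk' hk
        rw [max_eq_right (by linarith [hx.2]), zero_pow (by omega), mul_zero]
    rw [hsum]
    have hterm : ∀ k ∈ S, |c k * max (x - knot p k) 0 ^ p| ≤ D * p ^ p := by
      intro k hk
      obtain ⟨-, h1, h2⟩ := Finset.mem_filter.1 hk
      rw [abs_mul, abs_pow, abs_of_nonneg (le_max_right (x - knot p k) 0)]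
      refine mul_le_mul (hc k) (pow_le_pow_left₀ (le_max_right _ _) ?_ _) (by positivity) hD
      exact max_le (by linarith [hx.2]) (by positivity)
    refine (Finset.abs_sum_le_sum_abs _ _).trans ((Finset.sum_le_sum hterm).trans ?_)
    rw [Finset.sum_const, nsmul_eq_mul]
    have : (S.card : ℝ) ≤ p + 1 := by exact_mod_cast hcard
    calc (S.card : ℝ) * (D * p ^ p) ≤ (p + 1) * (D * p ^ p) := by gcongr
      _ = _ := by ring
  set R : Polynomial ℝ := P + ∑ k ∈ Finset.univ.filter (fun k : Fin M => knot p k ≤ r),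
    Polynomial.C (c k) * (Polynomial.X - Polynomial.C (knot p k)) ^ p with hR
  have hRdeg : R.natDegree ≤ p := by
    refine (Polynomial.natDegree_add_le _ _).trans (max_le hP ?_)
    refine Polynomial.natDegree_sum_le_of_forall_le _ _ fun k _ => ?_
    refine (Polynomial.natDegree_C_mul_le _ _).trans ((Polynomial.natDegree_pow_le).trans ?_)
    rw [Polynomial.natDegree_X_sub_C, mul_one]
  have hsplit : ∀ x ∈ Set.Icc (r : ℝ) (r + p), truncSpline p P c x = R.eval x + ψ x := by
    intro x hx
    rw [truncSpline, hR, Polynomial.eval_add, Polynomial.eval_finsetSum, add_assoc,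
      ← Finset.sum_filter_add_sum_filter_not Finset.univ (fun k : Fin M => knot p k ≤ r)]
    congr 2
    refine Finset.sum_congr rfl fun k hk => ?_
    have := (Finset.mem_filter.1 hk).2
    rw [max_eq_left (by linarith [hx.1])]
    simp
  have hRQ := abs_eval_le_of_abs_eval_nodes_le (p := p) (r := r) (R := R - Q)
    (A := A + (p + 1) * p ^ p * D)
    ((Polynomial.natDegree_sub_le _ _).trans (max_le hRdeg hQ)) (fun i hi => by
      have hmem : (((r + i : ℕ)) : ℝ) ∈ Set.Icc (r : ℝ) (r + p) := by
        have : (i : ℝ) ≤ p := by exact_mod_cast hi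
        push_cast
        exact ⟨by linarith [(Nat.cast_nonneg i : (0 : ℝ) ≤ i)], by linarith⟩
      rw [Polynomial.eval_sub, show R.eval (((r + i : ℕ)) : ℝ) - Q.eval (((r + i : ℕ)) : ℝ)
        = (truncSpline p P c ((r + i : ℕ) : ℝ) - Q.eval ((r + i : ℕ) : ℝ)) - ψ ((r + i : ℕ) : ℝ) by
          rw [hsplit _ hmem]; ring]
      exact (abs_sub _ _).trans (add_le_add (hA i hi) (hψle _ hmem))) hx
  rw [hsplit x hx, show R.eval x + ψ x - Q.eval x = (R - Q).eval x + ψ x by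
    rw [Polynomial.eval_sub]; ring]
  refine (abs_add_le _ _).trans ((add_le_add hRQ (hψle x hx)).trans_eq ?_)
  ring

theorem truncSpline_sum {ι : Type*} (s : Finset ι) (p : ℕ) {M : ℕ} (y : ι → ℝ)
    (P : ι → Polynomial ℝ) (c : ι → Fin M → ℝ) (x : ℝ) :
    ∑ q ∈ s, y q * truncSpline p (P q) (c q) x
      = truncSpline p (∑ q ∈ s, Polynomial.C (y q) * P q) (fun k => ∑ q ∈ s, y q * c q k) x := by
  simp only [truncSpline, mul_add, Finset.sum_add_distrib, Polynomial.eval_finsetSum,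
    Polynomial.eval_mul, Polynomial.eval_C, Finset.mul_sum, Finset.sum_mul]
  rw [Finset.sum_comm (s := s)]
  congr 1
  exact Finset.sum_congr rfl fun k _ => Finset.sum_congr rfl fun q _ => by ring

/-- The sup-norm bound for the inverse Toeplitz matrices controls the coefficients by the
differences, with a constant valid for all `K`. -/
theorem exists_truncSpline_window_bound (p : ℕ) (hp : 1 ≤ p) : ∃ Λ : ℝ, 0 < Λ ∧
    ∀ (K : ℕ) (P Q : Polynomial ℝ) (c : Fin (K - p - 1) → ℝ) (A D : ℝ) (r : ℕ) (x : ℝ),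
      P.natDegree ≤ p → Q.natDegree ≤ p → 0 ≤ D →
      (∀ r, r + p + 1 < K → |fdiff p (fun n => truncSpline p P c n) r| ≤ D) →
      (∀ i ≤ p, |truncSpline p P c ((r + i : ℕ) : ℝ) - Q.eval ((r + i : ℕ) : ℝ)| ≤ A) →
      x ∈ Set.Icc (r : ℝ) (r + p) → |truncSpline p P c x - Q.eval x| ≤ Λ * (A + D) := by
  obtain ⟨C, hC, h⟩ := exists_bsplineVal_inverse_bound p hp
  set a : ℝ := (p + 1) * p ^ p with ha
  have ha0 : 0 ≤ a := by positivity
  refine ⟨a + (a + 1) * a * C + 1, by positivity, ?_⟩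
  intro K P Q c A D r x hP hQ hD hdiff hA hx
  have hc : ∀ k, |c k| ≤ C * D := by
    refine h _ c D fun k => ?_
    have := hdiff k (by have := k.2; omega)
    rwa [fdiff_truncSpline hP] at this
  have hA0 : 0 ≤ A := (abs_nonneg _).trans (hA 0 (Nat.zero_le _))
  have := abs_truncSpline_sub_le hp hP hQ hc (by positivity) hA hx
  rw [← ha] at this
  refine this.trans ?_
  have h1 : 0 ≤ (a + 1) * a * C := by positivity
  nlinarith [mul_nonneg h1 hA0, mul_nonneg ha0 hD]

/-- The window starts at `⌊x⌋`, or is the last one available if that would run past the final site.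
-/
theorem exists_window {p K : ℕ} (hp : 1 ≤ p) (hK : p + 1 ≤ K) {x : ℝ}
    (hx : x ∈ Set.Icc (0 : ℝ) (K - 1)) : ∃ r : ℕ, r + p < K ∧ x ∈ Set.Icc (r : ℝ) (r + p) := by
  obtain ⟨n, rfl⟩ := Nat.exists_eq_add_of_le hK
  have hfl := Nat.floor_le hx.1
  have hfl2 := Nat.lt_floor_add_one x
  rcases Nat.lt_or_ge n ⌊x⌋₊ with h | h
  · have hn : (n : ℝ) ≤ ⌊x⌋₊ := by exact_mod_cast h.le
    have hx2 := hx.2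
    push_cast at hx2
    exact ⟨n, by omega, by linarith, by linarith⟩
  · have : (1 : ℝ) ≤ p := by exact_mod_cast hp
    exact ⟨⌊x⌋₊, by omega, hfl, by linarith⟩

theorem abs_fdiff_le {p : ℕ} {y : ℕ → ℝ} {r : ℕ} {A : ℝ} (h : ∀ i ≤ p + 1, |y (r + i)| ≤ A) :
    |fdiff p y r| ≤ 2 ^ (p + 1) * A := by
  have h2 : (2 : ℝ) ^ (p + 1) = ∑ i ∈ Finset.range (p + 2), ((p + 1).choose i : ℝ) := by
    have := Nat.sum_range_choose (p + 1)
    exact_mod_cast this.symm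
  rw [h2, Finset.sum_mul]
  refine (Finset.abs_sum_le_sum_abs _ _).trans (Finset.sum_le_sum fun i hi => ?_)
  rw [abs_mul, abs_mul, abs_pow, abs_neg, abs_one, one_pow, one_mul, Nat.abs_cast]
  exact mul_le_mul_of_nonneg_left (h i (Nat.lt_succ_iff.1 (Finset.mem_range.1 hi))) (by positivity)

/-- Length `p + 1` instead of `p` is needed to cover the `p + 2` sites of one difference. -/
theorem exists_taylor_polynomial {p : ℕ} {f : ℝ → ℝ} (hf : ContDiff ℝ (p + 1 : ℕ) f) {a b D : ℝ}
    (hab : a < b) (hD : ∀ t ∈ Set.Icc a b, |iteratedDeriv (p + 1) f t| ≤ D) :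
    ∃ Q : Polynomial ℝ, Q.natDegree ≤ p ∧ ∀ x ∈ Set.Icc a b, x ≤ a + (p + 1) →
      |f x - Q.eval x| ≤ (p + 1) ^ (p + 1) * D := by
  refine ⟨∑ k ∈ Finset.range (p + 1), Polynomial.C ((k.factorial : ℝ)⁻¹ *
    iteratedDerivWithin k f (Set.Icc a b) a) * (Polynomial.X - Polynomial.C a) ^ k, ?_, ?_⟩
  · refine Polynomial.natDegree_sum_le_of_forall_le _ _ fun k hk => ?_
    refine (Polynomial.natDegree_C_mul_le _ _).trans ((Polynomial.natDegree_pow_le).trans ?_)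
    rw [Polynomial.natDegree_X_sub_C, mul_one]
    exact Nat.lt_succ_iff.1 (Finset.mem_range.1 hk)
  · intro x hx hxa
    have hD0 : 0 ≤ D := (abs_nonneg _).trans (hD a ⟨le_rfl, hab.le⟩)
    have h := taylor_mean_remainder_bound (n := p) hab.le (f := f) (C := D)
      (by exact_mod_cast hf.contDiffOn) hx fun y hy => by
        rw [iteratedDerivWithin_eq_iteratedDeriv (uniqueDiffOn_Icc hab) hf.contDiffAt hy]
        exact hD y hy
    have heq : taylorWithinEval f p (Set.Icc a b) a x = (∑ k ∈ Finset.range (p + 1),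
        Polynomial.C ((k.factorial : ℝ)⁻¹ * iteratedDerivWithin k f (Set.Icc a b) a)
          * (Polynomial.X - Polynomial.C a) ^ k).eval x := by
      rw [taylor_within_apply, Polynomial.eval_finsetSum]
      refine Finset.sum_congr rfl fun k _ => ?_
      simp only [Polynomial.eval_mul, Polynomial.eval_C, Polynomial.eval_pow, Polynomial.eval_sub,
        Polynomial.eval_X, smul_eq_mul]
      ring
    rw [heq] at h
    refine h.trans ?_
    have h1 : (1 : ℝ) ≤ p.factorial := by exact_mod_cast Nat.one_le_iff_ne_zero.2 p.factorial_ne_zero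
    have h2 : (x - a) ^ (p + 1) ≤ (p + 1 : ℝ) ^ (p + 1) :=
      pow_le_pow_left₀ (by linarith [hx.1]) (by linarith) _
    rw [div_le_iff₀ (by linarith)]
    have h3 : 0 ≤ (p + 1 : ℝ) ^ (p + 1) * D := by positivity
    calc D * (x - a) ^ (p + 1) ≤ D * (p + 1 : ℝ) ^ (p + 1) := by gcongr
      _ = (p + 1 : ℝ) ^ (p + 1) * D * 1 := by ring
      _ ≤ _ := by gcongr

theorem iteratedDeriv_clm_comp {E F : Type*} [NormedAddCommGroup E] [NormedSpace ℝ E]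
    [NormedAddCommGroup F] [NormedSpace ℝ F] (L : E →L[ℝ] F) {n : ℕ} {f : ℝ → E}
    (hf : ContDiff ℝ n f) : iteratedDeriv n (fun x => L (f x)) = fun x => L (iteratedDeriv n f x) := by
  induction n with
  | zero => simp
  | succ n ih =>
    rw [iteratedDeriv_succ, ih (hf.of_le (by exact_mod_cast Nat.le_succ n))]
    funext x
    have hd : DifferentiableAt ℝ (iteratedDeriv n f) x :=
      (hf.differentiable_iteratedDeriv n (by exact_mod_cast Nat.lt_succ_self n)) x
    rw [iteratedDeriv_succ]
    exact (L.hasFDerivAt.comp_hasDerivAt x hd.hasDerivAt).deriv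

/-- Existence of the cardinal splines, with a uniform bound for their Lebesgue constants and the
error estimate of order `p + 1` for the interpolants. -/
theorem exists_cardinalFamily (p : ℕ) (hp : 1 ≤ p) : ∃ c : ℕ → ℕ → ℝ → ℝ, IsCardinalFamily p c ∧
    ∃ Λ : ℝ, 0 < Λ ∧
      (∀ K, p + 1 ≤ K → ∀ x ∈ Set.Icc (0 : ℝ) (K - 1), ∑ q ∈ Finset.range K, |c K q x| ≤ Λ) ∧
      ∀ K, p + 1 ≤ K → ∀ f : ℝ → ℂ, ContDiff ℝ (p + 1 : ℕ) f → ∀ D : ℝ,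
        (∀ t ∈ Set.Icc (0 : ℝ) (K - 1), ‖iteratedDeriv (p + 1) f t‖ ≤ D) →
        ∀ x ∈ Set.Icc (0 : ℝ) (K - 1),
          ‖∑ q ∈ Finset.range K, f q * (c K q x : ℂ) - f x‖ ≤ Λ * D := by
  choose P c hP hc using fun K q : ℕ =>
    exists_truncSpline_interpolating (p := p) (K := K) hp (fun r => if r = q then 1 else 0)
  obtain ⟨Λ, hΛ, hwin⟩ := exists_truncSpline_window_bound p hp
  have hdeg : ∀ (K : ℕ) (y : ℕ → ℝ),
      (∑ q ∈ Finset.range K, Polynomial.C (y q) * P K q).natDegree ≤ p := fun K y =>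
    Polynomial.natDegree_sum_le_of_forall_le _ _ fun q _ =>
      (Polynomial.natDegree_C_mul_le _ _).trans (hP K q)
  have hval : ∀ (K : ℕ) (y : ℕ → ℝ) (n : ℕ), n < K →
      ∑ q ∈ Finset.range K, y q * truncSpline p (P K q) (c K q) n = y n := by
    intro K y n hn
    rw [Finset.sum_congr rfl fun q _ => by rw [hc K q n hn]]
    simp [hn]
  -- The data need to be near a polynomial only on the window of `x`; elsewhere they enter through
  -- their differences alone.
  have hest : ∀ (K : ℕ) (y : ℕ → ℝ) (Q : Polynomial ℝ) (A D : ℝ) (r : ℕ) (x : ℝ),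
      Q.natDegree ≤ p → 0 ≤ D → r + p < K → (∀ r, r + p + 1 < K → |fdiff p y r| ≤ D) →
      (∀ i ≤ p, |y (r + i) - Q.eval ((r + i : ℕ) : ℝ)| ≤ A) → x ∈ Set.Icc (r : ℝ) (r + p) →
      |∑ q ∈ Finset.range K, y q * truncSpline p (P K q) (c K q) x - Q.eval x| ≤ Λ * (A + D) := by
    intro K y Q A D r x hQ hD hr hdiff hA hx
    rw [truncSpline_sum]
    refine hwin K _ Q _ A D r x (hdeg K y) hQ hD (fun r hr => ?_) (fun i hi => ?_) hx
    · convert hdiff r hr using 2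
      refine Finset.sum_congr rfl fun i hi => ?_
      have := Finset.mem_range.1 hi
      simp only [← truncSpline_sum]
      rw [hval K y _ (by omega)]
    · rw [← truncSpline_sum, hval K y _ (by omega)]
      exact hA i hi
  have hreal : ∀ K, p + 1 ≤ K → ∀ f : ℝ → ℝ, ContDiff ℝ (p + 1 : ℕ) f → ∀ D : ℝ,
        (∀ t ∈ Set.Icc (0 : ℝ) (K - 1), |iteratedDeriv (p + 1) f t| ≤ D) →
        ∀ x ∈ Set.Icc (0 : ℝ) (K - 1),
          |∑ q ∈ Finset.range K, f q * truncSpline p (P K q) (c K q) x - f x|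
            ≤ (Λ * ((p + 1) ^ (p + 1) + 2 ^ (p + 1) * (p + 1) ^ (p + 1)) + (p + 1) ^ (p + 1)) * D := by
    intro K hK f hf D hD x hx
    obtain ⟨r, hrK, hxr⟩ := exists_window hp hK hx
    have hxr' : x ≤ r + (p + 1) := by linarith [hxr.2]
    have hp' : (1 : ℝ) ≤ p := by exact_mod_cast hp
    have hD0 : 0 ≤ D := (abs_nonneg _).trans (hD x hx)
    have htay : ∀ r : ℕ, r + p < K → ∃ Q : Polynomial ℝ, Q.natDegree ≤ p ∧
        ∀ x ∈ Set.Icc (r : ℝ) (K - 1), x ≤ r + (p + 1) →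
          |f x - Q.eval x| ≤ (p + 1) ^ (p + 1) * D := by
      intro r hr
      have hr' : (r : ℝ) + p + 1 ≤ K := by exact_mod_cast hr
      refine exists_taylor_polynomial hf (by linarith) fun t ht => hD t ⟨?_, ht.2⟩
      exact (Nat.cast_nonneg r).trans ht.1
    obtain ⟨Q, hQ, hQf⟩ := htay r hrK
    have hmem : ∀ r i : ℕ, r + i < K → ((r + i : ℕ) : ℝ) ∈ Set.Icc (r : ℝ) (K - 1) := by
      intro r i h
      have : ((r + i : ℕ) : ℝ) + 1 ≤ K := by exact_mod_cast h
      push_cast at this ⊢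
      exact ⟨by linarith [(Nat.cast_nonneg i : (0 : ℝ) ≤ i)], by linarith⟩
    -- Each difference ignores the Taylor polynomial of its own window, so all differences are small
    -- although no single polynomial approximates `f` globally.
    have h1 := hest K (fun n => f n) Q ((p + 1) ^ (p + 1) * D) (2 ^ (p + 1) * ((p + 1) ^ (p + 1) * D))
      r x hQ (by positivity) hrK (fun r hr => by
        obtain ⟨Q, hQ, hQf⟩ := htay r (by omega)
        have : fdiff p (fun n : ℕ => f n) r = fdiff p (fun n : ℕ => f n - Q.eval (n : ℝ)) r := by
          rw [fdiff_sub, fdiff_polynomial hQ, sub_zero]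
        rw [this]
        refine abs_fdiff_le fun i hi => hQf _ (hmem r i (by omega)) ?_
        have : (i : ℝ) ≤ p + 1 := by exact_mod_cast hi
        push_cast; linarith) (fun i hi => hQf _ (hmem r i (by omega)) (by
        have : (i : ℝ) ≤ p := by exact_mod_cast hi
        push_cast; linarith)) hxr
    have h2 := hQf x ⟨hxr.1, hx.2⟩ hxr'
    calc _ = |(∑ q ∈ Finset.range K, f q * truncSpline p (P K q) (c K q) x - Q.eval x)
          - (f x - Q.eval x)| := by ring_nf
      _ ≤ _ := (abs_sub _ _).trans (add_le_add h1 h2)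
      _ = _ := by ring
  set Λ₁ : ℝ := Λ * ((p + 1) ^ (p + 1) + 2 ^ (p + 1) * (p + 1) ^ (p + 1)) + (p + 1) ^ (p + 1) with hΛ₁
  have hΛ₁0 : 0 < Λ₁ := by positivity
  -- The term `2 * Λ₁` serves the real and imaginary parts; the other term is the Lebesgue constant.
  refine ⟨fun K q => truncSpline p (P K q) (c K q), fun K hK q hq => ⟨?_, fun r hr => hc K q r hr⟩,
    Λ * (1 + 2 ^ (p + 1)) + 2 * Λ₁, by positivity, fun K hK x hx => ?_, fun K hK f hf D hD x hx => ?_⟩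
  · exact isSpline_truncSpline hp (hP K q) (c K q)
  · obtain ⟨r, hrK, hxr⟩ := exists_window hp hK hx
    -- For fixed `x` the Lebesgue sum is the value at `x` of the interpolant of these signs,
    -- compared with the zero polynomial.
    set y : ℕ → ℝ := fun q => SignType.sign (truncSpline p (P K q) (c K q) x) with hy
    have hy1 : ∀ q, |y q| ≤ 1 := fun q => by
      simp only [hy]
      rcases SignType.trichotomy (SignType.sign (truncSpline p (P K q) (c K q) x)) with h | h | h <;>
        rw [h] <;> simp
    have h1 := hest K y 0 1 (2 ^ (p + 1)) r x (by simp) (by positivity) hrK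
      (fun r _ => by simpa using abs_fdiff_le (A := 1) fun i _ => hy1 (r + i))
      (fun i _ => by simpa using hy1 (r + i)) hxr
    have h2 : ∑ q ∈ Finset.range K, |truncSpline p (P K q) (c K q) x|
        = ∑ q ∈ Finset.range K, y q * truncSpline p (P K q) (c K q) x :=
      Finset.sum_congr rfl fun q _ => (sign_mul_self _).symm
    rw [h2]
    refine (le_abs_self _).trans ?_
    rw [Polynomial.eval_zero, sub_zero] at h1
    linarith
  · have hD0 : 0 ≤ D := (norm_nonneg _).trans (hD x hx)
    have hre := hreal K hK (fun t => (f t).re) (Complex.reCLM.contDiff.comp hf) D (fun t ht => by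
      rw [show (fun t => (f t).re) = fun t => Complex.reCLM (f t) from rfl,
        iteratedDeriv_clm_comp _ hf]
      exact (Complex.abs_re_le_norm _).trans (hD t ht)) x hx
    have him := hreal K hK (fun t => (f t).im) (Complex.imCLM.contDiff.comp hf) D (fun t ht => by
      rw [show (fun t => (f t).im) = fun t => Complex.imCLM (f t) from rfl,
        iteratedDeriv_clm_comp _ hf]
      exact (Complex.abs_im_le_norm _).trans (hD t ht)) x hx
    refine (Complex.norm_le_abs_re_add_abs_im _).trans ?_
    simp only [Complex.sub_re, Complex.sub_im, Complex.re_sum, Complex.im_sum, Complex.re_mul_ofReal,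
      Complex.im_mul_ofReal]
    have h0 : 0 ≤ Λ * (1 + 2 ^ (p + 1)) * D := by positivity
    linarith

/-! ### The error of the hierarchical interpolant -/

/-- Uniform Lebesgue constants and approximation of order `p + 1` for a family of cardinal
functions on the sites `0, …, K - 1`. -/
structure IsStableFamily (p : ℕ) (c : ℕ → ℕ → ℝ → ℝ) (Λ : ℝ) : Prop where
  pos : 0 < Λ
  lebesgue : ∀ K, p + 1 ≤ K → ∀ x ∈ Set.Icc (0 : ℝ) (K - 1), ∑ q ∈ Finset.range K, |c K q x| ≤ Λ
  error : ∀ K, p + 1 ≤ K → ∀ f : ℝ → ℂ, ContDiff ℝ (p + 1 : ℕ) f → ∀ D : ℝ,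
    (∀ t ∈ Set.Icc (0 : ℝ) (K - 1), ‖iteratedDeriv (p + 1) f t‖ ≤ D) →
    ∀ x ∈ Set.Icc (0 : ℝ) (K - 1), ‖∑ q ∈ Finset.range K, f q * (c K q x : ℂ) - f x‖ ≤ Λ * D

theorem IsStableFamily.error_scaled {p : ℕ} {c : ℕ → ℕ → ℝ → ℝ} {Λ : ℝ} (hc : IsStableFamily p c Λ)
    {K : ℕ} (hK : p + 1 ≤ K) {g : ℝ → ℂ} (hg : ContDiff ℝ (p + 1 : ℕ) g) {a h D : ℝ} (hh : 0 < h)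
    (hD : ∀ t ∈ Set.Icc a (a + h * (K - 1)), ‖iteratedDeriv (p + 1) g t‖ ≤ D) {x : ℝ}
    (hx : x ∈ Set.Icc a (a + h * (K - 1))) :
    ‖∑ q ∈ Finset.range K, g (a + h * q) * (c K q ((x - a) / h) : ℂ) - g x‖
      ≤ Λ * (h ^ (p + 1) * D) := by
  have hg1 : ContDiff ℝ (p + 1 : ℕ) fun t => g (a + t) := hg.comp (contDiff_const.add contDiff_id)
  have := hc.error K hK (fun s => g (a + h * s))
    (hg.comp (contDiff_const.add (contDiff_const.mul contDiff_id))) (h ^ (p + 1) * D)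
    (fun t ht => by
      rw [iteratedDeriv_comp_const_smul hg1 h, iteratedDeriv_comp_const_add, norm_smul, norm_pow,
        Real.norm_of_nonneg hh.le]
      gcongr
      exact hD _ ⟨by nlinarith [ht.1], by nlinarith [ht.2]⟩) ((x - a) / h)
    ⟨div_nonneg (by linarith [hx.1]) hh.le, by rw [div_le_iff₀ hh]; linarith [hx.2]⟩
  rwa [show a + h * ((x - a) / h) = x by field_simp; ring] at this

/-- The error splits into the interpolation error in the first variable and the first-variable
interpolant of the error in the second; the latter costs one Lebesgue constant. Only pure
derivatives occur. -/
theorem IsStableFamily.tensor_error {p : ℕ} {c : ℕ → ℕ → ℝ → ℝ} {Λ : ℝ}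
    (hc : IsStableFamily p c Λ) {K : ℕ} (hK : p + 1 ≤ K) {φ : ℝ × ℝ → ℂ}
    (h₁ : ∀ t, ContDiff ℝ (p + 1 : ℕ) fun s => φ (s, t))
    (h₂ : ∀ s, ContDiff ℝ (p + 1 : ℕ) fun t => φ (s, t)) {a b h D : ℝ} (hh : 0 < h)
    (hD₁ : ∀ s ∈ Set.Icc a (a + h * (K - 1)), ∀ t ∈ Set.Icc b (b + h * (K - 1)),
      ‖iteratedDeriv (p + 1) (fun s => φ (s, t)) s‖ ≤ D)
    (hD₂ : ∀ s ∈ Set.Icc a (a + h * (K - 1)), ∀ t ∈ Set.Icc b (b + h * (K - 1)),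
      ‖iteratedDeriv (p + 1) (fun t => φ (s, t)) t‖ ≤ D) {x y : ℝ}
    (hx : x ∈ Set.Icc a (a + h * (K - 1))) (hy : y ∈ Set.Icc b (b + h * (K - 1))) :
    ‖∑ q ∈ Finset.range K, ∑ r ∈ Finset.range K, φ (a + h * q, b + h * r) *
        ((c K q ((x - a) / h) * c K r ((y - b) / h) : ℝ) : ℂ) - φ (x, y)‖
      ≤ (Λ + Λ ^ 2) * (h ^ (p + 1) * D) := by
  have hK1 : (1 : ℝ) ≤ K := by exact_mod_cast (by omega : 1 ≤ K)
  have hD0 : 0 ≤ D := (norm_nonneg _).trans (hD₁ x hx y hy)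
  have e1 := hc.error_scaled hK (h₁ y) hh (fun t ht => hD₁ t ht y hy) hx
  have e2 : ∀ q ∈ Finset.range K, ‖∑ r ∈ Finset.range K, φ (a + h * q, b + h * r) *
      (c K r ((y - b) / h) : ℂ) - φ (a + h * q, y)‖ ≤ Λ * (h ^ (p + 1) * D) := by
    intro q hq
    have hq' : (q : ℝ) + 1 ≤ K := by exact_mod_cast Finset.mem_range.1 hq
    refine hc.error_scaled hK (h₂ _) hh (fun t ht => hD₂ _ ⟨?_, ?_⟩ t ht) hy
    · have : 0 ≤ h * (q : ℝ) := by positivity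
      linarith
    · nlinarith
  have hleb := hc.lebesgue K hK ((x - a) / h)
    ⟨div_nonneg (by linarith [hx.1]) hh.le, by rw [div_le_iff₀ hh]; linarith [hx.2]⟩
  have hsplit : ∑ q ∈ Finset.range K, ∑ r ∈ Finset.range K, φ (a + h * q, b + h * r) *
        ((c K q ((x - a) / h) * c K r ((y - b) / h) : ℝ) : ℂ) - φ (x, y)
      = (∑ q ∈ Finset.range K, φ (a + h * q, y) * (c K q ((x - a) / h) : ℂ) - φ (x, y))
        + ∑ q ∈ Finset.range K, (c K q ((x - a) / h) : ℂ) *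
          (∑ r ∈ Finset.range K, φ (a + h * q, b + h * r) * (c K r ((y - b) / h) : ℂ)
            - φ (a + h * q, y)) := by
    rw [sub_add_eq_add_sub, ← Finset.sum_add_distrib]
    congr 1
    refine Finset.sum_congr rfl fun q _ => ?_
    rw [mul_sub, Finset.mul_sum]
    have : ∀ r ∈ Finset.range K, φ (a + h * q, b + h * r) *
        ((c K q ((x - a) / h) * c K r ((y - b) / h) : ℝ) : ℂ) = (c K q ((x - a) / h) : ℂ) *
        (φ (a + h * q, b + h * r) * (c K r ((y - b) / h) : ℂ)) := fun r _ => by push_cast; ring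
    rw [Finset.sum_congr rfl this]
    ring
  rw [hsplit]
  have e3 : ‖∑ q ∈ Finset.range K, (c K q ((x - a) / h) : ℂ) *
          (∑ r ∈ Finset.range K, φ (a + h * q, b + h * r) * (c K r ((y - b) / h) : ℂ)
            - φ (a + h * q, y))‖ ≤ Λ * (Λ * (h ^ (p + 1) * D)) := by
    have hn : 0 ≤ Λ * (h ^ (p + 1) * D) := by have := hc.pos; positivity
    refine (norm_sum_le _ _).trans ((Finset.sum_le_sum fun q hq => ?_).trans
      ((Finset.sum_mul (Finset.range K) (fun q => |c K q ((x - a) / h)|)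
        (Λ * (h ^ (p + 1) * D))).symm.le.trans (mul_le_mul_of_nonneg_right hleb hn)))
    rw [norm_mul, Complex.norm_real, Real.norm_eq_abs]
    exact mul_le_mul_of_nonneg_left (e2 q hq) (abs_nonneg _)
  refine (norm_add_le _ _).trans ((add_le_add e1 e3).trans_eq ?_)
  ring

/-! ### Geometry of the blocks. -/

theorem mem_part_zero {R x : ℝ} : x ∈ part R 0 ↔ -3 * R ≤ x ∧ x < -R := by simp [part]
theorem mem_part_one {R x : ℝ} : x ∈ part R 1 ↔ -R ≤ x ∧ x ≤ R := by simp [part]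
theorem mem_part_two {R x : ℝ} : x ∈ part R 2 ↔ R < x ∧ x ≤ 3 * R := by simp [part]

theorem part_unique {R x : ℝ} (hR : 0 < R) {i i' : Fin 3} (h : x ∈ part R i) (h' : x ∈ part R i') :
    i = i' := by
  fin_cases i <;> fin_cases i' <;> first | rfl | (
    simp only [Fin.zero_eta, Fin.mk_one, Fin.reduceFinMk, mem_part_zero, mem_part_one,
      mem_part_two] at h h'
    exfalso; linarith [h.1, h.2, h'.1, h'.2])

theorem exists_mem_part {R x : ℝ} (h : |x| ≤ 3 * R) : ∃ i, x ∈ part R i := by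
  obtain ⟨h1, h2⟩ := abs_le.1 h
  rcases lt_or_ge x (-R) with h3 | h3
  · exact ⟨0, mem_part_zero.2 ⟨by linarith, h3⟩⟩
  · rcases lt_or_ge R x with h4 | h4
    · exact ⟨2, mem_part_two.2 ⟨h4, h2⟩⟩
    · exact ⟨1, mem_part_one.2 ⟨h3, h4⟩⟩

theorem abs_le_of_mem_part {R x : ℝ} (hR : 0 < R) {i : Fin 3} (h : x ∈ part R i) : |x| ≤ 3 * R := by
  fin_cases i <;> simp only [Fin.zero_eta, Fin.mk_one, Fin.reduceFinMk, mem_part_zero, mem_part_one,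
      mem_part_two] at h <;> rw [abs_le] <;> constructor <;> linarith [h.1, h.2]

theorem lt_abs_of_mem_part {R x : ℝ} {i : Fin 3} (hi : i ≠ 1) (h : x ∈ part R i) : R < |x| := by
  fin_cases i
  · simp only [Fin.zero_eta, mem_part_zero] at h
    rw [lt_abs]; right; linarith [h.2]
  · exact absurd rfl hi
  · simp only [Fin.reduceFinMk, mem_part_two] at h
    rw [lt_abs]; left; exact h.1

theorem mem_Icc_left_of_mem_part {R x : ℝ} {i : Fin 3} (h : x ∈ part R i) :
    x ∈ Set.Icc (left R i) (left R i + 2 * R) := by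
  fin_cases i <;> simp only [Fin.zero_eta, Fin.mk_one, Fin.reduceFinMk, mem_part_zero, mem_part_one,
      mem_part_two, left] at h ⊢ <;> norm_num <;> constructor <;> linarith [h.1, h.2]

theorem le_abs_of_mem_Icc_left {R x : ℝ} {i : Fin 3} (hi : i ≠ 1)
    (h : x ∈ Set.Icc (left R i) (left R i + 2 * R)) : R ≤ |x| := by
  fin_cases i
  · simp [left] at h
    rw [le_abs]; right; linarith [h.2]
  · exact absurd rfl hi
  · simp [left] at h
    rw [le_abs]; left; linarith [h.1]

theorem abs_fst_le_bracket (ξ : ℝ × ℝ) : |ξ.1| ≤ bracket ξ :=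
  Real.abs_le_sqrt (by nlinarith [sq_nonneg ξ.2])

theorem abs_snd_le_bracket (ξ : ℝ × ℝ) : |ξ.2| ≤ bracket ξ :=
  Real.abs_le_sqrt (by nlinarith [sq_nonneg ξ.1])

/-! ### The hierarchical interpolant on the central square and on each block. -/

/-- The hierarchical spline interpolant of `φ`. -/
def hierInterp (c : ℕ → ℕ → ℝ → ℝ) (B : ℝ) (N K : ℕ) (φ : ℝ × ℝ → ℂ) (ξ : ℝ × ℝ) : ℂ :=
  ∑ μ ∈ indices B N K, φ (controlPoint B μ) * (basisFun c B μ ξ : ℂ)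

theorem hierInterp_eq (c : ℕ → ℕ → ℝ → ℝ) (B : ℝ) (N K : ℕ) (φ : ℝ × ℝ → ℂ) (ξ : ℝ × ℝ) :
    hierInterp c B N K φ ξ
      = ∑ ζ ∈ Finset.Icc (-⌊B⌋) ⌊B⌋ ×ˢ Finset.Icc (-⌊B⌋) ⌊B⌋,
          φ (toPlane ζ) * (basisFun c B (Sum.inl ζ) ξ : ℂ)
        + ∑ j ∈ Finset.range (levels B N), ∑ i ∈ Finset.univ.filter fun i : Fin 3 × Fin 3 => i ≠ (1, 1),
          ∑ q ∈ Finset.range K, ∑ r ∈ Finset.range K,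
            φ (controlPoint B (Sum.inr (K, j, i, (q, r))))
              * (basisFun c B (Sum.inr (K, j, i, (q, r))) ξ : ℂ) := by
  rw [hierInterp, indices, Finset.sum_disjSum]
  simp only [Finset.sum_product, Finset.sum_singleton, controlPoint]

theorem block_bounds {B : ℝ} (hB : 0 < B) {j : ℕ} {i : Fin 3 × Fin 3} (hi : i ≠ (1, 1)) {ξ : ℝ × ℝ}
    (h : ξ.1 ∈ part (3 ^ j * B) i.1 ∧ ξ.2 ∈ part (3 ^ j * B) i.2) :
    3 ^ j * B < max |ξ.1| |ξ.2| ∧ max |ξ.1| |ξ.2| ≤ 3 ^ (j + 1) * B := by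
  have hR : 0 < 3 ^ j * B := by positivity
  constructor
  · by_cases h1 : i.1 = 1
    · have h2 : i.2 ≠ 1 := fun h2 => hi (Prod.ext h1 h2)
      exact lt_max_of_lt_right (lt_abs_of_mem_part h2 h.2)
    · exact lt_max_of_lt_left (lt_abs_of_mem_part h1 h.1)
  · rw [pow_succ, mul_comm (3 ^ j : ℝ) 3, mul_assoc]
    exact max_le (abs_le_of_mem_part hR h.1) (abs_le_of_mem_part hR h.2)

theorem hierInterp_of_le {B : ℝ} (hB : 0 < B) (c : ℕ → ℕ → ℝ → ℝ) (N K : ℕ) (φ : ℝ × ℝ → ℂ)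
    {k : ℤ × ℤ} (hk : max |(k.1 : ℝ)| |(k.2 : ℝ)| ≤ B) :
    hierInterp c B N K φ (toPlane k) = φ (toPlane k) := by
  have hmem : k ∈ Finset.Icc (-⌊B⌋) ⌊B⌋ ×ˢ Finset.Icc (-⌊B⌋) ⌊B⌋ := by
    have hfl : ∀ n : ℤ, |(n : ℝ)| ≤ B → n ∈ Finset.Icc (-⌊B⌋) ⌊B⌋ := fun n hn => by
      have : |n| ≤ ⌊B⌋ := Int.le_floor.2 (by push_cast; exact hn)
      exact Finset.mem_Icc.2 (abs_le.1 this)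
    exact Finset.mem_product.2 ⟨hfl _ ((le_max_left _ _).trans hk), hfl _ ((le_max_right _ _).trans hk)⟩
  have hinj : ∀ ζ : ℤ × ℤ, toPlane k = toPlane ζ ↔ ζ = k := fun ζ => by
    simp only [toPlane, Prod.ext_iff, Int.cast_inj]
    exact ⟨fun h => ⟨h.1.symm, h.2.symm⟩, fun h => ⟨h.1.symm, h.2.symm⟩⟩
  rw [hierInterp_eq, Finset.sum_eq_single_of_mem k hmem, Finset.sum_eq_zero, add_zero]
  · simp [basisFun]
  · intro j _
    refine Finset.sum_eq_zero fun i hi => Finset.sum_eq_zero fun q _ => Finset.sum_eq_zero fun r _ => ?_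
    have : ¬ ((toPlane k).1 ∈ part (3 ^ j * B) i.1 ∧ (toPlane k).2 ∈ part (3 ^ j * B) i.2) := by
      intro h
      have h1 := (block_bounds hB (Finset.mem_filter.1 hi).2 h).1
      have h2 : B ≤ 3 ^ j * B := le_mul_of_one_le_left hB.le (one_le_pow₀ (by norm_num))
      simp only [toPlane] at h1
      linarith
    simp only [basisFun, if_neg this, Complex.ofReal_zero, mul_zero]
  · intro ζ _ hζ
    simp only [basisFun, if_neg (fun h => hζ ((hinj ζ).1 h)), Complex.ofReal_zero, mul_zero]

theorem le_three_pow_levels_mul {B : ℝ} (hB : 0 < B) {N : ℕ} (hN : 0 < N) :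
    (N : ℝ) ≤ 3 ^ levels B N * B := by
  have hNB : 0 < (N : ℝ) / B := by positivity
  rw [← div_le_iff₀ hB]
  have h := Nat.le_ceil (Real.logb 3 ((N : ℝ) / B))
  have := (Real.logb_le_iff_le_rpow (by norm_num) hNB).1 h
  rwa [Real.rpow_natCast] at this

theorem exists_block {B : ℝ} {L : ℕ} {u v : ℝ} (h1 : B < max |u| |v|)
    (h2 : max |u| |v| ≤ 3 ^ L * B) : ∃ j < L, ∃ i : Fin 3 × Fin 3, i ≠ (1, 1) ∧
      u ∈ part (3 ^ j * B) i.1 ∧ v ∈ part (3 ^ j * B) i.2 := by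
  induction L with
  | zero => simp at h2; linarith [max_le h2.1 h2.2]
  | succ L ih =>
    rcases le_or_gt (max |u| |v|) (3 ^ L * B) with h | h
    · obtain ⟨j, hj, h⟩ := ih h
      exact ⟨j, by omega, h⟩
    · rw [pow_succ, mul_comm (3 ^ L : ℝ) 3, mul_assoc] at h2
      obtain ⟨i₁, hi₁⟩ := exists_mem_part ((le_max_left _ _).trans h2)
      obtain ⟨i₂, hi₂⟩ := exists_mem_part ((le_max_right _ _).trans h2)
      refine ⟨L, by omega, (i₁, i₂), fun hi => ?_, hi₁, hi₂⟩
      rw [Prod.mk.injEq] at hi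
      rw [hi.1, mem_part_one] at hi₁
      rw [hi.2, mem_part_one] at hi₂
      exact absurd h (not_lt.2 (max_le (abs_le.2 hi₁) (abs_le.2 hi₂)))

/-- Different levels have disjoint ranges of `max |ξ₁| |ξ₂|`, and the half-open intervals make the
blocks of one level disjoint, so a single block contributes. -/
theorem hierInterp_of_mem_block {B : ℝ} (hB : 0 < B) (c : ℕ → ℕ → ℝ → ℝ) (N K : ℕ) (φ : ℝ × ℝ → ℂ)
    {ξ : ℝ × ℝ} {j : ℕ} (hj : j < levels B N) {i : Fin 3 × Fin 3} (hi : i ≠ (1, 1))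
    (h : ξ.1 ∈ part (3 ^ j * B) i.1 ∧ ξ.2 ∈ part (3 ^ j * B) i.2) :
    hierInterp c B N K φ ξ = ∑ q ∈ Finset.range K, ∑ r ∈ Finset.range K,
      φ (left (3 ^ j * B) i.1 + spacing (3 ^ j * B) K * q,
          left (3 ^ j * B) i.2 + spacing (3 ^ j * B) K * r) *
        ((c K q ((ξ.1 - left (3 ^ j * B) i.1) / spacing (3 ^ j * B) K) *
          c K r ((ξ.2 - left (3 ^ j * B) i.2) / spacing (3 ^ j * B) K) : ℝ) : ℂ) := by
  have hR : 0 < 3 ^ j * B := by positivity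
  obtain ⟨hb1, hb2⟩ := block_bounds hB hi h
  rw [hierInterp_eq, Finset.sum_eq_zero, zero_add,
    Finset.sum_eq_single_of_mem j (Finset.mem_range.2 hj),
    Finset.sum_eq_single_of_mem i (Finset.mem_filter.2 ⟨Finset.mem_univ _, hi⟩)]
  · simp only [basisFun, if_pos h, controlPoint]
  · intro i' _ hii
    refine Finset.sum_eq_zero fun q _ => Finset.sum_eq_zero fun r _ => ?_
    have : ¬ (ξ.1 ∈ part (3 ^ j * B) i'.1 ∧ ξ.2 ∈ part (3 ^ j * B) i'.2) := fun h' =>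
      hii (Prod.ext (part_unique hR h'.1 h.1) (part_unique hR h'.2 h.2))
    simp only [basisFun, if_neg this, Complex.ofReal_zero, mul_zero]
  · intro j' _ hjj
    refine Finset.sum_eq_zero fun i' hi' => Finset.sum_eq_zero fun q _ => Finset.sum_eq_zero fun r _ => ?_
    have : ¬ (ξ.1 ∈ part (3 ^ j' * B) i'.1 ∧ ξ.2 ∈ part (3 ^ j' * B) i'.2) := by
      intro h'
      obtain ⟨hb1', hb2'⟩ := block_bounds hB (Finset.mem_filter.1 hi').2 h'
      have key : ∀ {a b : ℕ}, a < b → (3 : ℝ) ^ (a + 1) * B ≤ 3 ^ b * B := fun hab => by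
        gcongr
        · norm_num
        · exact hab
      rcases lt_or_gt_of_ne hjj with hlt | hlt
      · linarith [key hlt]
      · linarith [key hlt]
    simp only [basisFun, if_neg this, Complex.ofReal_zero, mul_zero]
  · intro ζ hζ
    have : ξ ≠ toPlane ζ := by
      rintro rfl
      obtain ⟨h1, h2⟩ := Finset.mem_product.1 hζ
      have hfl : ∀ n : ℤ, n ∈ Finset.Icc (-⌊B⌋) ⌊B⌋ → |(n : ℝ)| ≤ B := fun n hn => by
        have := Int.le_floor.1 (abs_le.2 (Finset.mem_Icc.1 hn))
        push_cast at this
        exact this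
      have h3 : max |(toPlane ζ).1| |(toPlane ζ).2| ≤ B := max_le (hfl _ h1) (hfl _ h2)
      have h4 : B ≤ 3 ^ j * B := le_mul_of_one_le_left hB.le (one_le_pow₀ (by norm_num))
      linarith
    simp only [basisFun, if_neg this, Complex.ofReal_zero, mul_zero]

/-- The factor `R^{p+1}` from the spacing cancels the decay `R^{-(p+1)}` of the derivatives, so the
bound is the same at all levels. In the central square the interpolant is exact at integer points.
-/
theorem IsStableFamily.hierInterp_error {p : ℕ} {c : ℕ → ℕ → ℝ → ℝ} {Λ : ℝ} (hp : 1 ≤ p)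
    (hc : IsStableFamily p c Λ) {B : ℝ} (hB : 0 < B) {N K : ℕ} (hK : p + 1 ≤ K) (hN : 0 < N)
    {k : ℤ × ℤ} (hk : max |k.1| |k.2| ≤ (N : ℤ)) {φ : ℝ × ℝ → ℂ}
    (h₁ : ∀ t, ContDiff ℝ (p + 1 : ℕ) fun s => φ (s, t))
    (h₂ : ∀ s, ContDiff ℝ (p + 1 : ℕ) fun t => φ (s, t)) {D : ℝ}
    (hD₁ : ∀ s t, ‖iteratedDeriv (p + 1) (fun s => φ (s, t)) s‖ * bracket (s, t) ^ (p + 1) ≤ D)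
    (hD₂ : ∀ s t, ‖iteratedDeriv (p + 1) (fun t => φ (s, t)) t‖ * bracket (s, t) ^ (p + 1) ≤ D) :
    ‖hierInterp c B N K φ (toPlane k) - φ (toPlane k)‖
      ≤ (Λ + Λ ^ 2) * 2 ^ (p + 1) * D / ((K : ℝ) - 1) ^ (p + 1) := by
  have hK1 : (1 : ℝ) < K := by exact_mod_cast (by omega : 1 < K)
  have hK0 : 0 < (K : ℝ) - 1 := by linarith
  have hD0 : 0 ≤ D := (mul_nonneg (norm_nonneg _) (pow_nonneg (Real.sqrt_nonneg _) _)).trans (hD₁ 0 0)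
  have hΛ := hc.pos
  rcases le_or_gt (max |(k.1 : ℝ)| |(k.2 : ℝ)|) B with hkB | hkB
  · rw [hierInterp_of_le hB c N K φ hkB, sub_self, norm_zero]
    positivity
  · have hkN : max |(k.1 : ℝ)| |(k.2 : ℝ)| ≤ 3 ^ levels B N * B := by
      refine le_trans ?_ (le_three_pow_levels_mul hB hN)
      exact_mod_cast hk
    obtain ⟨j, hj, i, hi, hmem⟩ := exists_block hkB hkN
    set R := 3 ^ j * B with hR
    have hR0 : 0 < R := by positivity
    set h := spacing R K with hh
    have hh0 : 0 < h := by rw [hh, spacing]; positivity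
    have hhK : h * (K - 1) = 2 * R := by rw [hh, spacing]; field_simp
    -- The derivatives are evaluated on the closed block, edges included; it still avoids the open
    -- square of half side `R`.
    have hbr : ∀ s ∈ Set.Icc (left R i.1) (left R i.1 + h * (K - 1)),
        ∀ t ∈ Set.Icc (left R i.2) (left R i.2 + h * (K - 1)), R ≤ bracket (s, t) := by
      intro s hs t ht
      rw [hhK] at hs ht
      by_cases h1 : i.1 = 1
      · have h2 : i.2 ≠ 1 := fun h2 => hi (Prod.ext h1 h2)
        exact (le_abs_of_mem_Icc_left h2 ht).trans (abs_snd_le_bracket (s, t))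
      · exact (le_abs_of_mem_Icc_left h1 hs).trans (abs_fst_le_bracket (s, t))
    have hconv : ∀ {z : ℝ} {ξ : ℝ × ℝ}, 0 ≤ z → R ≤ bracket ξ → z * bracket ξ ^ (p + 1) ≤ D →
        z ≤ D / R ^ (p + 1) := fun hz hRξ hzD => by
      rw [le_div_iff₀ (by positivity)]
      exact (mul_le_mul_of_nonneg_left (pow_le_pow_left₀ hR0.le hRξ _) hz).trans hzD
    have hx := mem_Icc_left_of_mem_part hmem.1
    have hy := mem_Icc_left_of_mem_part hmem.2
    rw [← hhK] at hx hy
    rw [hierInterp_of_mem_block hB c N K φ hj hi (ξ := toPlane k) hmem]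
    refine (hc.tensor_error hK h₁ h₂ (D := D / R ^ (p + 1)) hh0
      (fun s hs t ht => hconv (norm_nonneg _) (hbr s hs t ht) (hD₁ s t))
      (fun s hs t ht => hconv (norm_nonneg _) (hbr s hs t ht) (hD₂ s t)) hx hy).trans_eq ?_
    rw [hh, spacing, div_pow, mul_pow]
    field_simp

/-! ### Symbol estimates -/

theorem one_le_bracket (ξ : ℝ × ℝ) : 1 ≤ bracket ξ :=
  Real.one_le_sqrt.2 (by nlinarith [sq_nonneg ξ.1, sq_nonneg ξ.2])

theorem bracket_pos (ξ : ℝ × ℝ) : 0 < bracket ξ := one_pos.trans_le (one_le_bracket ξ)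

theorem bracket_swap (s t : ℝ) : bracket (s, t) = bracket (t, s) := by
  simp only [bracket]; congr 1; ring

theorem bracket_rpow (ξ : ℝ × ℝ) (s : ℝ) : bracket ξ ^ s = (1 + ξ.1 ^ 2 + ξ.2 ^ 2) ^ (s / 2) := by
  rw [bracket, Real.sqrt_eq_rpow, ← Real.rpow_mul (by positivity)]
  congr 1; ring

theorem contDiff_bracket_rpow (s : ℝ) :
    ContDiff ℝ ((⊤ : ℕ∞) : WithTop ℕ∞) fun ξ : ℝ × ℝ => ((bracket ξ ^ s : ℝ) : ℂ) := by
  simp only [bracket_rpow]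
  refine Complex.ofRealCLM.contDiff.comp (ContDiff.rpow_const_of_ne (by fun_prop) fun ξ => ?_)
  positivity

/-- The estimate of order `s` for the derivative of order `n` of a family of functions of one
variable, with respect to a weight `w`. -/
def DerivBound {P : Type*} (w : P → ℝ → ℝ) (s : ℝ) (F : P → ℝ → ℂ) (n : ℕ) : Prop :=
  ∃ C : ℝ, ∀ y t, ‖iteratedDeriv n (F y) t‖ ≤ C * w y t ^ (s - n)

theorem DerivBound.mul {P : Type*} {w : P → ℝ → ℝ} (hw : ∀ y t, 0 < w y t) {s s' : ℝ}
    {F G : P → ℝ → ℂ} {n : ℕ} (hF : ∀ y, ContDiff ℝ n (F y)) (hG : ∀ y, ContDiff ℝ n (G y))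
    (hFb : ∀ k ≤ n, DerivBound w s F k) (hGb : ∀ k ≤ n, DerivBound w s' G k) :
    DerivBound w (s + s') (fun y t => F y t * G y t) n := by
  -- A dummy constant beyond `n` makes the constants a function on all of `ℕ`.
  have hF' : ∀ k, ∃ C : ℝ, k ≤ n → ∀ y t, ‖iteratedDeriv k (F y) t‖ ≤ C * w y t ^ (s - k) := fun k => by
    by_cases hk : k ≤ n
    · obtain ⟨C, hC⟩ := hFb k hk; exact ⟨C, fun _ => hC⟩
    · exact ⟨0, fun h => absurd h hk⟩
  have hG' : ∀ k, ∃ C : ℝ, k ≤ n → ∀ y t, ‖iteratedDeriv k (G y) t‖ ≤ C * w y t ^ (s' - k) := fun k => by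
    by_cases hk : k ≤ n
    · obtain ⟨C, hC⟩ := hGb k hk; exact ⟨C, fun _ => hC⟩
    · exact ⟨0, fun h => absurd h hk⟩
  choose A hA using hF'
  choose A' hA' using hG'
  refine ⟨∑ i ∈ Finset.range (n + 1), (n.choose i : ℝ) * A i * A' (n - i), fun y t => ?_⟩
  rw [← norm_iteratedFDeriv_eq_norm_iteratedDeriv]
  refine (norm_iteratedFDeriv_mul_le (hF y) (hG y) t le_rfl).trans ?_
  rw [Finset.sum_mul]
  refine Finset.sum_le_sum fun i hi => ?_
  have hi' : i ≤ n := Nat.lt_succ_iff.1 (Finset.mem_range.1 hi)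
  rw [norm_iteratedFDeriv_eq_norm_iteratedDeriv, norm_iteratedFDeriv_eq_norm_iteratedDeriv,
    mul_assoc, mul_assoc, mul_assoc]
  have e : w y t ^ (s + s' - n) = w y t ^ (s - i) * w y t ^ (s' - (n - i : ℕ)) := by
    rw [← Real.rpow_add (hw y t), Nat.cast_sub hi']; congr 1; ring
  rw [e]
  have h1 := hA i hi' y t
  have h2 := hA' (n - i) (Nat.sub_le _ _) y t
  have := mul_le_mul h1 h2 (norm_nonneg _) ((norm_nonneg _).trans h1)
  calc _ ≤ (n.choose i : ℝ) * (A i * w y t ^ (s - i) * (A' (n - i) * w y t ^ (s' - (n - i : ℕ)))) := by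
        gcongr
    _ = _ := by ring

theorem hasDerivAt_bracket_rpow (s y t : ℝ) :
    HasDerivAt (fun t => ((bracket (t, y) ^ s : ℝ) : ℂ))
      ((s : ℂ) * ((t : ℂ) * ((bracket (t, y) ^ (s - 2) : ℝ) : ℂ))) t := by
  have h1 : HasDerivAt (fun t : ℝ => 1 + t ^ 2 + y ^ 2) (2 * t) t := by
    have := ((hasDerivAt_pow 2 t).const_add 1).add_const (y ^ 2)
    simpa using this
  have h2 := h1.rpow_const (p := s / 2) (Or.inl (by positivity))
  have h3 := h2.ofReal_comp
  simp only [bracket_rpow]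
  convert h3 using 1
  rw [show (s - 2) / 2 = s / 2 - 1 by ring]
  push_cast
  ring

theorem derivBound_ofReal (n : ℕ) :
    DerivBound (fun y t : ℝ => bracket (t, y)) 1 (fun _ t => (t : ℂ)) n := by
  refine ⟨1, fun y t => ?_⟩
  have hd : deriv (fun t : ℝ => (t : ℂ)) = fun _ => 1 := by
    funext t; exact (hasDerivAt_id t).ofReal_comp.deriv
  rw [one_mul]
  rcases n with _ | _ | n
  · simpa using abs_fst_le_bracket (t, y)
  · simp [hd]
  · rw [iteratedDeriv_succ', hd, iteratedDeriv_const, if_neg (by omega), norm_zero]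
    exact (Real.rpow_pos_of_pos (bracket_pos _) _).le

/-- The derivative of `⟨ξ⟩^s` in `t` is `s t ⟨ξ⟩^{s-2}`, a product of factors of orders `1` and `s -
2`. Hence the induction runs over all `s` at once. -/
theorem derivBound_bracket_rpow (n : ℕ) (s : ℝ) :
    DerivBound (fun y t : ℝ => bracket (t, y)) s (fun y t => ((bracket (t, y) ^ s : ℝ) : ℂ)) n := by
  induction n using Nat.strong_induction_on generalizing s with
  | _ n ih =>
    rcases n with _ | n
    · refine ⟨1, fun y t => ?_⟩
      rw [iteratedDeriv_zero, Complex.norm_real, Real.norm_eq_abs,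
        abs_of_pos (Real.rpow_pos_of_pos (bracket_pos _) _)]
      simp
    · have hsm : ∀ (s y : ℝ), ContDiff ℝ n fun t => ((bracket (t, y) ^ s : ℝ) : ℂ) := fun s y =>
        ((contDiff_bracket_rpow s).comp (contDiff_id.prodMk contDiff_const)).of_le
          (by exact_mod_cast le_top)
      have hof : ContDiff ℝ n fun t : ℝ => (t : ℂ) := Complex.ofRealCLM.contDiff
      obtain ⟨C, hC⟩ := DerivBound.mul (w := fun y t : ℝ => bracket (t, y))
        (fun y t => bracket_pos _) (F := fun _ t => (t : ℂ))
        (G := fun y t => ((bracket (t, y) ^ (s - 2) : ℝ) : ℂ)) (fun y => hof)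
        (fun y => hsm (s - 2) y) (fun k _ => derivBound_ofReal k) (fun k hk => ih k (by omega) (s - 2))
      refine ⟨|s| * C, fun y t => ?_⟩
      rw [iteratedDeriv_succ', funext fun t => (hasDerivAt_bracket_rpow s y t).deriv]
      have := iteratedDeriv_const_mul (n := n) (x := t) (s : ℂ) (hof.mul (hsm (s - 2) y)).contDiffAt
      rw [this, norm_mul, Complex.norm_real, Real.norm_eq_abs, mul_assoc]
      refine mul_le_mul_of_nonneg_left ?_ (abs_nonneg _)
      refine (hC y t).trans_eq ?_
      congr 2
      push_cast; ring

/-! ### Spatial derivatives and normalization to order zero. -/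

/-- The derivative of order `r` in the first spatial variable. -/
def xDeriv₁ (r : ℕ) (a : ℝ × ℝ → ℝ × ℝ → ℂ) (x ξ : ℝ × ℝ) : ℂ :=
  iteratedDeriv r (fun y => a (y, x.2) ξ) x.1

/-- The derivative of order `r` in the second spatial variable. -/
def xDeriv₂ (r : ℕ) (a : ℝ × ℝ → ℝ × ℝ → ℂ) (x ξ : ℝ × ℝ) : ℂ :=
  iteratedDeriv r (fun y => a (x.1, y) ξ) x.2

/-- A directional derivative is the Fréchet derivative applied to a fixed vector, hence smooth
jointly in all variables. -/
theorem contDiff_deriv_of_affine {E : Type*} [NormedAddCommGroup E] [NormedSpace ℝ E] {g : E → ℂ}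
    (hg : ContDiff ℝ ((⊤ : ℕ∞) : WithTop ℕ∞) g) (v : E) (γ : E → ℝ → E) (τ : E → ℝ)
    (hγ : ∀ z, HasDerivAt (γ z) v (τ z)) (hz : ∀ z, γ z (τ z) = z) :
    ContDiff ℝ ((⊤ : ℕ∞) : WithTop ℕ∞) fun z => deriv (fun y => g (γ z y)) (τ z) := by
  have h : (fun z => deriv (fun y => g (γ z y)) (τ z)) = fun z => fderiv ℝ g z v := by
    funext z
    have h1 : HasFDerivAt g (fderiv ℝ g z) (γ z (τ z)) := by
      rw [hz]; exact (hg.differentiable (by simp) z).hasFDerivAt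
    exact (h1.comp_hasDerivAt _ (hγ z)).deriv
  rw [h]
  exact (hg.fderiv_right (m := ((⊤ : ℕ∞) : WithTop ℕ∞)) (by simp)).clm_apply contDiff_const

theorem contDiff_xDeriv₁ {a : ℝ × ℝ → ℝ × ℝ → ℂ}
    (ha : ContDiff ℝ ((⊤ : ℕ∞) : WithTop ℕ∞) fun z : (ℝ × ℝ) × (ℝ × ℝ) => a z.1 z.2) (r : ℕ) :
    ContDiff ℝ ((⊤ : ℕ∞) : WithTop ℕ∞) fun z : (ℝ × ℝ) × (ℝ × ℝ) => xDeriv₁ r a z.1 z.2 := by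
  induction r with
  | zero => simpa [xDeriv₁] using ha
  | succ r ih =>
    simp only [xDeriv₁, iteratedDeriv_succ]
    exact contDiff_deriv_of_affine ih ((1, 0), (0, 0)) (fun z y => ((y, z.1.2), z.2)) (fun z => z.1.1)
      (fun z => ((hasDerivAt_id _).prodMk (hasDerivAt_const _ _)).prodMk (hasDerivAt_const _ _))
      (fun z => rfl)

theorem contDiff_xDeriv₂ {a : ℝ × ℝ → ℝ × ℝ → ℂ}
    (ha : ContDiff ℝ ((⊤ : ℕ∞) : WithTop ℕ∞) fun z : (ℝ × ℝ) × (ℝ × ℝ) => a z.1 z.2) (r : ℕ) :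
    ContDiff ℝ ((⊤ : ℕ∞) : WithTop ℕ∞) fun z : (ℝ × ℝ) × (ℝ × ℝ) => xDeriv₂ r a z.1 z.2 := by
  induction r with
  | zero => simpa [xDeriv₂] using ha
  | succ r ih =>
    simp only [xDeriv₂, iteratedDeriv_succ]
    exact contDiff_deriv_of_affine ih ((0, 1), (0, 0)) (fun z y => ((z.1.1, y), z.2)) (fun z => z.1.2)
      (fun z => ((hasDerivAt_const _ _).prodMk (hasDerivAt_id _)).prodMk (hasDerivAt_const _ _))
      (fun z => rfl)

/-- A bound `D` for `ψ` and for its pure derivatives of order `n` in frequency, of order zero. -/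
def ZeroOrderBound (n : ℕ) (D : ℝ) (ψ : ℝ × ℝ → ℝ × ℝ → ℂ) : Prop :=
  ∀ x, (∀ s t, ‖ψ x (s, t)‖ ≤ D) ∧
    (∀ s t, ‖iteratedDeriv n (fun s => ψ x (s, t)) s‖ * bracket (s, t) ^ n ≤ D) ∧
    ∀ s t, ‖iteratedDeriv n (fun t => ψ x (s, t)) t‖ * bracket (s, t) ^ n ≤ D

/-- The position `x` and the frozen frequency variable are treated as parameters in the Leibniz
estimate, which makes the constant uniform in them. -/
theorem exists_zeroOrderBound {m : ℝ} {g : ℝ × ℝ → ℝ × ℝ → ℂ}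
    (hg : ContDiff ℝ ((⊤ : ℕ∞) : WithTop ℕ∞) fun z : (ℝ × ℝ) × (ℝ × ℝ) => g z.1 z.2)
    (h₁ : ∀ k : ℕ, ∃ C : ℝ, ∀ x s t,
      ‖iteratedDeriv k (fun s => g x (s, t)) s‖ ≤ C * bracket (s, t) ^ (m - k))
    (h₂ : ∀ k : ℕ, ∃ C : ℝ, ∀ x s t,
      ‖iteratedDeriv k (fun t => g x (s, t)) t‖ ≤ C * bracket (s, t) ^ (m - k)) (n : ℕ) :
    ∃ D, ZeroOrderBound n D fun x ξ => g x ξ * ((bracket ξ ^ (-m) : ℝ) : ℂ) := by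
  have hfin : ∀ {f : ℝ → ℂ}, ContDiff ℝ ((⊤ : ℕ∞) : WithTop ℕ∞) f → ContDiff ℝ n f := fun h =>
    h.of_le (by exact_mod_cast le_top)
  have hconv : ∀ {C z : ℝ} {ξ : ℝ × ℝ}, z ≤ C * bracket ξ ^ (m + -m - n) → z * bracket ξ ^ n ≤ C := by
    intro C z ξ h
    have hb := pow_pos (bracket_pos ξ) n
    rw [show m + -m - (n : ℝ) = -(n : ℝ) by ring, Real.rpow_neg (bracket_pos ξ).le,
      Real.rpow_natCast, ← div_eq_mul_inv] at h
    exact (le_div_iff₀ hb).1 h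
  obtain ⟨C₀, hC₀⟩ := h₁ 0
  obtain ⟨C₁, hC₁⟩ := DerivBound.mul (P := (ℝ × ℝ) × ℝ) (w := fun y s => bracket (s, y.2)) (n := n)
    (fun y t => bracket_pos _) (s := m) (s' := -m) (F := fun y s => g y.1 (s, y.2))
    (G := fun y s => ((bracket (s, y.2) ^ (-m) : ℝ) : ℂ))
    (fun y => hfin (hg.comp (contDiff_const.prodMk (contDiff_id.prodMk contDiff_const))))
    (fun y => hfin ((contDiff_bracket_rpow (-m)).comp (contDiff_id.prodMk contDiff_const)))
    (fun k _ => by obtain ⟨C, hC⟩ := h₁ k; exact ⟨C, fun y s => hC y.1 s y.2⟩)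
    (fun k _ => by obtain ⟨C, hC⟩ := derivBound_bracket_rpow k (-m); exact ⟨C, fun y s => hC y.2 s⟩)
  obtain ⟨C₂, hC₂⟩ := DerivBound.mul (P := (ℝ × ℝ) × ℝ) (w := fun y t => bracket (y.2, t)) (n := n)
    (fun y t => bracket_pos _) (s := m) (s' := -m) (F := fun y t => g y.1 (y.2, t))
    (G := fun y t => ((bracket (y.2, t) ^ (-m) : ℝ) : ℂ))
    (fun y => hfin (hg.comp (contDiff_const.prodMk (contDiff_const.prodMk contDiff_id))))
    (fun y => hfin ((contDiff_bracket_rpow (-m)).comp (contDiff_const.prodMk contDiff_id)))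
    (fun k _ => by obtain ⟨C, hC⟩ := h₂ k; exact ⟨C, fun y t => hC y.1 y.2 t⟩)
    (fun k _ => by
      obtain ⟨C, hC⟩ := derivBound_bracket_rpow k (-m)
      refine ⟨C, fun y t => ?_⟩
      simp only [bracket_swap y.2]
      exact hC y.2 t)
  refine ⟨max C₀ (max C₁ C₂), fun x => ⟨fun s t => ?_, fun s t => ?_, fun s t => ?_⟩⟩
  · refine le_trans ?_ (le_max_left _ _)
    rw [norm_mul, Complex.norm_real, Real.norm_eq_abs,
      abs_of_pos (Real.rpow_pos_of_pos (bracket_pos _) _), Real.rpow_neg (bracket_pos _).le,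
      ← div_eq_mul_inv, div_le_iff₀ (Real.rpow_pos_of_pos (bracket_pos _) _)]
    simpa using hC₀ x s t
  · exact le_trans (hconv (hC₁ (x, t) s)) ((le_max_left _ _).trans (le_max_right _ _))
  · exact le_trans (hconv (hC₂ (x, s) t)) ((le_max_right _ _).trans (le_max_right _ _))

theorem ZeroOrderBound.mono {n : ℕ} {D D' : ℝ} {ψ : ℝ × ℝ → ℝ × ℝ → ℂ} (h : ZeroOrderBound n D ψ)
    (hD : D ≤ D') : ZeroOrderBound n D' ψ := fun x =>
  ⟨fun s t => ((h x).1 s t).trans hD, fun s t => ((h x).2.1 s t).trans hD,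
    fun s t => ((h x).2.2 s t).trans hD⟩

/-- Spatial derivatives do not change the order of a symbol. One constant is taken for the three
functions that control the Fourier coefficients and their interpolation errors. -/
theorem IsSymbol.exists_zeroOrderBound {m : ℝ} {a : ℝ × ℝ → ℝ × ℝ → ℂ} (ha : IsSymbol m a)
    (n r : ℕ) : ∃ D,
      ZeroOrderBound n D (fun x ξ => a x ξ * ((bracket ξ ^ (-m) : ℝ) : ℂ)) ∧
      ZeroOrderBound n D (fun x ξ => xDeriv₁ r a x ξ * ((bracket ξ ^ (-m) : ℝ) : ℂ)) ∧
      ZeroOrderBound n D (fun x ξ => xDeriv₂ r a x ξ * ((bracket ξ ^ (-m) : ℝ) : ℂ)) := by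
  obtain ⟨D₁, h₁⟩ := HierSpline.exists_zeroOrderBound (m := m) (contDiff_xDeriv₁ ha.smooth r)
    (fun k => by
      obtain ⟨C, hC⟩ := ha.estimate (k, 0) (r, 0)
      exact ⟨C, fun x s t => by simpa [partialDeriv, xDeriv₁] using hC x (s, t)⟩)
    (fun k => by
      obtain ⟨C, hC⟩ := ha.estimate (0, k) (r, 0)
      exact ⟨C, fun x s t => by simpa [partialDeriv, xDeriv₁] using hC x (s, t)⟩) n
  obtain ⟨D₂, h₂⟩ := HierSpline.exists_zeroOrderBound (m := m) (contDiff_xDeriv₂ ha.smooth r)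
    (fun k => by
      obtain ⟨C, hC⟩ := ha.estimate (k, 0) (0, r)
      exact ⟨C, fun x s t => by simpa [partialDeriv, xDeriv₂] using hC x (s, t)⟩)
    (fun k => by
      obtain ⟨C, hC⟩ := ha.estimate (0, k) (0, r)
      exact ⟨C, fun x s t => by simpa [partialDeriv, xDeriv₂] using hC x (s, t)⟩) n
  obtain ⟨D₀, h₀⟩ := HierSpline.exists_zeroOrderBound (m := m) ha.smooth
    (fun k => by
      obtain ⟨C, hC⟩ := ha.estimate (k, 0) (0, 0)
      exact ⟨C, fun x s t => by simpa [partialDeriv] using hC x (s, t)⟩)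
    (fun k => by
      obtain ⟨C, hC⟩ := ha.estimate (0, k) (0, 0)
      exact ⟨C, fun x s t => by simpa [partialDeriv] using hC x (s, t)⟩) n
  exact ⟨max D₀ (max D₁ D₂), h₀.mono (le_max_left _ _),
    h₁.mono ((le_max_left _ _).trans (le_max_right _ _)),
    h₂.mono ((le_max_right _ _).trans (le_max_right _ _))⟩

/-! ### Fourier series on the square -/

/-- The character `t ↦ e^{2πint}`. -/
def char1 (n : ℤ) (t : ℝ) : ℂ := Complex.exp (2 * (Real.pi : ℂ) * Complex.I * n * t)

theorem expo_eq (k : ℤ × ℤ) (x : ℝ × ℝ) : expo k x = char1 k.1 x.1 * char1 k.2 x.2 := by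
  rw [expo, char1, char1, ← Complex.exp_add]
  congr 1; push_cast; ring

theorem norm_char1 (n : ℤ) (t : ℝ) : ‖char1 n t‖ = 1 := by
  rw [char1, show 2 * (Real.pi : ℂ) * Complex.I * n * t = ((2 * Real.pi * n * t : ℝ) : ℂ) * Complex.I by
    push_cast; ring, Complex.norm_exp_ofReal_mul_I]

theorem norm_expo (k : ℤ × ℤ) (x : ℝ × ℝ) : ‖expo k x‖ = 1 := by
  rw [expo_eq, norm_mul, norm_char1, norm_char1, one_mul]

theorem continuous_char1 (n : ℤ) : Continuous (char1 n) := by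
  unfold char1; fun_prop

theorem continuous_expo (k : ℤ × ℤ) : Continuous (expo k) := by
  unfold expo; fun_prop

theorem char1_add (n n' : ℤ) (t : ℝ) : char1 (n + n') t = char1 n t * char1 n' t := by
  rw [char1, char1, char1, ← Complex.exp_add]; congr 1; push_cast; ring

theorem expo_add (k k' : ℤ × ℤ) (x : ℝ × ℝ) : expo (k + k') x = expo k x * expo k' x := by
  simp only [expo_eq, Prod.fst_add, Prod.snd_add, char1_add]; ring

theorem conj_expo (k : ℤ × ℤ) (x : ℝ × ℝ) : (starRingEnd ℂ) (expo k x) = expo (-k) x := by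
  rw [expo, expo, ← Complex.exp_conj]
  congr 1
  simp only [map_mul, Complex.conj_ofReal, Complex.conj_I, map_ofNat]
  push_cast [Prod.fst_neg, Prod.snd_neg]
  ring

theorem char1_zero_right (n : ℤ) : char1 n 0 = 1 := by simp [char1]

theorem char1_one_right (n : ℤ) : char1 n 1 = 1 := by
  rw [char1, Complex.exp_eq_one_iff]
  exact ⟨n, by push_cast; ring⟩

theorem hasDerivAt_char1 (n : ℤ) (t : ℝ) :
    HasDerivAt (char1 n) (2 * (Real.pi : ℂ) * Complex.I * n * char1 n t) t := by
  have h : HasDerivAt (fun z : ℂ => Complex.exp (2 * (Real.pi : ℂ) * Complex.I * n * z))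
      (Complex.exp (2 * (Real.pi : ℂ) * Complex.I * n * t) * (2 * (Real.pi : ℂ) * Complex.I * n))
      (t : ℂ) := by
    have := ((hasDerivAt_id (t : ℂ)).const_mul (2 * (Real.pi : ℂ) * Complex.I * n)).cexp
    simpa using this
  have h' := h.comp_ofReal
  rwa [mul_comm (Complex.exp _)] at h'

theorem two_pi_I_mul_ne_zero {n : ℤ} (hn : n ≠ 0) : 2 * (Real.pi : ℂ) * Complex.I * n ≠ 0 := by
  simp [Real.pi_ne_zero, hn]

theorem integral_char1_mul_periodic {n : ℤ} (hn : n ≠ 0) {g : ℝ → ℂ} (hg : ContDiff ℝ 1 g)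
    (hper : g 1 = g 0) : ∫ t in (0 : ℝ)..1, char1 n t * g t
      = -(2 * (Real.pi : ℂ) * Complex.I * n)⁻¹ * ∫ t in (0 : ℝ)..1, char1 n t * deriv g t := by
  have hd : ∀ t, HasDerivAt g (deriv g t) t := fun t => (hg.differentiable one_ne_zero t).hasDerivAt
  have hc : Continuous (deriv g) := hg.continuous_deriv le_rfl
  have h := intervalIntegral.integral_mul_deriv_eq_deriv_mul (a := 0) (b := 1)
    (fun t _ => hasDerivAt_char1 n t) (fun t _ => hd t)
    ((by have := continuous_char1 n; fun_prop : Continuous fun t =>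
      2 * (Real.pi : ℂ) * Complex.I * n * char1 n t).intervalIntegrable 0 1)
    (hc.intervalIntegrable 0 1)
  rw [char1_one_right, char1_zero_right, hper, sub_self, zero_sub] at h
  rw [h]
  have : ∀ t : ℝ, 2 * (Real.pi : ℂ) * Complex.I * n * char1 n t * g t
      = (2 * (Real.pi : ℂ) * Complex.I * n) * (char1 n t * g t) := fun t => by ring
  simp only [this]
  rw [intervalIntegral.integral_const_mul, neg_mul_neg, ← mul_assoc,
    inv_mul_cancel₀ (two_pi_I_mul_ne_zero hn), one_mul]

/-- Each integration by parts gains `1/(2π|n|)`, and periodicity cancels the boundary terms. -/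
theorem norm_integral_char1_mul_le {n : ℤ} (hn : n ≠ 0) (r : ℕ) {g : ℝ → ℂ} (hg : ContDiff ℝ r g)
    (hper : Function.Periodic g 1) {D : ℝ} (hD : ∀ t, ‖iteratedDeriv r g t‖ ≤ D) :
    ‖∫ t in (0 : ℝ)..1, char1 n t * g t‖ * |(n : ℝ)| ^ r ≤ D := by
  induction r generalizing g with
  | zero =>
    rw [pow_zero, mul_one]
    have := intervalIntegral.norm_integral_le_of_norm_le_const (a := (0 : ℝ)) (b := 1) (C := D)
      (f := fun t => char1 n t * g t) fun t _ => by
        rw [norm_mul, norm_char1, one_mul]; simpa using hD t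
    simpa using this
  | succ r ih =>
    have hg1 : ContDiff ℝ 1 g := hg.of_le (by exact_mod_cast Nat.le_add_left 1 r)
    have hgd : ContDiff ℝ r (deriv g) := by
      have := (contDiff_succ_iff_deriv (n := (r : WithTop ℕ∞))).1 (by exact_mod_cast hg)
      exact this.2.2
    have hperd : Function.Periodic (deriv g) 1 := fun t => by
      have : (fun s => g (s + 1)) = g := funext hper
      rw [← deriv_comp_add_const, this]
    have h := ih hgd hperd (fun t => by rw [← iteratedDeriv_succ']; exact hD t)
    have hper0 : g 1 = g 0 := by simpa using hper 0
    rw [integral_char1_mul_periodic hn hg1 hper0, norm_mul, norm_neg, norm_inv]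
    have hnorm : ‖2 * (Real.pi : ℂ) * Complex.I * n‖ = 2 * Real.pi * |(n : ℝ)| := by
      simp [abs_of_pos Real.pi_pos]
    rw [hnorm]
    have hn0 : 0 < |(n : ℝ)| := abs_pos.2 (by exact_mod_cast hn)
    have hpi : (1 : ℝ) ≤ 2 * Real.pi := by linarith [Real.pi_gt_three]
    set I := ‖∫ t in (0 : ℝ)..1, char1 n t * deriv g t‖
    calc (2 * Real.pi * |(n : ℝ)|)⁻¹ * I * |(n : ℝ)| ^ (r + 1)
        = (2 * Real.pi)⁻¹ * (I * |(n : ℝ)| ^ r) := by field_simp; ring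
      _ ≤ 1 * (I * |(n : ℝ)| ^ r) := by
          gcongr
          exact inv_le_one_of_one_le₀ hpi
      _ ≤ D := by rwa [one_mul]

/-- The Fourier coefficient of a function on the unit square. -/
def squareCoeff (F : ℝ × ℝ → ℂ) (l : ℤ × ℤ) : ℂ := ∫ x in unitSquare, expo (-l) x * F x

theorem integrableOn_unitSquare {F : ℝ × ℝ → ℂ} (hF : Continuous F) : IntegrableOn F unitSquare :=
  hF.continuousOn.integrableOn_compact (isCompact_Icc.prod isCompact_Icc)

theorem squareCoeff_eq_iterated₁ {F : ℝ × ℝ → ℂ} (hF : Continuous F) (l : ℤ × ℤ) :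
    squareCoeff F l = ∫ y in Set.Icc (0 : ℝ) 1,
      char1 (-l.2) y * ∫ x in (0 : ℝ)..1, char1 (-l.1) x * F (x, y) := by
  rw [squareCoeff, unitSquare, Measure.volume_eq_prod, ← Measure.prod_restrict, integral_prod_symm]
  · congr 1
    funext y
    rw [intervalIntegral.integral_of_le zero_le_one,
      ← integral_Icc_eq_integral_Ioc, ← integral_const_mul]
    congr 1
    funext x
    rw [expo_eq]
    simp only [Prod.fst_neg, Prod.snd_neg]
    ring
  · rw [Measure.prod_restrict]
    exact integrableOn_unitSquare ((continuous_expo _).mul hF)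

theorem squareCoeff_eq_iterated₂ {F : ℝ × ℝ → ℂ} (hF : Continuous F) (l : ℤ × ℤ) :
    squareCoeff F l = ∫ x in Set.Icc (0 : ℝ) 1,
      char1 (-l.1) x * ∫ y in (0 : ℝ)..1, char1 (-l.2) y * F (x, y) := by
  rw [squareCoeff, unitSquare, Measure.volume_eq_prod, setIntegral_prod]
  · congr 1
    funext y
    rw [intervalIntegral.integral_of_le zero_le_one,
      ← integral_Icc_eq_integral_Ioc, ← integral_const_mul]
    congr 1
    funext x
    rw [expo_eq]
    simp only [Prod.fst_neg, Prod.snd_neg]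
    ring
  · exact integrableOn_unitSquare ((continuous_expo _).mul hF)

theorem norm_setIntegral_char1_mul_le {D : ℝ} (n : ℤ) {G : ℝ → ℂ} (hG : ∀ y, ‖G y‖ ≤ D) :
    ‖∫ y in Set.Icc (0 : ℝ) 1, char1 n y * G y‖ ≤ D := by
  have := norm_setIntegral_le_of_norm_le_const (μ := volume) (s := Set.Icc (0 : ℝ) 1) (C := D)
    (f := fun y => char1 n y * G y) (by simp) fun y _ => by
      rw [norm_mul, norm_char1, one_mul]; exact hG y
  simpa using this

/-- The weight `(1 + |l₁|) (1 + |l₂|)`. -/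
def freqWeight (l : ℤ × ℤ) : ℝ := (1 + |(l.1 : ℝ)|) * (1 + |(l.2 : ℝ)|)

theorem one_le_freqWeight (l : ℤ × ℤ) : 1 ≤ freqWeight l := by
  have h1 := abs_nonneg (l.1 : ℝ)
  have h2 := abs_nonneg (l.2 : ℝ)
  unfold freqWeight
  nlinarith

theorem one_add_max_le_freqWeight (l : ℤ × ℤ) : 1 + max |(l.1 : ℝ)| |(l.2 : ℝ)| ≤ freqWeight l := by
  have h1 := abs_nonneg (l.1 : ℝ)
  have h2 := abs_nonneg (l.2 : ℝ)
  unfold freqWeight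
  rcases max_choice |(l.1 : ℝ)| |(l.2 : ℝ)| with h | h <;> rw [h] <;> nlinarith

/-- Derivatives of order `2s` in the variable with the larger frequency gain `max(|l₁|,|l₂|)^{2s}`,
which dominates `ω_l^s` up to `4^s` when `l ≠ 0`. Mixed derivatives are thus avoided. -/
theorem norm_squareCoeff_mul_le (s : ℕ) {F : ℝ × ℝ → ℂ} (hF : Continuous F)
    (h₁ : ∀ y, ContDiff ℝ (2 * s : ℕ) fun x => F (x, y))
    (h₂ : ∀ x, ContDiff ℝ (2 * s : ℕ) fun y => F (x, y))
    (hp₁ : ∀ y, Function.Periodic (fun x => F (x, y)) 1)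
    (hp₂ : ∀ x, Function.Periodic (fun y => F (x, y)) 1) {D : ℝ} (hD : ∀ x, ‖F x‖ ≤ D)
    (hD₁ : ∀ x y, ‖iteratedDeriv (2 * s) (fun x => F (x, y)) x‖ ≤ D)
    (hD₂ : ∀ x y, ‖iteratedDeriv (2 * s) (fun y => F (x, y)) y‖ ≤ D) (l : ℤ × ℤ) :
    ‖squareCoeff F l‖ * freqWeight l ^ s ≤ 4 ^ s * D := by
  have hD0 : 0 ≤ D := (norm_nonneg _).trans (hD 0)
  have hl₀ : ‖squareCoeff F l‖ ≤ D := by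
    rw [squareCoeff_eq_iterated₁ hF]
    refine norm_setIntegral_char1_mul_le _ fun y => ?_
    have := intervalIntegral.norm_integral_le_of_norm_le_const (a := (0 : ℝ)) (b := 1) (C := D)
      (f := fun t => char1 (-l.1) t * F (t, y)) fun t _ => by
        rw [norm_mul, norm_char1, one_mul]; exact hD _
    simpa using this
  have hl₁ : ‖squareCoeff F l‖ * |(l.1 : ℝ)| ^ (2 * s) ≤ D := by
    rcases eq_or_ne l.1 0 with h | h
    · rcases Nat.eq_zero_or_pos s with rfl | hs
      · simpa using hl₀
      · rw [h, Int.cast_zero, abs_zero, zero_pow (by omega), mul_zero]; exact hD0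
    · have hpos : 0 < |(l.1 : ℝ)| ^ (2 * s) := pow_pos (abs_pos.2 (by exact_mod_cast h)) _
      rw [← le_div_iff₀ hpos, squareCoeff_eq_iterated₁ hF]
      refine norm_setIntegral_char1_mul_le _ fun y => ?_
      rw [le_div_iff₀ hpos]
      simpa using norm_integral_char1_mul_le (neg_ne_zero.2 h) _ (h₁ y) (hp₁ y) (fun t => hD₁ t y)
  have hl₂ : ‖squareCoeff F l‖ * |(l.2 : ℝ)| ^ (2 * s) ≤ D := by
    rcases eq_or_ne l.2 0 with h | h
    · rcases Nat.eq_zero_or_pos s with rfl | hs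
      · simpa using hl₀
      · rw [h, Int.cast_zero, abs_zero, zero_pow (by omega), mul_zero]; exact hD0
    · have hpos : 0 < |(l.2 : ℝ)| ^ (2 * s) := pow_pos (abs_pos.2 (by exact_mod_cast h)) _
      rw [← le_div_iff₀ hpos, squareCoeff_eq_iterated₂ hF]
      refine norm_setIntegral_char1_mul_le _ fun x => ?_
      rw [le_div_iff₀ hpos]
      simpa using norm_integral_char1_mul_le (neg_ne_zero.2 h) _ (h₂ x) (hp₂ x) (fun t => hD₂ x t)
  have hone : (1 : ℝ) ≤ 4 ^ s := one_le_pow₀ (by norm_num)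
  set M := max |(l.1 : ℝ)| |(l.2 : ℝ)| with hM
  have hlM : ‖squareCoeff F l‖ * M ^ (2 * s) ≤ D := by
    rcases max_choice |(l.1 : ℝ)| |(l.2 : ℝ)| with h | h <;> rw [hM, h] <;> assumption
  rcases eq_or_ne l 0 with rfl | hl
  · have : freqWeight 0 = 1 := by simp [freqWeight]
    rw [this, one_pow, mul_one]
    exact hl₀.trans (le_mul_of_one_le_left hD0 hone)
  · have hM1 : 1 ≤ M := by
      have : (1 : ℤ) ≤ max |l.1| |l.2| := by
        by_contra hcon
        have h1 := le_max_left |l.1| |l.2|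
        have h2 := le_max_right |l.1| |l.2|
        have h3 := abs_nonneg l.1
        have h4 := abs_nonneg l.2
        exact hl (Prod.ext (abs_eq_zero.1 (by omega)) (abs_eq_zero.1 (by omega)))
      rw [hM]
      exact_mod_cast this
    have hw : freqWeight l ≤ 4 * M ^ 2 := by
      have e1 : |(l.1 : ℝ)| ≤ M := le_max_left _ _
      have e2 : |(l.2 : ℝ)| ≤ M := le_max_right _ _
      calc freqWeight l ≤ (2 * M) * (2 * M) := by
            unfold freqWeight
            gcongr <;> linarith
        _ = _ := by ring
    calc ‖squareCoeff F l‖ * freqWeight l ^ s ≤ ‖squareCoeff F l‖ * (4 * M ^ 2) ^ s := by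
          gcongr
          exact zero_le_one.trans (one_le_freqWeight l)
      _ = 4 ^ s * (‖squareCoeff F l‖ * M ^ (2 * s)) := by rw [mul_pow, pow_mul]; ring
      _ ≤ _ := by gcongr

theorem summable_freqWeight : Summable fun l : ℤ × ℤ => (freqWeight l ^ 2)⁻¹ := by
  have h1 : Summable fun n : ℤ => ((1 + |(n : ℝ)|) ^ 2)⁻¹ := by
    have hn : Summable fun n : ℕ => ((1 + (n : ℝ)) ^ 2)⁻¹ := by
      have := (summable_nat_add_iff 1).2 (Real.summable_nat_pow_inv.2 (by norm_num : 1 < 2))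
      refine this.congr fun n => ?_
      push_cast; ring_nf
    apply Summable.of_nat_of_neg
    · simpa using hn
    · simpa using hn
  refine (h1.mul_of_nonneg h1 (fun n => by positivity) (fun n => by positivity)).congr fun l => ?_
  rw [freqWeight, mul_pow, mul_inv]

/-! ### Orthogonality of the exponentials and `L²` bounds. -/

theorem integral_char1 (n : ℤ) : ∫ t in Set.Icc (0 : ℝ) 1, char1 n t = if n = 0 then 1 else 0 := by
  rw [integral_Icc_eq_integral_Ioc, ← intervalIntegral.integral_of_le zero_le_one]
  split_ifs with h
  · subst h; simp [char1]
  · have := integral_char1_mul_periodic h (g := fun _ => 1) contDiff_const rfl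
    simpa using this

theorem integral_expo (k : ℤ × ℤ) : ∫ x in unitSquare, expo k x = if k = 0 then 1 else 0 := by
  simp only [expo_eq]
  rw [unitSquare, Measure.volume_eq_prod, setIntegral_prod_mul, integral_char1, integral_char1]
  by_cases h1 : k.1 = 0 <;> by_cases h2 : k.2 = 0 <;> simp [h1, h2, Prod.ext_iff]

theorem integral_normSq_sum_expo (s : Finset (ℤ × ℤ)) (g : ℤ × ℤ → ℂ) :
    ∫ x in unitSquare, ‖∑ k ∈ s, expo k x * g k‖ ^ 2 = ∑ k ∈ s, ‖g k‖ ^ 2 := by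
  have h : ∀ x, ((‖∑ k ∈ s, expo k x * g k‖ ^ 2 : ℝ) : ℂ)
      = ∑ k ∈ s, ∑ k' ∈ s, expo (k - k') x * (g k * (starRingEnd ℂ) (g k')) := by
    intro x
    rw [Complex.ofReal_pow, ← Complex.mul_conj', map_sum, Finset.sum_mul_sum]
    refine Finset.sum_congr rfl fun k _ => Finset.sum_congr rfl fun k' _ => ?_
    rw [map_mul, conj_expo, sub_eq_add_neg, expo_add]
    ring
  have h' : ((∫ x in unitSquare, ‖∑ k ∈ s, expo k x * g k‖ ^ 2 : ℝ) : ℂ)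
      = ((∑ k ∈ s, ‖g k‖ ^ 2 : ℝ) : ℂ) := by
    rw [← integral_complex_ofReal]
    simp only [h]
    have hint : ∀ k k' : ℤ × ℤ, IntegrableOn
        (fun x => expo (k - k') x * (g k * (starRingEnd ℂ) (g k'))) unitSquare := fun k k' =>
      integrableOn_unitSquare ((continuous_expo _).mul continuous_const)
    rw [integral_finsetSum _ fun k _ => integrable_finsetSum _ fun k' _ => hint k k']
    push_cast
    refine Finset.sum_congr rfl fun k hk => ?_
    rw [integral_finsetSum _ fun k' _ => hint k k']
    simp only [integral_mul_const, integral_expo, sub_eq_zero]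
    simp [hk, Complex.mul_conj']
  exact_mod_cast h'

theorem eLpNorm_sum_expo_le (s : Finset (ℤ × ℤ)) (g : ℤ × ℤ → ℂ) {A : ℝ} (hA : 0 ≤ A)
    (hg : ∑ k ∈ s, ‖g k‖ ^ 2 ≤ A ^ 2) :
    eLpNorm (fun x => ∑ k ∈ s, expo k x * g k) 2 (volume.restrict unitSquare) ≤ ENNReal.ofReal A := by
  have hc : Continuous fun x => ∑ k ∈ s, expo k x * g k :=
    continuous_finsetSum _ fun k _ => (continuous_expo k).mul continuous_const
  have hmem : MemLp (fun x => ∑ k ∈ s, expo k x * g k) 2 (volume.restrict unitSquare) := by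
    rw [memLp_two_iff_integrable_sq_norm hc.aestronglyMeasurable]
    exact (hc.norm.pow 2).continuousOn.integrableOn_compact (isCompact_Icc.prod isCompact_Icc)
  rw [hmem.eLpNorm_eq_integral_rpow_norm two_ne_zero ENNReal.ofNat_ne_top]
  apply ENNReal.ofReal_le_ofReal
  simp only [ENNReal.toReal_ofNat, Real.rpow_two]
  rw [integral_normSq_sum_expo, ← one_div, ← Real.sqrt_eq_rpow]
  exact Real.sqrt_le_iff.2 ⟨hA, hg⟩

/-- The triangle inequality for a series converging only pointwise: the partial sums are bounded by
Minkowski and the limit by Fatou. -/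
theorem eLpNorm_le_of_hasSum {α ι : Type*} [MeasurableSpace α] {μ : Measure α} [Denumerable ι]
    {H : ι → α → ℂ} {T : α → ℂ} (hH : ∀ i, AEStronglyMeasurable (H i) μ)
    (hsum : ∀ x, HasSum (fun i => H i x) (T x)) {w : ι → ℝ} (hw : ∀ i, 0 ≤ w i) {W : ℝ}
    (hW : HasSum w W) (hle : ∀ i, eLpNorm (H i) 2 μ ≤ ENNReal.ofReal (w i)) :
    eLpNorm T 2 μ ≤ ENNReal.ofReal W := by
  let e : ℕ ≃ ι := (Denumerable.eqv ι).symm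
  have hlim : ∀ x, Filter.Tendsto (fun n => ∑ i ∈ Finset.range n, H (e i) x) Filter.atTop
      (nhds (T x)) := fun x => ((e.hasSum_iff).2 (hsum x)).tendsto_sum_nat
  have hWn : ∀ n, ∑ i ∈ Finset.range n, w (e i) ≤ W := fun n =>
    sum_le_hasSum _ (fun i _ => hw (e i)) ((e.hasSum_iff).2 hW)
  have hm : ∀ n, AEStronglyMeasurable (fun x => ∑ i ∈ Finset.range n, H (e i) x) μ := fun n =>
    Finset.aestronglyMeasurable_fun_sum _ fun i _ => hH (e i)
  refine (Lp.eLpNorm_lim_le_liminf_eLpNorm hm T (Filter.Eventually.of_forall hlim)).trans ?_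
  refine Filter.liminf_le_of_le (by isBoundedDefault) fun b hb => ?_
  obtain ⟨n, hn⟩ := hb.exists
  refine hn.trans ?_
  have h1 : eLpNorm (fun x => ∑ i ∈ Finset.range n, H (e i) x) 2 μ
      ≤ ∑ i ∈ Finset.range n, eLpNorm (H (e i)) 2 μ := by
    have := eLpNorm_sum_le (s := Finset.range n) (f := fun i => H (e i)) (p := 2) (μ := μ)
      (fun i _ => hH (e i)) (by norm_num)
    convert this using 2
    funext x
    simp
  refine h1.trans ((Finset.sum_le_sum fun i _ => hle (e i)).trans ?_)
  rw [← ENNReal.ofReal_sum_of_nonneg fun i _ => hw (e i)]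
  exact ENNReal.ofReal_le_ofReal (hWn n)

/-! ### Fourier inversion on the square through the torus. -/

/-- A periodic function factors through the quotient map onto the torus; that map is open, so
continuity descends. -/
theorem exists_continuous_lift {F : ℝ × ℝ → ℂ} (hF : Continuous F)
    (hp : ∀ (k : ℤ × ℤ) (x : ℝ × ℝ), F (x.1 + k.1, x.2 + k.2) = F x) :
    ∃ f : C(UnitAddTorus (Fin 2), ℂ), ∀ x : Fin 2 → ℝ,
      f (fun i => (x i : UnitAddCircle)) = F (x 0, x 1) := by
  have hs : Function.Surjective ((↑) : ℝ → UnitAddCircle) := QuotientAddGroup.mk_surjective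
  have hq : IsOpenQuotientMap (Pi.map fun _ : Fin 2 => ((↑) : ℝ → UnitAddCircle)) :=
    IsOpenQuotientMap.piMap fun _ => QuotientAddGroup.isOpenQuotientMap_mk
  let f : UnitAddTorus (Fin 2) → ℂ := fun z =>
    F (Function.surjInv hs (z 0), Function.surjInv hs (z 1))
  have hf : ∀ x : Fin 2 → ℝ, f (fun i => (x i : UnitAddCircle)) = F (x 0, x 1) := by
    intro x
    have key : ∀ t : ℝ, ∃ n : ℤ, Function.surjInv hs (t : UnitAddCircle) = t + n := by
      intro t
      have h := Function.surjInv_eq hs (t : UnitAddCircle)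
      obtain ⟨n, hn⟩ := AddSubgroup.mem_zmultiples_iff.1 (QuotientAddGroup.eq.1 h.symm)
      exact ⟨n, by rw [zsmul_eq_mul, mul_one] at hn; linarith⟩
    obtain ⟨n₀, h₀⟩ := key (x 0)
    obtain ⟨n₁, h₁⟩ := key (x 1)
    simp only [f, h₀, h₁]
    exact hp (n₀, n₁) (x 0, x 1)
  refine ⟨⟨f, ?_⟩, hf⟩
  rw [hq.isQuotientMap.continuous_iff]
  have : f ∘ (Pi.map fun _ : Fin 2 => ((↑) : ℝ → UnitAddCircle)) = fun x => F (x 0, x 1) :=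
    funext hf
  rw [this]
  fun_prop

theorem mFourier_coe (n : Fin 2 → ℤ) (x : Fin 2 → ℝ) :
    UnitAddTorus.mFourier n (fun i => (x i : UnitAddCircle)) = expo (n 0, n 1) (x 0, x 1) := by
  simp [UnitAddTorus.mFourier, Fin.prod_univ_two, expo_eq, char1]

theorem setIntegral_finTwo (G : ℝ × ℝ → ℂ) :
    ∫ x in {x : Fin 2 → ℝ | ∀ i, x i ∈ Set.Ioc ((0 : Fin 2 → ℝ) i) ((0 : Fin 2 → ℝ) i + 1)},
      G (x 0, x 1) = ∫ x in unitSquare, G x := by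
  have hs : {x : Fin 2 → ℝ | ∀ i, x i ∈ Set.Ioc ((0 : Fin 2 → ℝ) i) ((0 : Fin 2 → ℝ) i + 1)}
      = MeasurableEquiv.finTwoArrow ⁻¹' (Set.Ioc (0 : ℝ) 1 ×ˢ Set.Ioc (0 : ℝ) 1) := by
    ext x
    simp [Fin.forall_fin_two, MeasurableEquiv.finTwoArrow]
  have h := (volume_preserving_finTwoArrow ℝ).setIntegral_preimage_emb
    MeasurableEquiv.finTwoArrow.measurableEmbedding G (Set.Ioc (0 : ℝ) 1 ×ˢ Set.Ioc (0 : ℝ) 1)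
  rw [hs]
  refine Eq.trans (by rfl) (h.trans ?_)
  refine setIntegral_congr_set ?_
  rw [unitSquare]
  exact Measure.set_prod_ae_eq Ioc_ae_eq_Icc Ioc_ae_eq_Icc

/-- A continuous periodic function with summable Fourier coefficients is the sum of its Fourier
series. -/
theorem hasSum_squareCoeff_mul_expo {F : ℝ × ℝ → ℂ} (hF : Continuous F)
    (hp : ∀ (k : ℤ × ℤ) (x : ℝ × ℝ), F (x.1 + k.1, x.2 + k.2) = F x)
    (hs : Summable (squareCoeff F)) (x : ℝ × ℝ) :
    HasSum (fun l => squareCoeff F l * expo l x) (F x) := by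
  obtain ⟨f, hf⟩ := exists_continuous_lift hF hp
  have hc : ∀ n : Fin 2 → ℤ, UnitAddTorus.mFourierCoeff f n = squareCoeff F (n 0, n 1) := by
    intro n
    rw [UnitAddTorus.mFourierCoeff_eq_integral _ _ 0, squareCoeff, ← setIntegral_finTwo]
    simp [hf, mFourier_coe]
  let e : (Fin 2 → ℤ) ≃ ℤ × ℤ := finTwoArrowEquiv ℤ
  have hs' : Summable (UnitAddTorus.mFourierCoeff f) := by
    have : UnitAddTorus.mFourierCoeff f = squareCoeff F ∘ e := funext hc
    rw [this]
    exact e.summable_iff.2 hs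
  have h := UnitAddTorus.hasSum_mFourier_series_apply_of_summable hs'
    (fun i => ((![x.1, x.2] i : ℝ) : UnitAddCircle))
  rw [hf] at h
  refine e.hasSum_iff.1 ?_
  convert h using 1
  · ext n
    rw [hc, mFourier_coe]
    simp [e]
  · simp

/-! ### Error of the interpolated Fourier coefficients of a symbol -/

/-- The symbol of order zero `a(x, ξ) ⟨ξ⟩^{-m}`. -/
def normalize (m : ℝ) (a : ℝ × ℝ → ℝ × ℝ → ℂ) (x ξ : ℝ × ℝ) : ℂ :=
  a x ξ * ((bracket ξ ^ (-m) : ℝ) : ℂ)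

theorem hCoeff_eq_squareCoeff (m : ℝ) (a : ℝ × ℝ → ℝ × ℝ → ℂ) (l : ℤ × ℤ) (ξ : ℝ × ℝ) :
    hCoeff m a l ξ = squareCoeff (fun x => normalize m a x ξ) l := by
  simp only [hCoeff, xCoeff, squareCoeff, normalize, ← mul_assoc]
  rw [integral_mul_const]

/-- The interpolation error of the normalized symbol at the frequency `ξ`. -/
def interpError (c : ℕ → ℕ → ℝ → ℝ) (B m : ℝ) (N K : ℕ) (a : ℝ × ℝ → ℝ × ℝ → ℂ)
    (x ξ : ℝ × ℝ) : ℂ :=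
  hierInterp c B N K (normalize m a x) ξ - normalize m a x ξ

section
variable {m : ℝ} {a : ℝ × ℝ → ℝ × ℝ → ℂ}

theorem contDiff_normalize_freq
    (ha : ContDiff ℝ ((⊤ : ℕ∞) : WithTop ℕ∞) fun z : (ℝ × ℝ) × (ℝ × ℝ) => a z.1 z.2) (x : ℝ × ℝ) :
    ContDiff ℝ ((⊤ : ℕ∞) : WithTop ℕ∞) (normalize m a x) :=
  (ha.comp (contDiff_const.prodMk contDiff_id)).mul (contDiff_bracket_rpow (-m))

theorem contDiff_normalize_space
    (ha : ContDiff ℝ ((⊤ : ℕ∞) : WithTop ℕ∞) fun z : (ℝ × ℝ) × (ℝ × ℝ) => a z.1 z.2) (ξ : ℝ × ℝ) :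
    ContDiff ℝ ((⊤ : ℕ∞) : WithTop ℕ∞) fun x => normalize m a x ξ :=
  (ha.comp (contDiff_id.prodMk contDiff_const)).mul contDiff_const

theorem contDiff_interpError (c : ℕ → ℕ → ℝ → ℝ) (B : ℝ) (N K : ℕ)
    (ha : ContDiff ℝ ((⊤ : ℕ∞) : WithTop ℕ∞) fun z : (ℝ × ℝ) × (ℝ × ℝ) => a z.1 z.2) (ξ : ℝ × ℝ) :
    ContDiff ℝ ((⊤ : ℕ∞) : WithTop ℕ∞) fun x => interpError c B m N K a x ξ :=
  (ContDiff.sum fun _ _ => (contDiff_normalize_space ha _).mul contDiff_const).sub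
    (contDiff_normalize_space ha ξ)

theorem norm_interpError_le {p : ℕ} {c : ℕ → ℕ → ℝ → ℝ} {Λ : ℝ} (hp : 1 ≤ p)
    (hc : IsStableFamily p c Λ) {B : ℝ} (hB : 0 < B) {N K : ℕ} (hK : p + 1 ≤ K) (hN : 0 < N)
    {k : ℤ × ℤ} (hk : max |k.1| |k.2| ≤ (N : ℤ))
    (ha : ContDiff ℝ ((⊤ : ℕ∞) : WithTop ℕ∞) fun z : (ℝ × ℝ) × (ℝ × ℝ) => a z.1 z.2) {D : ℝ}
    (hD : ZeroOrderBound (p + 1) D (normalize m a)) (x : ℝ × ℝ) :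
    ‖interpError c B m N K a x (toPlane k)‖
      ≤ (Λ + Λ ^ 2) * 2 ^ (p + 1) * D / ((K : ℝ) - 1) ^ (p + 1) :=
  have h : ContDiff ℝ (p + 1 : ℕ) (normalize m a x) :=
    (contDiff_normalize_freq ha x).of_le (by exact_mod_cast le_top)
  hc.hierInterp_error hp hB hK hN hk (fun _ => h.comp (contDiff_id.prodMk contDiff_const))
    (fun _ => h.comp (contDiff_const.prodMk contDiff_id)) (hD x).2.1 (hD x).2.2

theorem xDeriv₁_normalize (r : ℕ) (x ξ : ℝ × ℝ) :
    xDeriv₁ r (normalize m a) x ξ = normalize m (xDeriv₁ r a) x ξ := by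
  simp only [xDeriv₁, normalize, iteratedDeriv_mul_const_field]

theorem xDeriv₂_normalize (r : ℕ) (x ξ : ℝ × ℝ) :
    xDeriv₂ r (normalize m a) x ξ = normalize m (xDeriv₂ r a) x ξ := by
  simp only [xDeriv₂, normalize, iteratedDeriv_mul_const_field]

theorem iteratedDeriv_sum_mul_sub {ι : Type*} (s : Finset ι) (r : ℕ) {f : ι → ℝ → ℂ} {g : ℝ → ℂ}
    (κ : ι → ℂ) (hf : ∀ i, ContDiff ℝ r (f i)) (hg : ContDiff ℝ r g) (t : ℝ) :
    iteratedDeriv r (fun y => ∑ i ∈ s, f i y * κ i - g y) t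
      = ∑ i ∈ s, iteratedDeriv r (f i) t * κ i - iteratedDeriv r g t := by
  have h := iteratedDeriv_sub (n := r) (x := t) (f := fun y => ∑ i ∈ s, f i y * κ i) (g := g)
    (ContDiff.sum fun i _ => (hf i).mul contDiff_const).contDiffAt hg.contDiffAt
  refine h.trans ?_
  rw [iteratedDeriv_fun_sum fun i _ => ((hf i).mul contDiff_const).contDiffAt]
  simp only [iteratedDeriv_mul_const_field]

theorem xDeriv₁_interpError (c : ℕ → ℕ → ℝ → ℝ) (B : ℝ) (N K r : ℕ)
    (ha : ContDiff ℝ ((⊤ : ℕ∞) : WithTop ℕ∞) fun z : (ℝ × ℝ) × (ℝ × ℝ) => a z.1 z.2) (x ξ : ℝ × ℝ) :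
    xDeriv₁ r (interpError c B m N K a) x ξ = interpError c B m N K (xDeriv₁ r a) x ξ := by
  have h : ∀ η, ContDiff ℝ r fun y => normalize m a (y, x.2) η := fun η =>
    ((contDiff_normalize_space ha η).of_le (by exact_mod_cast le_top)).comp
      (contDiff_id.prodMk contDiff_const)
  simp only [interpError, hierInterp, ← xDeriv₁_normalize]
  exact iteratedDeriv_sum_mul_sub _ r _ (fun μ => h _) (h ξ) x.1

theorem xDeriv₂_interpError (c : ℕ → ℕ → ℝ → ℝ) (B : ℝ) (N K r : ℕ)
    (ha : ContDiff ℝ ((⊤ : ℕ∞) : WithTop ℕ∞) fun z : (ℝ × ℝ) × (ℝ × ℝ) => a z.1 z.2) (x ξ : ℝ × ℝ) :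
    xDeriv₂ r (interpError c B m N K a) x ξ = interpError c B m N K (xDeriv₂ r a) x ξ := by
  have h : ∀ η, ContDiff ℝ r fun y => normalize m a (x.1, y) η := fun η =>
    ((contDiff_normalize_space ha η).of_le (by exact_mod_cast le_top)).comp
      (contDiff_const.prodMk contDiff_id)
  simp only [interpError, hierInterp, ← xDeriv₂_normalize]
  exact iteratedDeriv_sum_mul_sub _ r _ (fun μ => h _) (h ξ) x.2

/-- The interpolant is a finite sum of values in `ξ` with weights independent of `x`, so it commutes
with the integral over `x`. -/
theorem squareCoeff_interpError (c : ℕ → ℕ → ℝ → ℝ) (B : ℝ) (N K : ℕ)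
    (ha : ContDiff ℝ ((⊤ : ℕ∞) : WithTop ℕ∞) fun z : (ℝ × ℝ) × (ℝ × ℝ) => a z.1 z.2) (l : ℤ × ℤ)
    (ξ : ℝ × ℝ) : squareCoeff (fun x => interpError c B m N K a x ξ) l
      = hierInterp c B N K (hCoeff m a l) ξ - hCoeff m a l ξ := by
  have hc : ∀ η, Continuous fun x => expo (-l) x * normalize m a x η := fun η =>
    (continuous_expo _).mul (contDiff_normalize_space ha η).continuous
  have hi : ∀ (η : ℝ × ℝ) (κ : ℂ),
      IntegrableOn (fun x => expo (-l) x * normalize m a x η * κ) unitSquare := fun η κ =>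
    integrableOn_unitSquare ((hc η).mul continuous_const)
  simp only [squareCoeff, interpError, hierInterp, mul_sub, Finset.mul_sum, ← mul_assoc]
  rw [integral_sub (integrable_finsetSum _ fun μ _ => hi _ _) (integrableOn_unitSquare (hc ξ)),
    integral_finsetSum _ fun μ _ => hi _ _]
  simp only [integral_mul_const, hCoeff_eq_squareCoeff, squareCoeff]

/-- A bound for the Fourier coefficients of a smooth periodic family in terms of the derivatives of
order `2 s`. -/
theorem norm_squareCoeff_family_mul_le (s : ℕ) {G : ℝ × ℝ → ℝ × ℝ → ℂ} {ξ : ℝ × ℝ}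
    (hG : ContDiff ℝ ((⊤ : ℕ∞) : WithTop ℕ∞) fun x => G x ξ)
    (hp : ∀ (k : ℤ × ℤ) (x : ℝ × ℝ), G (x.1 + k.1, x.2 + k.2) ξ = G x ξ) {D : ℝ}
    (hD : ∀ x, ‖G x ξ‖ ≤ D) (hD₁ : ∀ x, ‖xDeriv₁ (2 * s) G x ξ‖ ≤ D)
    (hD₂ : ∀ x, ‖xDeriv₂ (2 * s) G x ξ‖ ≤ D) (l : ℤ × ℤ) :
    ‖squareCoeff (fun x => G x ξ) l‖ * freqWeight l ^ s ≤ 4 ^ s * D := by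
  have h : ContDiff ℝ (2 * s : ℕ) fun x => G x ξ := contDiff_infty.1 hG _
  exact norm_squareCoeff_mul_le s hG.continuous
    (fun y => h.comp (contDiff_id.prodMk contDiff_const))
    (fun x => h.comp (contDiff_const.prodMk contDiff_id))
    (fun y x => by simpa using hp (1, 0) (x, y)) (fun x y => by simpa using hp (0, 1) (x, y)) hD
    (fun x y => hD₁ (x, y)) (fun x y => hD₂ (x, y)) l

theorem IsSymbol.norm_hCoeff_mul_le (ha : IsSymbol m a) {n s : ℕ} {D : ℝ}
    (h₀ : ZeroOrderBound n D (normalize m a))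
    (h₁ : ZeroOrderBound n D (normalize m (xDeriv₁ (2 * s) a)))
    (h₂ : ZeroOrderBound n D (normalize m (xDeriv₂ (2 * s) a))) (l : ℤ × ℤ) (ξ : ℝ × ℝ) :
    ‖hCoeff m a l ξ‖ * freqWeight l ^ s ≤ 4 ^ s * D := by
  rw [hCoeff_eq_squareCoeff]
  refine norm_squareCoeff_family_mul_le s (contDiff_normalize_space ha.smooth ξ)
    (fun k x => by simp only [normalize, ha.periodic]) (fun x => (h₀ x).1 _ _) (fun x => ?_)
    (fun x => ?_) l
  · rw [xDeriv₁_normalize]; exact (h₁ x).1 _ _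
  · rw [xDeriv₂_normalize]; exact (h₂ x).1 _ _

/-- The interpolation error is itself smooth and periodic in `x`, and its `x`-derivatives are the
interpolation errors of the `x`-derivatives of `a`. Decay in `l` and accuracy in `K` are therefore
obtained together. -/
theorem IsSymbol.norm_hierInterp_hCoeff_sub_mul_le (ha : IsSymbol m a) {p s : ℕ} {D : ℝ}
    (h₀ : ZeroOrderBound (p + 1) D (normalize m a))
    (h₁ : ZeroOrderBound (p + 1) D (normalize m (xDeriv₁ (2 * s) a)))
    (h₂ : ZeroOrderBound (p + 1) D (normalize m (xDeriv₂ (2 * s) a)))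
    {c : ℕ → ℕ → ℝ → ℝ} {Λ : ℝ} (hp : 1 ≤ p)
    (hc : IsStableFamily p c Λ) {B : ℝ} (hB : 0 < B) {N K : ℕ} (hK : p + 1 ≤ K) (hN : 0 < N)
    {k : ℤ × ℤ} (hk : max |k.1| |k.2| ≤ (N : ℤ)) (l : ℤ × ℤ) :
    ‖hierInterp c B N K (hCoeff m a l) (toPlane k) - hCoeff m a l (toPlane k)‖ * freqWeight l ^ s
      ≤ 4 ^ s * ((Λ + Λ ^ 2) * 2 ^ (p + 1) * D / ((K : ℝ) - 1) ^ (p + 1)) := by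
  rw [← squareCoeff_interpError c B N K ha.smooth]
  refine norm_squareCoeff_family_mul_le s (contDiff_interpError c B N K ha.smooth _)
    (fun k x => by simp only [interpError, hierInterp, normalize, ha.periodic])
    (norm_interpError_le hp hc hB hK hN hk ha.smooth h₀) (fun x => ?_) (fun x => ?_) l
  · rw [xDeriv₁_interpError _ _ _ _ _ ha.smooth]
    exact norm_interpError_le hp hc hB hK hN hk (contDiff_xDeriv₁ ha.smooth _) h₁ x
  · rw [xDeriv₂_interpError _ _ _ _ _ ha.smooth]
    exact norm_interpError_le hp hc hB hK hN hk (contDiff_xDeriv₂ ha.smooth _) h₂ x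

end

/-! ### The operator norm of the truncation error -/

/-- The Fourier modes `l` in `(-b, b)²`. -/
def band (b : ℕ) : Finset (ℤ × ℤ) := Finset.Ioo (-(b : ℤ)) b ×ˢ Finset.Ioo (-(b : ℤ)) b

/-- The frequencies `k` with `max(|k₁|, |k₂|) ≤ N`. -/
def box (N : ℕ) : Finset (ℤ × ℤ) := Finset.Icc (-(N : ℤ)) N ×ˢ Finset.Icc (-(N : ℤ)) N

theorem mem_box {N : ℕ} {k : ℤ × ℤ} : k ∈ box N ↔ max |k.1| |k.2| ≤ (N : ℤ) := by
  simp [box, abs_le]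

theorem pdo_proj (a : ℝ × ℝ → ℝ × ℝ → ℂ) (N : ℕ) (fhat : ℤ × ℤ → ℂ) (x : ℝ × ℝ) :
    pdo a (proj N fhat) x = ∑ k ∈ box N, expo k x * a x (toPlane k) * fhat k := by
  rw [pdo, tsum_eq_sum (s := box N)]
  · exact Finset.sum_congr rfl fun k hk => by rw [proj, if_pos (mem_box.1 hk)]
  · intro k hk
    rw [proj, if_neg (mt mem_box.2 hk), mul_zero]

theorem IsSymbol.hasSum_hCoeff_mul_expo {m : ℝ} {a : ℝ × ℝ → ℝ × ℝ → ℂ} (ha : IsSymbol m a)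
    (x ξ : ℝ × ℝ) : HasSum (fun l => hCoeff m a l ξ * expo l x) (normalize m a x ξ) := by
  obtain ⟨D, h₀, h₁, h₂⟩ := ha.exists_zeroOrderBound 0 (2 * 2)
  simp only [hCoeff_eq_squareCoeff]
  refine hasSum_squareCoeff_mul_expo (contDiff_normalize_space ha.smooth ξ).continuous
    (fun k x => by simp only [normalize, ha.periodic]) ?_ x
  refine Summable.of_norm_bounded (summable_freqWeight.mul_left (4 ^ 2 * D)) fun l => ?_
  have hω : 0 < freqWeight l := one_pos.trans_le (one_le_freqWeight l)
  rw [← div_eq_mul_inv, le_div_iff₀ (by positivity), ← hCoeff_eq_squareCoeff]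
  exact ha.norm_hCoeff_mul_le (s := 2) h₀ h₁ h₂ l ξ

/-- The error of the coefficient of `e_l` in a truncated expansion. -/
def coeffError (c : ℕ → ℕ → ℝ → ℝ) (B m : ℝ) (a : ℝ × ℝ → ℝ × ℝ → ℂ) (N b : ℕ) (K : ℤ × ℤ → ℕ)
    (l : ℤ × ℤ) (ξ : ℝ × ℝ) : ℂ :=
  (if l ∈ band b then hierInterp c B N (K l) (hCoeff m a l) ξ else 0) - hCoeff m a l ξ

theorem expansion_retained (c : ℕ → ℕ → ℝ → ℝ) (B m : ℝ) (a : ℝ × ℝ → ℝ × ℝ → ℂ) (N b : ℕ)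
    (K : ℤ × ℤ → ℕ) (x ξ : ℝ × ℝ) : expansion c B m a (retained B N b K) x ξ
      = (∑ l ∈ band b, hierInterp c B N (K l) (hCoeff m a l) ξ * expo l x)
        * ((bracket ξ ^ m : ℝ) : ℂ) := by
  rw [expansion, retained, Finset.sum_sigma, Finset.sum_mul]
  refine Finset.sum_congr rfl fun l _ => ?_
  rw [hierInterp, Finset.sum_mul, Finset.sum_mul]
  exact Finset.sum_congr rfl fun μ _ => by ring

theorem normalize_mul_bracket (m : ℝ) (a : ℝ × ℝ → ℝ × ℝ → ℂ) (x ξ : ℝ × ℝ) :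
    normalize m a x ξ * ((bracket ξ ^ m : ℝ) : ℂ) = a x ξ := by
  rw [normalize, mul_assoc, ← Complex.ofReal_mul, ← Real.rpow_add (bracket_pos ξ), neg_add_cancel,
    Real.rpow_zero, Complex.ofReal_one, mul_one]

theorem IsSymbol.hasSum_coeffError {m : ℝ} {a : ℝ × ℝ → ℝ × ℝ → ℂ} (ha : IsSymbol m a)
    (c : ℕ → ℕ → ℝ → ℝ) (B : ℝ) (N b : ℕ) (K : ℤ × ℤ → ℕ) (x ξ : ℝ × ℝ) :
    HasSum (fun l => coeffError c B m a N b K l ξ * expo l x * ((bracket ξ ^ m : ℝ) : ℂ))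
      (expansion c B m a (retained B N b K) x ξ - a x ξ) := by
  rw [expansion_retained, ← normalize_mul_bracket m a x ξ, ← sub_mul]
  refine HasSum.mul_right _ ?_
  have h : HasSum (fun l => (if l ∈ band b then hierInterp c B N (K l) (hCoeff m a l) ξ else 0)
      * expo l x) (∑ l ∈ band b, hierInterp c B N (K l) (hCoeff m a l) ξ * expo l x) := by
    rw [Finset.sum_congr rfl fun l (hl : l ∈ band b) => show
      hierInterp c B N (K l) (hCoeff m a l) ξ * expo l x
        = (if l ∈ band b then hierInterp c B N (K l) (hCoeff m a l) ξ else 0) * expo l x by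
      rw [if_pos hl]]
    exact hasSum_sum_of_ne_finset_zero fun l hl => by rw [if_neg hl, zero_mul]
  exact (h.sub (ha.hasSum_hCoeff_mul_expo x ξ)).congr_fun fun l => by rw [coeffError, sub_mul]

/-- The Fourier multiplier `r(ξ)⟨ξ⟩^m` maps `H^m` to `L²` with norm at most the supremum of `|r|`.
-/
theorem MemSobolev.sum_sq_le {m : ℝ} {fhat : ℤ × ℤ → ℂ} (hf : MemSobolev m fhat)
    (s : Finset (ℤ × ℤ)) {r : ℤ × ℤ → ℂ} {w : ℝ} (hr : ∀ k ∈ s, ‖r k‖ ≤ w) :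
    ∑ k ∈ s, ‖r k * ((bracket (toPlane k) ^ m : ℝ) : ℂ) * fhat k‖ ^ 2
      ≤ (w * sobolevNorm m fhat) ^ 2 := by
  have hb : ∀ k, 0 ≤ bracket (toPlane k) ^ (2 * m) * ‖fhat k‖ ^ 2 := fun k =>
    mul_nonneg (Real.rpow_nonneg (bracket_pos _).le _) (sq_nonneg _)
  rw [mul_pow, sobolevNorm, Real.sq_sqrt (tsum_nonneg hb)]
  calc _ ≤ ∑ k ∈ s, w ^ 2 * (bracket (toPlane k) ^ (2 * m) * ‖fhat k‖ ^ 2) := by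
        refine Finset.sum_le_sum fun k hk => ?_
        have h2 : bracket (toPlane k) ^ (2 * m) = (bracket (toPlane k) ^ m) ^ 2 := by
          rw [mul_comm, Real.rpow_mul (bracket_pos _).le, Real.rpow_two]
        rw [norm_mul, norm_mul, Complex.norm_real, Real.norm_eq_abs, mul_pow, mul_pow, sq_abs, h2,
          mul_assoc]
        gcongr
        exact hr k hk
    _ = w ^ 2 * ∑ k ∈ s, bracket (toPlane k) ^ (2 * m) * ‖fhat k‖ ^ 2 := (Finset.mul_sum _ _ _).symm
    _ ≤ _ := by
        gcongr
        exact hf.sum_le_tsum s fun k _ => hb k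

/-- The difference of the operators is a sum over `l` of multiplications by `e_l` after Fourier
multipliers; each has norm at most `w l`. Thanks to `P_N` all sums over frequencies are finite. -/
theorem IsSymbol.opNormLE_of_coeffError {m : ℝ} {a : ℝ × ℝ → ℝ × ℝ → ℂ} (ha : IsSymbol m a)
    (c : ℕ → ℕ → ℝ → ℝ) (B : ℝ) (N b : ℕ) (K : ℤ × ℤ → ℕ) {w : ℤ × ℤ → ℝ} {W : ℝ}
    (hw : ∀ l, 0 ≤ w l) (hW : HasSum w W)
    (hr : ∀ l, ∀ k ∈ box N, ‖coeffError c B m a N b K l (toPlane k)‖ ≤ w l) :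
    OpNormLE m (fun fhat x => pdo (expansion c B m a (retained B N b K)) (proj N fhat) x -
      pdo a (proj N fhat) x) W := by
  intro fhat hf
  have hS : 0 ≤ sobolevNorm m fhat := Real.sqrt_nonneg _
  have hcont : Continuous fun x => ∑ k ∈ box N,
      expo k x * (expansion c B m a (retained B N b K) x (toPlane k) - a x (toPlane k)) * fhat k := by
    have h1 : ∀ ξ, Continuous fun x => a x ξ := fun ξ =>
      ha.smooth.continuous.comp (continuous_id.prodMk continuous_const)
    have h2 : ∀ ξ, Continuous fun x => expansion c B m a (retained B N b K) x ξ := fun ξ =>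
      continuous_finsetSum _ fun w _ => ((continuous_const.mul (continuous_expo _)).mul
        continuous_const).mul continuous_const
    exact continuous_finsetSum _ fun k _ => ((continuous_expo k).mul ((h2 _).sub (h1 _))).mul
      continuous_const
  have hT : (fun x => pdo (expansion c B m a (retained B N b K)) (proj N fhat) x -
      pdo a (proj N fhat) x) = fun x => ∑ k ∈ box N,
      expo k x * (expansion c B m a (retained B N b K) x (toPlane k) - a x (toPlane k)) * fhat k := by
    ext x
    rw [pdo_proj, pdo_proj, ← Finset.sum_sub_distrib]
    exact Finset.sum_congr rfl fun k _ => by ring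
  simp only [hT]
  refine ⟨hcont.aestronglyMeasurable, ?_⟩
  let g : ℤ × ℤ → ℤ × ℤ → ℂ := fun l k =>
    coeffError c B m a N b K l (toPlane k) * ((bracket (toPlane k) ^ m : ℝ) : ℂ) * fhat k
  have hg : ∀ l, Continuous fun x => ∑ k ∈ box N, expo k x * g l k := fun l =>
    continuous_finsetSum _ fun k _ => (continuous_expo k).mul continuous_const
  refine eLpNorm_le_of_hasSum (ι := ℤ × ℤ)
    (H := fun l x => expo l x * ∑ k ∈ box N, expo k x * g l k)
    (w := fun l => w l * sobolevNorm m fhat)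
    (fun l => ((continuous_expo l).mul (hg l)).aestronglyMeasurable) (fun x => ?_)
    (fun l => mul_nonneg (hw l) hS) (hW.mul_right _) (fun l => ?_)
  · have h := hasSum_sum (s := box N) fun k _ =>
      ((ha.hasSum_coeffError c B N b K x (toPlane k)).mul_left (expo k x)).mul_right (fhat k)
    refine h.congr_fun fun l => ?_
    rw [Finset.mul_sum]
    exact Finset.sum_congr rfl fun k _ => by simp only [g]; ring
  · rw [eLpNorm_congr_norm_ae (g := fun x => ∑ k ∈ box N, expo k x * g l k)
      (Filter.Eventually.of_forall fun x => by simp only [norm_mul, norm_expo, one_mul])]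
    exact eLpNorm_sum_expo_le _ _ (mul_nonneg (hw l) hS) (hf.sum_sq_le _ (hr l))

/-! ### The number of terms -/

/-- The bound has no additive constant: for `b = 0` the band is empty. The count can then stay below
a multiple of `τ²` even when `τ < 1`. -/
theorem card_band_le (b : ℕ) : ((band b).card : ℝ) ≤ 4 * (b : ℝ) ^ 2 := by
  have h : (Finset.Ioo (-(b : ℤ)) b).card ≤ 2 * b := by
    rw [Int.card_Ioo]; omega
  have h' : (band b).card ≤ 2 * b * (2 * b) := by
    rw [band, Finset.card_product]; exact Nat.mul_le_mul h h
  have h'' : ((band b).card : ℝ) ≤ ((2 * b * (2 * b) : ℕ) : ℝ) := by exact_mod_cast h'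
  push_cast at h''
  linarith

/-- The additive constants from `B` and from rounding are absorbed using `log N ≥ log 2`, which is
where `N ≥ 2` is needed. -/
theorem levels_le (B : ℝ) (hB : 0 < B) {N : ℕ} (hN : 2 ≤ N) :
    (levels B N : ℝ) ≤ (1 + (|Real.log B| + 1) / Real.log 2) * Real.log N := by
  have hN' : (2 : ℝ) ≤ N := by exact_mod_cast hN
  have hl2 : 0 < Real.log 2 := Real.log_pos (by norm_num)
  have hlN : Real.log 2 ≤ Real.log N := Real.log_le_log (by norm_num) hN'
  have hl3 : 1 ≤ Real.log 3 := by
    rw [Real.le_log_iff_exp_le (by norm_num)]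
    linarith [Real.exp_one_lt_d9]
  have h1 : |Real.logb 3 (N / B)| ≤ Real.log N + |Real.log B| := by
    rw [Real.logb, abs_div, abs_of_pos (by linarith : 0 < Real.log 3),
      Real.log_div (by positivity) hB.ne']
    refine (div_le_self (abs_nonneg _) hl3).trans ((abs_sub _ _).trans ?_)
    rw [abs_of_nonneg (by linarith : 0 ≤ Real.log N)]
  have h2 : (levels B N : ℝ) ≤ |Real.logb 3 (N / B)| + 1 :=
    (Nat.cast_le.2 (Nat.ceil_mono (le_abs_self _))).trans (Nat.ceil_lt_add_one (abs_nonneg _)).le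
  have h3 : |Real.log B| + 1 ≤ (|Real.log B| + 1) / Real.log 2 * Real.log N := by
    rw [div_mul_eq_mul_div, le_div_iff₀ hl2]
    gcongr
  linarith

theorem card_indices_le (B : ℝ) (N K : ℕ) : ((indices B N K).card : ℝ)
    ≤ ((Finset.Icc (-⌊B⌋) ⌊B⌋).card : ℝ) ^ 2 + levels B N * (9 * (K : ℝ) ^ 2) := by
  rw [indices, Finset.card_disjSum]
  simp only [Finset.card_product, Finset.card_singleton, Finset.card_range, one_mul]
  push_cast
  have h : ((Finset.univ.filter fun i : Fin 3 × Fin 3 => i ≠ (1, 1)).card : ℝ) ≤ 9 := by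
    exact_mod_cast (Finset.card_le_univ _).trans (by simp)
  rw [← pow_two, ← pow_two]
  gcongr

/-- The square of `K_l` is at most `2(p+2)² + 2τ²/ω_l²`. The first part is summed over the `O(τ²)`
modes of the band, the second against the convergent series `∑ ω_l^{-2}`; both give `τ²` per level.
-/
theorem card_retained_le (B : ℝ) (hB : 0 < B) (p N : ℕ) (hN : 2 ≤ N) {τ : ℝ} (hτ : 0 < τ)
    {S : ℝ} (hS : ∑' l : ℤ × ℤ, (freqWeight l ^ 2)⁻¹ = S) :
    ((retained B N ⌊τ⌋₊ fun l => p + 1 + ⌈τ / freqWeight l⌉₊).card : ℝ)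
      ≤ τ ^ 2 * ((4 * ((Finset.Icc (-⌊B⌋) ⌊B⌋).card : ℝ) ^ 2 / Real.log 2
        + 9 * (1 + (|Real.log B| + 1) / Real.log 2) * (8 * ((p : ℝ) + 2) ^ 2 + 2 * S))
          * Real.log N) := by
  have hN' : (2 : ℝ) ≤ N := by exact_mod_cast hN
  have hl2 : 0 < Real.log 2 := Real.log_pos (by norm_num)
  have hlN : Real.log 2 ≤ Real.log N := Real.log_le_log (by norm_num) hN'
  have hω : ∀ l, 0 < freqWeight l := fun l => one_pos.trans_le (one_le_freqWeight l)
  set q : ℝ := ((Finset.Icc (-⌊B⌋) ⌊B⌋).card : ℝ)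
  set L : ℝ := (levels B N : ℝ)
  have hL : L ≤ (1 + (|Real.log B| + 1) / Real.log 2) * Real.log N := levels_le B hB hN
  have hL0 : 0 ≤ L := Nat.cast_nonneg _
  have hband : ((band ⌊τ⌋₊).card : ℝ) ≤ 4 * τ ^ 2 := (card_band_le _).trans (by
    gcongr
    exact Nat.floor_le hτ.le)
  have hterm : ∀ l, ((indices B N (p + 1 + ⌈τ / freqWeight l⌉₊)).card : ℝ)
      ≤ q ^ 2 + L * (9 * (2 * ((p : ℝ) + 2) ^ 2 + 2 * τ ^ 2 * (freqWeight l ^ 2)⁻¹)) := by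
    intro l
    refine (card_indices_le B N _).trans ?_
    have hy0 : 0 ≤ τ / freqWeight l := (div_pos hτ (hω l)).le
    have h1 : ((p + 1 + ⌈τ / freqWeight l⌉₊ : ℕ) : ℝ) ≤ (p + 2) + τ / freqWeight l := by
      push_cast
      linarith [(Nat.ceil_lt_add_one hy0).le]
    have h2 : ((p + 1 + ⌈τ / freqWeight l⌉₊ : ℕ) : ℝ) ^ 2
        ≤ 2 * ((p : ℝ) + 2) ^ 2 + 2 * τ ^ 2 * (freqWeight l ^ 2)⁻¹ := by
      refine (pow_le_pow_left₀ (Nat.cast_nonneg _) h1 2).trans ?_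
      have h3 : 2 * τ ^ 2 * (freqWeight l ^ 2)⁻¹ = 2 * (τ / freqWeight l) ^ 2 := by
        rw [div_pow]; ring
      rw [h3]
      nlinarith [sq_nonneg ((p : ℝ) + 2 - τ / freqWeight l)]
    gcongr
  have hsum : ∑ l ∈ band ⌊τ⌋₊, (freqWeight l ^ 2)⁻¹ ≤ S :=
    hS ▸ summable_freqWeight.sum_le_tsum _ fun l _ => by have := hω l; positivity
  have hS0 : 0 ≤ S := (Finset.sum_nonneg fun l _ => by have := hω l; positivity).trans hsum
  have hcard : ((retained B N ⌊τ⌋₊ fun l => p + 1 + ⌈τ / freqWeight l⌉₊).card : ℝ)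
      = ∑ l ∈ band ⌊τ⌋₊, ((indices B N (p + 1 + ⌈τ / freqWeight l⌉₊)).card : ℝ) := by
    rw [retained, Finset.card_sigma, Nat.cast_sum]; rfl
  rw [hcard]
  have h4 : 4 * q ^ 2 ≤ 4 * q ^ 2 / Real.log 2 * Real.log N := by
    rw [div_mul_eq_mul_div, le_div_iff₀ hl2]
    gcongr
  calc _ ≤ ∑ l ∈ band ⌊τ⌋₊,
        (q ^ 2 + L * (9 * (2 * ((p : ℝ) + 2) ^ 2 + 2 * τ ^ 2 * (freqWeight l ^ 2)⁻¹))) :=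
        Finset.sum_le_sum fun l _ => hterm l
    _ = (band ⌊τ⌋₊).card * (q ^ 2 + L * (18 * ((p : ℝ) + 2) ^ 2))
        + L * (18 * τ ^ 2) * ∑ l ∈ band ⌊τ⌋₊, (freqWeight l ^ 2)⁻¹ := by
        rw [← nsmul_eq_mul, ← Finset.sum_const, Finset.mul_sum, ← Finset.sum_add_distrib]
        exact Finset.sum_congr rfl fun l _ => by ring
    _ ≤ 4 * τ ^ 2 * (q ^ 2 + L * (18 * ((p : ℝ) + 2) ^ 2)) + L * (18 * τ ^ 2) * S := by gcongr
    _ = τ ^ 2 * (4 * q ^ 2 + 9 * L * (8 * ((p : ℝ) + 2) ^ 2 + 2 * S)) := by ring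
    _ ≤ τ ^ 2 * (4 * q ^ 2 / Real.log 2 * Real.log N + 9 *
          ((1 + (|Real.log B| + 1) / Real.log 2) * Real.log N) *
            (8 * ((p : ℝ) + 2) ^ 2 + 2 * S)) := by gcongr
    _ = _ := by ring

/-- With grids of size `⌈τ / ω_l⌉ + p + 1` and the band `τ`, the coefficients of the truncated
expansion have errors of size `τ^{-(p+1)}`, summable in `l`. -/
theorem IsSymbol.norm_coeffError_le {m : ℝ} {a : ℝ × ℝ → ℝ × ℝ → ℂ} (ha : IsSymbol m a) {p : ℕ}
    {D : ℝ} (h₀ : ZeroOrderBound (p + 1) D (normalize m a))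
    (h₁ : ZeroOrderBound (p + 1) D (normalize m (xDeriv₁ (2 * (p + 3)) a)))
    (h₂ : ZeroOrderBound (p + 1) D (normalize m (xDeriv₂ (2 * (p + 3)) a)))
    {c : ℕ → ℕ → ℝ → ℝ} {Λ : ℝ} (hp : 1 ≤ p) (hc : IsStableFamily p c Λ) {B : ℝ} (hB : 0 < B)
    {N : ℕ} (hN : 0 < N) {k : ℤ × ℤ} (hk : k ∈ box N) {τ : ℝ} (hτ : 0 < τ) (l : ℤ × ℤ) :
    ‖coeffError c B m a N ⌊τ⌋₊ (fun l => p + 1 + ⌈τ / freqWeight l⌉₊) l (toPlane k)‖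
      ≤ (4 ^ (p + 3) * D * ((Λ + Λ ^ 2) * 2 ^ (p + 1) + 1) + 1) / τ ^ (p + 1)
        * (freqWeight l ^ 2)⁻¹ := by
  have hω : 0 < freqWeight l := one_pos.trans_le (one_le_freqWeight l)
  have hΛ := hc.pos
  have hD0 : 0 ≤ D := (norm_nonneg _).trans ((h₀ 0).1 0 0)
  rw [← div_eq_mul_inv, div_div, le_div_iff₀ (by positivity)]
  by_cases hl : l ∈ band ⌊τ⌋₊
  · rw [coeffError, if_pos hl]
    set K : ℕ := p + 1 + ⌈τ / freqWeight l⌉₊ with hK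
    have hK1 : τ / freqWeight l ≤ (K : ℝ) - 1 := by
      rw [hK]; push_cast
      linarith [Nat.le_ceil (τ / freqWeight l), (Nat.cast_nonneg p : (0 : ℝ) ≤ p)]
    have hpos : 0 < τ / freqWeight l := div_pos hτ hω
    have h := ha.norm_hierInterp_hCoeff_sub_mul_le h₀ h₁ h₂ hp hc hB (K := K) (by omega) hN
      (mem_box.1 hk) l
    set r := ‖hierInterp c B N K (hCoeff m a l) (toPlane k) - hCoeff m a l (toPlane k)‖
    have hKp : (τ / freqWeight l) ^ (p + 1) ≤ ((K : ℝ) - 1) ^ (p + 1) := by gcongr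
    have hpp : 0 < (τ / freqWeight l) ^ (p + 1) := by positivity
    have h' : r * freqWeight l ^ (p + 3) * (τ / freqWeight l) ^ (p + 1)
        ≤ 4 ^ (p + 3) * ((Λ + Λ ^ 2) * 2 ^ (p + 1) * D) := by
      refine (mul_le_mul_of_nonneg_left hKp (by positivity)).trans ?_
      refine (mul_le_mul_of_nonneg_right h (hpp.trans_le hKp).le).trans_eq ?_
      rw [mul_assoc, div_mul_cancel₀ _ (hpp.trans_le hKp).ne']
    -- Of the `p + 3` powers of `ω_l`, `p + 1` pay for the coarser grid of the mode `l` and two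
    -- remain for the summation over `l`.
    have h3 : r * freqWeight l ^ (p + 3) * (τ / freqWeight l) ^ (p + 1)
        = r * (τ ^ (p + 1) * freqWeight l ^ 2) := by
      rw [div_pow, show p + 3 = (p + 1) + 2 by ring, pow_add]
      field_simp
    rw [h3] at h'
    nlinarith [show 0 ≤ 4 ^ (p + 3) * D by positivity]
  · rw [coeffError, if_neg hl, zero_sub, norm_neg]
    have h := ha.norm_hCoeff_mul_le h₀ h₁ h₂ l (toPlane k)
    -- Outside the band some `|l_i|` is at least `⌊τ⌋`, and the `1` in the weight compensates for
    -- the rounding.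
    have hτω : τ ≤ freqWeight l := by
      have hb : (⌊τ⌋₊ : ℝ) ≤ max |(l.1 : ℝ)| |(l.2 : ℝ)| := by
        by_contra hcon
        rw [not_le, max_lt_iff] at hcon
        refine hl (Finset.mem_product.2 ⟨Finset.mem_Ioo.2 (abs_lt.1 ?_), Finset.mem_Ioo.2 (abs_lt.1 ?_)⟩)
        · exact_mod_cast hcon.1
        · exact_mod_cast hcon.2
      linarith [one_add_max_le_freqWeight l, (Nat.lt_floor_add_one τ).le]
    calc _ ≤ ‖hCoeff m a l (toPlane k)‖ * (freqWeight l ^ (p + 1) * freqWeight l ^ 2) := by gcongr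
      _ ≤ 4 ^ (p + 3) * D := by rw [← pow_add]; exact h
      _ ≤ _ := by
        have : 0 ≤ 4 ^ (p + 3) * D * ((Λ + Λ ^ 2) * 2 ^ (p + 1)) := by positivity
        linarith

end HierSpline

end

/-! ### Choice of the parameters. -/

theorem theorem2 (p : ℕ) (hp : 1 ≤ p) (B : ℝ) (hB : 0 < B) (m : ℝ)
    (a : ℝ × ℝ → ℝ × ℝ → ℂ) (ha : HierSpline.IsSymbol m a) :
    ∃ c : ℕ → ℕ → ℝ → ℝ, HierSpline.IsCardinalFamily p c ∧
      ∃ C : ℝ, 0 < C ∧ ∀ (N : ℕ) (ε : ℝ), 2 ≤ N → 0 < ε →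
        ∃ M : ℕ, (M : ℝ) ≤ C * ε ^ (-(2 / ((p : ℝ) + 1))) * Real.log N ∧
          ∃ (b : ℕ) (K : ℤ × ℤ → ℕ), (∀ l, p + 1 ≤ K l) ∧
            (HierSpline.retained B N b K).card ≤ M ∧
            HierSpline.OpNormLE m
              (fun fhat x =>
                HierSpline.pdo (HierSpline.expansion c B m a (HierSpline.retained B N b K))
                    (HierSpline.proj N fhat) x -
                  HierSpline.pdo a (HierSpline.proj N fhat) x) ε := by
  obtain ⟨c, hcard, Λ, hΛ, hleb, herr⟩ := HierSpline.exists_cardinalFamily p hp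
  have hc : HierSpline.IsStableFamily p c Λ := ⟨hΛ, hleb, herr⟩
  obtain ⟨D, h₀, h₁, h₂⟩ := ha.exists_zeroOrderBound (p + 1) (2 * (p + 3))
  have hD0 : 0 ≤ D := (norm_nonneg _).trans ((h₀ 0).1 0 0)
  -- The final `+ 1` keeps `A` positive when `D = 0`.
  set A : ℝ := 4 ^ (p + 3) * D * ((Λ + Λ ^ 2) * 2 ^ (p + 1) + 1) + 1 with hA
  have hA0 : 0 < A := by positivity
  set S : ℝ := ∑' l : ℤ × ℤ, (HierSpline.freqWeight l ^ 2)⁻¹ with hS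
  have hω : ∀ l, 0 < HierSpline.freqWeight l := fun l =>
    one_pos.trans_le (HierSpline.one_le_freqWeight l)
  have hS0 : 0 < S := HierSpline.summable_freqWeight.tsum_pos
    (fun l => by have := hω l; positivity) 0 (by have := hω 0; positivity)
  have hl2 : 0 < Real.log 2 := Real.log_pos (by norm_num)
  set E : ℝ := 4 * ((Finset.Icc (-⌊B⌋) ⌊B⌋).card : ℝ) ^ 2 / Real.log 2
    + 9 * (1 + (|Real.log B| + 1) / Real.log 2) * (8 * ((p : ℝ) + 2) ^ 2 + 2 * S) with hE
  have hE0 : 0 < E := by positivity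
  have hp1 : (0 : ℝ) < p + 1 := by positivity
  refine ⟨c, hcard, (A * S) ^ (2 / ((p : ℝ) + 1)) * E, by positivity, fun N ε hN hε => ?_⟩
  -- Chosen so that the coefficient errors `A τ^{-(p+1)} ω_l^{-2}` sum to exactly `ε`.
  set τ : ℝ := (A * S / ε) ^ (1 / ((p : ℝ) + 1)) with hτ
  have hτ0 : 0 < τ := by positivity
  have hτp : τ ^ (p + 1) = A * S / ε := by
    rw [hτ, ← Real.rpow_natCast, ← Real.rpow_mul (by positivity)]
    push_cast
    rw [one_div, inv_mul_cancel₀ hp1.ne', Real.rpow_one]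
  have hτ2 : τ ^ 2 = (A * S) ^ (2 / ((p : ℝ) + 1)) * ε ^ (-(2 / ((p : ℝ) + 1))) := by
    rw [hτ, ← Real.rpow_natCast, ← Real.rpow_mul (by positivity), Real.rpow_neg hε.le,
      ← div_eq_mul_inv, ← Real.div_rpow (by positivity) hε.le]
    congr 1
    push_cast; ring
  refine ⟨_, ?_, ⌊τ⌋₊, fun l => p + 1 + ⌈τ / HierSpline.freqWeight l⌉₊, fun l => Nat.le_add_right _ _,
    le_rfl, ?_⟩
  · refine (HierSpline.card_retained_le B hB p N hN hτ0 hS.symm).trans_eq ?_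
    rw [hτ2, ← hE]
    ring
  · have hW : HasSum (fun l => A / τ ^ (p + 1) * (HierSpline.freqWeight l ^ 2)⁻¹) ε := by
      have h := HierSpline.summable_freqWeight.hasSum.mul_left (A / τ ^ (p + 1))
      rw [hτp] at h ⊢
      rwa [← hS, show A / (A * S / ε) * S = ε by field_simp] at h
    exact ha.opNormLE_of_coeffError c B N _ _ (fun l => by have := hω l; positivity) hW
      fun l k hk => ha.norm_coeffError_le h₀ h₁ h₂ hp hc hB (by omega) hk hτ0 l
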